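/- Conventions. All CW complexes are finite. A $d$-deformation is a finite composition of elementary expansions, elementary collapses and cellular isomorphisms through CW complexes of dimension at most $d$; here a CW complex $Y$ is an elementary expansion of a subcomplex $X$ if $Y=X\cup e\cup e'$ with cells $e$, $e'$ of dimensions $m$, $m+1$, and some characteristic map $[-1,1]^{m+1}\to Y$ of $e'$ restricts on one $m$-face of the cube to a characteristic map of $e$ and maps all other $m$-faces into $X$. A 2-complex is a CW complex of dimension at most $2$. For $n\ge 0$ let $\mathcal K_n$ be the set of equivalence classes of 2-complexes together with a cellular identification of a subgraph of the 1-skeleton (the boundary) with the wedge $\vee^n S^1$ of $n$ ordered circles, up to 3-deformations restricting to the identity on $\vee^n S^1$. The product $A\cdot B$ of $A,B\in\mathcal K_n$ is the class of the union of the two complexes along the common boundary $\vee^nS^1$. For a commutative ring $k$ let $k\mathcal K_n$ be the free $k$-module on $\mathcal K_n$ with the $k$-bilinear extension of this product. The universal pairing $\langle x,y\rangle$ of $x,y\in k\mathcal K_n$ is the image of $x\cdot y$ under the $k$-linear map induced by forgetting the boundary; it takes values in the free $k$-module on the set of 2-complexes without boundary, up to 3-deformations. Theorem. Let $L_1,L_2$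 be connected 2-complexes with $\pi_1(L_1)\cong\pi_1(L_2)$ and $\chi(L_1)=\chi(L_2)$. Then there are $n\ge 0$ and 2-complexes $L_1',L_2'$, each with its entire 1-skeleton identified with $\vee^nS^1$, so that they represent elements of $\mathcal K_n$, such that: (i) for $i=1,2$, $L_i$ is 3-deformation equivalent to $L_i'$; (ii) for every commutative ring $k$, the element $x:=L_1'-L_2'\in k\mathcal K_n$ satisfies $x\cdot x=0$, so in particular $\langle x,x\rangle=0$. -/

import Mathlib

open Topology Metric Set

/-! ## Finite CW complexes, expansions and deformations -/

/-- A finite CW complex: a Hausdorff space with a (finite) CW structure on the whole space. -/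
structure FinCW where
  carrier : Type
  [top : TopologicalSpace carrier]
  [t2 : T2Space carrier]
  [cw : CWComplex (univ : Set carrier)]
  [fin : CWComplex.Finite (univ : Set carrier)]

namespace FinCW

instance : CoeSort FinCW Type := ⟨carrier⟩

attribute [instance] FinCW.top FinCW.t2 FinCW.cw FinCW.fin

/-- The `m`-cells of `X`. -/
abbrev Cell (X : FinCW) (m : ℕ) : Type := RelCWComplex.cell (univ : Set X) m

/-- The open cell, as a subset of the space. -/
abbrev openCell (X : FinCW) {m : ℕ} (i : X.Cell m) : Set X :=
  RelCWComplex.openCell (C := (univ : Set X)) m i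

/-- All cells of `X` have dimension at most `d`. -/
def DimLE (X : FinCW) (d : ℕ) : Prop := ∀ m, d < m → IsEmpty (X.Cell m)

/-- The Euler characteristic, the alternating sum of the numbers of cells. -/
noncomputable def eulerChar (X : FinCW) : ℤ := ∑ᶠ m : ℕ, (-1) ^ m * (Nat.card (X.Cell m) : ℤ)

/-- `f` is an isomorphism of `X` onto a subcomplex of `Y`: a continuous injection (hence a closed
embedding, by compactness) which maps every open cell onto an open cell of the same dimension. -/
structure IsCellEmbedding {X Y : FinCW} (f : X → Y) : Prop where
  continuous : Continuous f
  injective : Function.Injective f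
  cell : ∀ (m : ℕ) (i : X.Cell m), ∃ j : Y.Cell m, f '' X.openCell i = Y.openCell j

/-- A cellular isomorphism. -/
def IsCellIso {X Y : FinCW} (f : X → Y) : Prop :=
  IsCellEmbedding f ∧ Function.Surjective f

/-- `Y` is an elementary expansion of its subcomplex `f(X)` (and `f(X)` an elementary collapse of
`Y`): `Y = f(X) ∪ e ∪ e'` with two further cells `e` of dimension `m` and `e'` of dimension
`m + 1`, and there is a map `φ` of the cube `[-1,1]^(m+1)` to `Y` which is a characteristic map of
`e'`, which restricts on the face `x 0 = 1` to a characteristic map of `e`, and which maps the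
other faces into `f(X)`. Here `closedBall 0 1`, `ball 0 1` and `sphere 0 1` in `Fin k → ℝ` are the
cube, its interior and its boundary; that `φ` and its restriction to the face are homeomorphisms
of the open cubes onto the open cells follows by compactness from the conditions below. -/
def IsElemExpansion {X Y : FinCW} (f : X → Y) : Prop :=
  IsCellEmbedding f ∧
  ∃ (m : ℕ) (e : Y.Cell m) (e' : Y.Cell (m + 1)) (φ : (Fin (m + 1) → ℝ) → Y),
    Disjoint (Y.openCell e) (range f) ∧
    Disjoint (Y.openCell e') (range f) ∧
    range f ∪ Y.openCell e ∪ Y.openCell e' = univ ∧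
    ContinuousOn φ (closedBall 0 1) ∧
    InjOn φ (ball 0 1) ∧ φ '' ball 0 1 = Y.openCell e' ∧
    InjOn (fun y : Fin m → ℝ => φ (Fin.cons 1 y)) (ball 0 1) ∧
    (fun y : Fin m → ℝ => φ (Fin.cons 1 y)) '' ball 0 1 = Y.openCell e ∧
    ∀ x ∈ sphere (0 : Fin (m + 1) → ℝ) 1,
      (¬ ∃ y ∈ ball (0 : Fin m → ℝ) 1, x = Fin.cons 1 y) → φ x ∈ range f

/-- One step of a `d`-deformation: a cellular isomorphism or an elementary expansion, between
complexes of dimension at most `d`. -/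
def Step (d : ℕ) (X Y : FinCW) : Prop :=
  X.DimLE d ∧ Y.DimLE d ∧ ∃ f : X → Y, IsCellIso f ∨ IsElemExpansion f

/-- `d`-deformation equivalence: finite compositions of cellular isomorphisms, elementary
expansions and elementary collapses through complexes of dimension at most `d`. -/
def Deform (d : ℕ) : FinCW → FinCW → Prop := Relation.EqvGen (Step d)

end FinCW

/-! ## Complexes with boundary a wedge of circles -/

/-- The wedge of `n` ordered circles: the points of the torus with at most one coordinate
different from `1`. For `n = 0` it is a point. -/
def WedgeCircles (n : ℕ) : Type :=
  {z : Fin n → Circle // ∀ i j, i ≠ j → z i = 1 ∨ z j = 1}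

namespace WedgeCircles

instance (n : ℕ) : TopologicalSpace (WedgeCircles n) :=
  inferInstanceAs (TopologicalSpace {z : Fin n → Circle // ∀ i j, i ≠ j → z i = 1 ∨ z j = 1})

/-- The wedge point. -/
noncomputable def base (n : ℕ) : WedgeCircles n := ⟨fun _ => 1, fun _ _ _ => Or.inl rfl⟩

/-- The `i`-th circle without the wedge point. -/
def openCircle {n : ℕ} (i : Fin n) : Set (WedgeCircles n) := {z | z.1 i ≠ 1}

theorem eq_base_or_mem {n : ℕ} (w : WedgeCircles n) : w = base n ∨ ∃ i, w ∈ openCircle i := by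
  by_cases h : ∃ i, w.1 i ≠ 1
  · exact Or.inr h
  · push Not at h
    exact Or.inl (Subtype.ext (funext h))

instance (n : ℕ) : CompactSpace (WedgeCircles n) := by
  have h : IsClosed {z : Fin n → Circle | ∀ i j, i ≠ j → z i = 1 ∨ z j = 1} := by
    have h' : {z : Fin n → Circle | ∀ i j, i ≠ j → z i = 1 ∨ z j = 1} =
        ⋂ (i) (j) (_ : i ≠ j), ({z | z i = 1} ∪ {z | z j = 1}) := by
      ext z
      simp
    rw [h']
    exact isClosed_iInter fun i => isClosed_iInter fun j => isClosed_iInter fun _ =>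
      (isClosed_eq (continuous_apply i) continuous_const).union
        (isClosed_eq (continuous_apply j) continuous_const)
  exact isCompact_iff_compactSpace.1 h.isCompact

end WedgeCircles

/-- A finite CW complex with a subgraph of its `1`-skeleton identified with the wedge of `n`
circles: `ι` maps the wedge point to a `0`-cell and each circle minus the wedge point onto an
open `1`-cell. -/
structure BdCW (n : ℕ) where
  cx : FinCW
  ι : WedgeCircles n → cx
  continuous_ι : Continuous ι
  injective_ι : Function.Injective ι
  base_ι : ∃ v : cx.Cell 0, ι '' {WedgeCircles.base n} = cx.openCell v
  circle_ι : ∀ i : Fin n, ∃ e : cx.Cell 1, ι '' WedgeCircles.openCircle i = cx.openCell e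

namespace BdCW

variable {n : ℕ}

/-- One step of a `d`-deformation which restricts to the identity on the wedge of circles. -/
def Step (d : ℕ) (A B : BdCW n) : Prop :=
  A.cx.DimLE d ∧ B.cx.DimLE d ∧
    ∃ f : A.cx → B.cx, (∀ w, f (A.ι w) = B.ι w) ∧
      (FinCW.IsCellIso f ∨ FinCW.IsElemExpansion f)

/-- `d`-deformation equivalence, restricting to the identity on the wedge of circles. -/
def Deform (d : ℕ) : BdCW n → BdCW n → Prop := Relation.EqvGen (Step d)

/-- The entire `1`-skeleton is the boundary wedge of circles. -/
def IsOneSkeleton (A : BdCW n) : Prop :=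
  range A.ι = (RelCWComplex.skeleton (univ : Set A.cx) 1 : Set A.cx)

end BdCW

/-! ## Union of two complexes along the common boundary -/

namespace FinCW

theorem compactSpace (X : FinCW) : CompactSpace X := by
  have h := CWComplex.union (C := (univ : Set X))
  constructor
  rw [← h]
  have hfin : Finite (Σ m, X.Cell m) :=
    CWComplex.finite_iff_finite_cells.1 inferInstance
  have h2 : (⋃ (m : ℕ) (j : X.Cell m), RelCWComplex.closedCell (C := (univ : Set X)) m j) =
      ⋃ p : Σ m, X.Cell m, RelCWComplex.closedCell (C := (univ : Set X)) p.1 p.2 := by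
    rw [iUnion_sigma]
  rw [h2]
  exact isCompact_iUnion fun p => RelCWComplex.isCompact_closedCell

instance (X : FinCW) : CompactSpace X := X.compactSpace

theorem exists_mem_openCell (X : FinCW) (x : X) : ∃ m, ∃ i : X.Cell m, x ∈ X.openCell i := by
  have h := CWComplex.iUnion_openCell_eq_complex (C := (univ : Set X))
  have hx : x ∈ (univ : Set X) := mem_univ x
  rw [← h] at hx
  simpa using hx

/-- The image of a characteristic map under a closed embedding. -/
noncomputable def pushMap {X M : Type} [Nonempty X] {k : ℕ} (e : PartialEquiv (Fin k → ℝ) X)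
    (g : X → M) (hg : Function.Injective g) : PartialEquiv (Fin k → ℝ) M :=
  e.trans (InjOn.toPartialEquiv g univ hg.injOn)

theorem pushMap_coe {X M : Type} [Nonempty X] {k : ℕ} (e : PartialEquiv (Fin k → ℝ) X)
    (g : X → M) (hg : Function.Injective g) : (pushMap e g hg : _ → M) = g ∘ e := rfl

theorem pushMap_source {X M : Type} [Nonempty X] {k : ℕ} (e : PartialEquiv (Fin k → ℝ) X)
    (g : X → M) (hg : Function.Injective g) : (pushMap e g hg).source = e.source := by
  change e.source ∩ e ⁻¹' univ = e.source
  simp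

theorem pushMap_continuousOn_symm {X M : Type} [TopologicalSpace X] [TopologicalSpace M]
    [Nonempty X] {k : ℕ} (e : PartialEquiv (Fin k → ℝ) X)
    (he : ContinuousOn e.symm e.target)
    (g : X → M) (hg : IsEmbedding g) :
    ContinuousOn (pushMap e g hg.injective).symm (pushMap e g hg.injective).target := by
  set p := InjOn.toPartialEquiv g univ hg.injective.injOn with hp
  have h1 : ContinuousOn p.symm p.target := by
    rw [hg.isInducing.continuousOn_iff]
    refine continuousOn_id.congr fun y hy => ?_
    exact p.right_inv hy
  change ContinuousOn (e.symm ∘ p.symm) (p.target ∩ p.symm ⁻¹' e.target)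
  exact he.comp (h1.mono inter_subset_left) fun y hy => hy.2

end FinCW

namespace BdCW

variable {n : ℕ}

theorem boundary_cell (A B : BdCW n) {m : ℕ} (i : A.cx.Cell m)
    (h : ¬ Disjoint (A.cx.openCell i) (range A.ι)) :
    ∃ (S : Set (WedgeCircles n)) (j : B.cx.Cell m),
      A.cx.openCell i = A.ι '' S ∧ B.cx.openCell j = B.ι '' S := by
  obtain ⟨_, hx, w, rfl⟩ := Set.not_disjoint_iff.1 h
  rcases WedgeCircles.eq_base_or_mem w with rfl | ⟨k, hk⟩
  · obtain ⟨v, hv⟩ := A.base_ι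
    obtain ⟨v', hv'⟩ := B.base_ι
    have hne : ¬ Disjoint (A.cx.openCell i) (A.cx.openCell v) :=
      Set.not_disjoint_iff.2 ⟨_, hx, hv ▸ mem_image_of_mem _ rfl⟩
    have heq := RelCWComplex.eq_of_not_disjoint_openCell hne
    cases heq
    exact ⟨_, v', hv.symm, hv'.symm⟩
  · obtain ⟨v, hv⟩ := A.circle_ι k
    obtain ⟨v', hv'⟩ := B.circle_ι k
    have hne : ¬ Disjoint (A.cx.openCell i) (A.cx.openCell v) :=
      Set.not_disjoint_iff.2 ⟨_, hx, hv ▸ mem_image_of_mem _ hk⟩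
    have heq := RelCWComplex.eq_of_not_disjoint_openCell hne
    cases heq
    exact ⟨_, v', hv.symm, hv'.symm⟩

theorem isClosedEmbedding_ι (A : BdCW n) : IsClosedEmbedding A.ι :=
  A.continuous_ι.isClosedEmbedding A.injective_ι

/-- The relation on the disjoint union which identifies the two copies of the boundary. -/
def glueRel (A B : BdCW n) : A.cx ⊕ B.cx → A.cx ⊕ B.cx → Prop
  | .inl x, .inl x' => x = x'
  | .inl x, .inr y => ∃ w, A.ι w = x ∧ B.ι w = y
  | .inr y, .inl x => ∃ w, A.ι w = x ∧ B.ι w = y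
  | .inr y, .inr y' => y = y'

def glueSetoid (A B : BdCW n) : Setoid (A.cx ⊕ B.cx) where
  r := glueRel A B
  iseqv := by
    have hA := A.injective_ι
    have hB := B.injective_ι
    refine ⟨?_, ?_, ?_⟩
    · rintro (x | x) <;> simp [glueRel]
    · rintro (x | x) (y | y) <;> simp only [glueRel] <;> grind
    · rintro (x | x) (y | y) (z | z) <;> simp only [glueRel]
      · grind
      · grind
      · rintro ⟨w, rfl, h⟩ ⟨w', rfl, h'⟩
        rw [hB (h.trans h'.symm)]
      · grind
      · grind
      · rintro ⟨w, h, rfl⟩ ⟨w', h', rfl⟩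
        rw [hA (h.trans h'.symm)]
      · grind
      · grind

/-- The union of the spaces of `A` and `B` along the common boundary. -/
def GlueSpace (A B : BdCW n) : Type := Quotient (glueSetoid A B)

namespace GlueSpace

variable (A B : BdCW n)

instance : TopologicalSpace (GlueSpace A B) :=
  inferInstanceAs (TopologicalSpace (Quotient (glueSetoid A B)))

def inl (x : A.cx) : GlueSpace A B := Quotient.mk (glueSetoid A B) (Sum.inl x)

def inr (y : B.cx) : GlueSpace A B := Quotient.mk (glueSetoid A B) (Sum.inr y)

variable {A B}

theorem inl_eq_inl {x x' : A.cx} : inl A B x = inl A B x' ↔ x = x' :=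
  Quotient.eq (r := glueSetoid A B)

theorem inr_eq_inr {y y' : B.cx} : inr A B y = inr A B y' ↔ y = y' :=
  Quotient.eq (r := glueSetoid A B)

theorem inl_eq_inr {x : A.cx} {y : B.cx} :
    inl A B x = inr A B y ↔ ∃ w, A.ι w = x ∧ B.ι w = y :=
  Quotient.eq (r := glueSetoid A B)

theorem inl_ι (w : WedgeCircles n) : inl A B (A.ι w) = inr A B (B.ι w) :=
  inl_eq_inr.2 ⟨w, rfl, rfl⟩

theorem ind {P : GlueSpace A B → Prop} (hl : ∀ x, P (inl A B x)) (hr : ∀ y, P (inr A B y))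
    (p : GlueSpace A B) : P p := by
  obtain ⟨x | y, rfl⟩ := Quotient.exists_rep p
  · exact hl x
  · exact hr y

theorem continuous_inl : Continuous (inl A B) := continuous_quotient_mk'.comp _root_.continuous_inl

theorem continuous_inr : Continuous (inr A B) := continuous_quotient_mk'.comp _root_.continuous_inr

/-- Maps out of the union. -/
def desc {Z : Type*} (g : A.cx → Z) (h : B.cx → Z) (hgh : ∀ w, g (A.ι w) = h (B.ι w)) :
    GlueSpace A B → Z :=
  Quotient.lift (Sum.elim g h) (by
    rintro (x | x) (y | y) hxy
    · exact congrArg g hxy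
    · obtain ⟨w, rfl, rfl⟩ := hxy
      exact hgh w
    · obtain ⟨w, rfl, rfl⟩ := hxy
      exact (hgh w).symm
    · exact congrArg h hxy)

theorem continuous_desc {Z : Type*} [TopologicalSpace Z] {g : A.cx → Z} {h : B.cx → Z}
    (hgh : ∀ w, g (A.ι w) = h (B.ι w)) (hg : Continuous g) (hh : Continuous h) :
    Continuous (desc g h hgh) :=
  Continuous.quotient_lift (hg.sumElim hh) _

theorem exists_separating (p q : GlueSpace A B) (hpq : p ≠ q) :
    ∃ F : GlueSpace A B → ℝ, Continuous F ∧ F p ≠ F q := by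
  have key : ∀ (C D : BdCW n) (x x' : C.cx), x ≠ x' →
      ∃ (g : C(C.cx, ℝ)) (h : C(D.cx, ℝ)), (∀ w, g (C.ι w) = h (D.ι w)) ∧ g x ≠ g x' := by
    intro C D x x' hx
    obtain ⟨g, hg0, hg1, -⟩ := exists_continuous_zero_one_of_isClosed
      (isClosed_singleton (x := x)) (isClosed_singleton (x := x')) (by simpa using hx)
    obtain ⟨h, hh⟩ := ContinuousMap.exists_extension' D.isClosedEmbedding_ι
      (g.comp ⟨C.ι, C.continuous_ι⟩)
    refine ⟨g, h, fun w => (congrFun hh w).symm, ?_⟩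
    rw [hg0 rfl, hg1 rfl]
    simp
  induction p using ind with
  | hl x =>
    induction q using ind with
    | hl x' =>
      obtain ⟨g, h, hgh, hne⟩ := key A B x x' (fun e => hpq (by rw [e]))
      exact ⟨desc g h hgh, continuous_desc _ g.continuous h.continuous, hne⟩
    | hr y =>
      by_cases hx : x ∈ range A.ι
      · obtain ⟨w, rfl⟩ := hx
        obtain ⟨g, h, hgh, hne⟩ := key B A (B.ι w) y (fun e => hpq (by rw [← e, inl_ι]))
        refine ⟨desc h g fun w => (hgh w).symm,
          continuous_desc _ h.continuous g.continuous, ?_⟩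
        rw [inl_ι]
        exact hne
      · obtain ⟨g, hg0, hg1, -⟩ := exists_continuous_zero_one_of_isClosed
          (isClosed_singleton (x := x)) A.isClosedEmbedding_ι.isClosed_range (by simpa using hx)
        refine ⟨desc g (fun _ => 1) fun w => hg1 (mem_range_self w),
          continuous_desc _ g.continuous continuous_const, ?_⟩
        change g x ≠ 1
        rw [hg0 rfl]
        simp
  | hr y =>
    induction q using ind with
    | hr y' =>
      obtain ⟨g, h, hgh, hne⟩ := key B A y y' (fun e => hpq (by rw [e]))
      exact ⟨desc h g fun w => (hgh w).symm, continuous_desc _ h.continuous g.continuous, hne⟩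
    | hl x =>
      by_cases hx : x ∈ range A.ι
      · obtain ⟨w, rfl⟩ := hx
        obtain ⟨g, h, hgh, hne⟩ := key B A y (B.ι w) (fun e => hpq (by rw [e, inl_ι]))
        refine ⟨desc h g fun w => (hgh w).symm,
          continuous_desc _ h.continuous g.continuous, ?_⟩
        rw [inl_ι]
        exact hne
      · obtain ⟨g, hg0, hg1, -⟩ := exists_continuous_zero_one_of_isClosed
          (isClosed_singleton (x := x)) A.isClosedEmbedding_ι.isClosed_range (by simpa using hx)
        refine ⟨desc g (fun _ => 1) fun w => hg1 (mem_range_self w),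
          continuous_desc _ g.continuous continuous_const, ?_⟩
        change 1 ≠ g x
        rw [hg0 rfl]
        simp

instance : T2Space (GlueSpace A B) := by
  refine ⟨fun p q hpq => ?_⟩
  obtain ⟨F, hF, hne⟩ := exists_separating p q hpq
  exact separated_by_continuous hF hne

theorem isEmbedding_inl : IsEmbedding (inl A B) :=
  (continuous_inl.isClosedEmbedding fun _ _ h => inl_eq_inl.1 h).isEmbedding

theorem isEmbedding_inr : IsEmbedding (inr A B) :=
  (continuous_inr.isClosedEmbedding fun _ _ h => inr_eq_inr.1 h).isEmbedding

theorem inl_injective : Function.Injective (inl A B) := isEmbedding_inl.injective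

theorem inr_injective : Function.Injective (inr A B) := isEmbedding_inr.injective

variable (A B)

/-- The cells of the union: those of `A`, and those of `B` outside the boundary. -/
def Cell (m : ℕ) : Type :=
  A.cx.Cell m ⊕ {j : B.cx.Cell m // Disjoint (B.cx.openCell j) (range B.ι)}

/-- The characteristic maps of the union are those of `A` and `B`. -/
noncomputable def cellMap (m : ℕ) : Cell A B m → PartialEquiv (Fin m → ℝ) (GlueSpace A B)
  | .inl i =>
    haveI : Nonempty A.cx := ⟨RelCWComplex.map (C := (univ : Set A.cx)) m i 0⟩
    FinCW.pushMap (RelCWComplex.map (C := (univ : Set A.cx)) m i) (inl A B) inl_injective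
  | .inr j =>
    haveI : Nonempty B.cx := ⟨RelCWComplex.map (C := (univ : Set B.cx)) m j.1 0⟩
    FinCW.pushMap (RelCWComplex.map (C := (univ : Set B.cx)) m j.1) (inr A B) inr_injective

variable {A B}

theorem cellMap_inl_image (m : ℕ) (i : A.cx.Cell m) (s : Set (Fin m → ℝ)) :
    cellMap A B m (.inl i) '' s =
      inl A B '' (RelCWComplex.map (C := (univ : Set A.cx)) m i '' s) := by
  rw [← image_comp]
  rfl

theorem cellMap_inr_image (m : ℕ)
    (j : {j : B.cx.Cell m // Disjoint (B.cx.openCell j) (range B.ι)}) (s : Set (Fin m → ℝ)) :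
    cellMap A B m (.inr j) '' s =
      inr A B '' (RelCWComplex.map (C := (univ : Set B.cx)) m j.1 '' s) := by
  rw [← image_comp]
  rfl

/-- Every open cell of `B` becomes an open cell of the union. -/
theorem exists_cell_inr {m : ℕ} (j : B.cx.Cell m) :
    ∃ c : Cell A B m, cellMap A B m c '' ball 0 1 = inr A B '' B.cx.openCell j := by
  by_cases h : Disjoint (B.cx.openCell j) (range B.ι)
  · exact ⟨.inr ⟨j, h⟩, cellMap_inr_image m ⟨j, h⟩ _⟩
  · obtain ⟨S, i, hS, hi⟩ := boundary_cell B A j h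
    refine ⟨.inl i, ?_⟩
    rw [cellMap_inl_image]
    change inl A B '' A.cx.openCell i = _
    rw [hi, hS, image_image, image_image]
    simp only [inl_ι]

end GlueSpace

open GlueSpace in
/-- The CW structure of the union. -/
noncomputable instance instCWGlue (A B : BdCW n) : CWComplex (univ : Set (GlueSpace A B)) :=
  CWComplex.mkFinite univ (Cell A B) (cellMap A B)
    (by
      have hA : ∀ᶠ m in Filter.atTop, IsEmpty (A.cx.Cell m) :=
        RelCWComplex.FiniteDimensional.eventually_isEmpty_cell
      have hB : ∀ᶠ m in Filter.atTop, IsEmpty (B.cx.Cell m) :=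
        RelCWComplex.FiniteDimensional.eventually_isEmpty_cell
      filter_upwards [hA, hB] with m h1 h2
      have : IsEmpty {j : B.cx.Cell m // Disjoint (B.cx.openCell j) (range B.ι)} :=
        ⟨fun j => h2.false j.1⟩
      exact instIsEmptySum)
    (fun m => by
      have h1 : Finite (A.cx.Cell m) := RelCWComplex.FiniteType.finite_cell m
      have h2 : Finite (B.cx.Cell m) := RelCWComplex.FiniteType.finite_cell m
      exact Finite.instSum)
    (by
      rintro m (i | j)
      · have : Nonempty A.cx := ⟨RelCWComplex.map (C := (univ : Set A.cx)) m i 0⟩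
        exact (FinCW.pushMap_source _ (inl A B) inl_injective).trans (RelCWComplex.source_eq m i)
      · have : Nonempty B.cx := ⟨RelCWComplex.map (C := (univ : Set B.cx)) m j.1 0⟩
        exact (FinCW.pushMap_source _ (inr A B) inr_injective).trans
          (RelCWComplex.source_eq m j.1))
    (by
      rintro m (i | j)
      · exact GlueSpace.continuous_inl.comp_continuousOn
          (RelCWComplex.continuousOn (C := (univ : Set A.cx)) m i)
      · exact GlueSpace.continuous_inr.comp_continuousOn
          (RelCWComplex.continuousOn (C := (univ : Set B.cx)) m j.1))
    (by
      rintro m (i | j)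
      · have : Nonempty A.cx := ⟨RelCWComplex.map (C := (univ : Set A.cx)) m i 0⟩
        exact FinCW.pushMap_continuousOn_symm _
          (RelCWComplex.continuousOn_symm (C := (univ : Set A.cx)) m i) _ isEmbedding_inl
      · have : Nonempty B.cx := ⟨RelCWComplex.map (C := (univ : Set B.cx)) m j.1 0⟩
        exact FinCW.pushMap_continuousOn_symm _
          (RelCWComplex.continuousOn_symm (C := (univ : Set B.cx)) m j.1) _ isEmbedding_inr)
    (by
      have hlr : ∀ (m : ℕ) (i : A.cx.Cell m) (m' : ℕ)
          (j : {j : B.cx.Cell m' // Disjoint (B.cx.openCell j) (range B.ι)}),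
          Disjoint (cellMap A B m (.inl i) '' ball 0 1) (cellMap A B m' (.inr j) '' ball 0 1) := by
        intro m i m' j
        rw [cellMap_inl_image, cellMap_inr_image, Set.disjoint_left]
        rintro _ ⟨x, hx, rfl⟩ ⟨y, hy, hxy⟩
        obtain ⟨w, -, rfl⟩ := inl_eq_inr.1 hxy.symm
        exact Set.disjoint_left.1 j.2 hy (mem_range_self w)
      rintro ⟨m, i | j⟩ - ⟨m', i' | j'⟩ - hne
      · change Disjoint (cellMap A B m (.inl i) '' ball 0 1)
          (cellMap A B m' (.inl i') '' ball 0 1)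
        rw [cellMap_inl_image, cellMap_inl_image, disjoint_image_iff inl_injective]
        refine RelCWComplex.disjoint_openCell_of_ne (C := (univ : Set A.cx)) fun h => hne ?_
        cases h
        rfl
      · exact hlr m i m' j'
      · exact (hlr m' i' m j).symm
      · change Disjoint (cellMap A B m (.inr j) '' ball 0 1)
          (cellMap A B m' (.inr j') '' ball 0 1)
        rw [cellMap_inr_image, cellMap_inr_image, disjoint_image_iff inr_injective]
        refine RelCWComplex.disjoint_openCell_of_ne (C := (univ : Set B.cx)) fun h => hne ?_
        obtain ⟨j, hj⟩ := j
        obtain ⟨j', hj'⟩ := j'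
        cases h
        rfl)
    (by
      rintro m (i | j) x hx
      · obtain ⟨I, hI⟩ := RelCWComplex.mapsTo (C := (univ : Set A.cx)) m i
        have h := hI hx
        simp only [empty_union, mem_iUnion] at h
        obtain ⟨m', hm', k, -, hk⟩ := h
        simp only [mem_iUnion]
        refine ⟨m', hm', .inl k, ?_⟩
        rw [cellMap_inl_image]
        exact mem_image_of_mem _ hk
      · obtain ⟨I, hI⟩ :=
          RelCWComplex.cellFrontier_subset_finite_openCell (C := (univ : Set B.cx)) m j.1
        have h := hI (mem_image_of_mem _ hx)
        simp only [empty_union, mem_iUnion] at h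
        obtain ⟨m', hm', k, -, hk⟩ := h
        simp only [mem_iUnion]
        obtain ⟨c, hc⟩ := exists_cell_inr (A := A) k
        refine ⟨m', hm', c, image_mono ball_subset_closedBall ?_⟩
        rw [hc]
        exact mem_image_of_mem _ hk)
    (by
      refine eq_univ_of_forall fun p => ?_
      simp only [mem_iUnion]
      induction p using GlueSpace.ind with
      | hl x =>
        obtain ⟨m, i, hi⟩ := A.cx.exists_mem_openCell x
        refine ⟨m, .inl i, image_mono ball_subset_closedBall ?_⟩
        rw [cellMap_inl_image]
        exact mem_image_of_mem _ hi
      | hr y =>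
        obtain ⟨m, j, hj⟩ := B.cx.exists_mem_openCell y
        obtain ⟨c, hc⟩ := exists_cell_inr (A := A) j
        refine ⟨m, c, image_mono ball_subset_closedBall ?_⟩
        rw [hc]
        exact mem_image_of_mem _ hj)

instance instFiniteGlue (A B : BdCW n) : CWComplex.Finite (univ : Set (GlueSpace A B)) :=
  CWComplex.finite_mkFinite ..

/-- The union of the complexes of `A` and `B` along the common boundary. -/
noncomputable def glueCx (A B : BdCW n) : FinCW where
  carrier := GlueSpace A B

open GlueSpace

theorem glue_openCell_inl (A B : BdCW n) {m : ℕ} (i : A.cx.Cell m) :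
    ∃ c : (glueCx A B).Cell m, (glueCx A B).openCell c = inl A B '' A.cx.openCell i :=
  ⟨Sum.inl i, cellMap_inl_image m i _⟩

theorem glue_openCell_inr (A B : BdCW n) {m : ℕ} (j : B.cx.Cell m) :
    ∃ c : (glueCx A B).Cell m, (glueCx A B).openCell c = inr A B '' B.cx.openCell j :=
  exists_cell_inr j

theorem glue_openCell_cases (A B : BdCW n) {m : ℕ} (c : (glueCx A B).Cell m) :
    (∃ i : A.cx.Cell m, (glueCx A B).openCell c = inl A B '' A.cx.openCell i) ∨
      ∃ j : B.cx.Cell m, (glueCx A B).openCell c = inr A B '' B.cx.openCell j := by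
  rcases c with i | j
  · exact Or.inl ⟨i, cellMap_inl_image m i _⟩
  · exact Or.inr ⟨j.1, cellMap_inr_image m j _⟩

/-- The union of `A` and `B` along the common boundary, which is again the boundary. -/
noncomputable def glue (A B : BdCW n) : BdCW n where
  cx := glueCx A B
  ι w := inl A B (A.ι w)
  continuous_ι := GlueSpace.continuous_inl.comp A.continuous_ι
  injective_ι := inl_injective.comp A.injective_ι
  base_ι := by
    obtain ⟨v, hv⟩ := A.base_ι
    obtain ⟨c, hc⟩ := glue_openCell_inl A B v
    exact ⟨c, by rw [hc, ← hv, image_image]; rfl⟩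
  circle_ι i := by
    obtain ⟨v, hv⟩ := A.circle_ι i
    obtain ⟨c, hc⟩ := glue_openCell_inl A B v
    exact ⟨c, by rw [hc, ← hv, image_image]; rfl⟩

theorem dimLE_glue {A B : BdCW n} {d : ℕ} (hA : A.cx.DimLE d) (hB : B.cx.DimLE d) :
    (glue A B).cx.DimLE d := by
  intro m hm
  refine ⟨?_⟩
  rintro (i | j)
  · exact (hA m hm).false i
  · exact (hB m hm).false j.1

theorem glue_swap (A B : BdCW n) : ∃ f : (glue A B).cx → (glue B A).cx,
    (∀ w, f ((glue A B).ι w) = (glue B A).ι w) ∧ FinCW.IsCellIso f := by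
  have hw : ∀ w, inr B A (A.ι w) = inl B A (B.ι w) := fun w => (inl_ι w).symm
  refine ⟨desc (inr B A) (inl B A) hw, hw, ⟨⟨continuous_desc hw GlueSpace.continuous_inr
    GlueSpace.continuous_inl, ?_, ?_⟩, ?_⟩⟩
  · intro p q h
    induction p using GlueSpace.ind with
    | hl x =>
      induction q using GlueSpace.ind with
      | hl x' => exact congrArg _ (inr_injective h)
      | hr y =>
        obtain ⟨w, h1, h2⟩ := inl_eq_inr.1 (Eq.symm h)
        exact inl_eq_inr.2 ⟨w, h2, h1⟩
    | hr y =>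
      induction q using GlueSpace.ind with
      | hr y' => exact congrArg _ (inl_injective h)
      | hl x =>
        obtain ⟨w, h1, h2⟩ := inl_eq_inr.1 h
        exact (inl_eq_inr.2 ⟨w, h2, h1⟩).symm
  · intro m c
    rcases glue_openCell_cases A B c with ⟨i, hi⟩ | ⟨i, hi⟩
    · obtain ⟨c', hc'⟩ := glue_openCell_inr B A i
      refine ⟨c', ?_⟩
      change _ '' (glueCx A B).openCell c = (glueCx B A).openCell c'
      rw [hi, hc']
      exact image_image _ _ _
    · obtain ⟨c', hc'⟩ := glue_openCell_inl B A i
      refine ⟨c', ?_⟩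
      change _ '' (glueCx A B).openCell c = (glueCx B A).openCell c'
      rw [hi, hc']
      exact image_image _ _ _
  · intro p
    induction p using GlueSpace.ind with
    | hl x => exact ⟨inr A B x, rfl⟩
    | hr y => exact ⟨inl A B y, rfl⟩

theorem glue_comm (d : ℕ) {A B : BdCW n} (hA : A.cx.DimLE d) (hB : B.cx.DimLE d) :
    Deform d (glue A B) (glue B A) := by
  obtain ⟨f, hf, hf'⟩ := glue_swap A B
  exact .rel _ _ ⟨dimLE_glue hA hB, dimLE_glue hB hA, f, hf, Or.inl hf'⟩

/-- The map of unions induced by a map of the first factor. -/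
def glueMap {A A' : BdCW n} (B : BdCW n) (f : A.cx → A'.cx) (hf : ∀ w, f (A.ι w) = A'.ι w) :
    GlueSpace A B → GlueSpace A' B :=
  desc (fun x => inl A' B (f x)) (inr A' B) fun w => by rw [hf, inl_ι]

theorem glueMap_embedding {A A' : BdCW n} (B : BdCW n) {f : A.cx → A'.cx}
    (hf : ∀ w, f (A.ι w) = A'.ι w) (h : FinCW.IsCellEmbedding f) :
    FinCW.IsCellEmbedding (X := glueCx A B) (Y := glueCx A' B) (glueMap B f hf) := by
  refine ⟨continuous_desc _ (GlueSpace.continuous_inl.comp h.continuous)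
    GlueSpace.continuous_inr, ?_, ?_⟩
  · have key : ∀ x y, glueMap B f hf (inl A B x) = inr A' B y → inl A B x = inr A B y := by
      intro x y hxy
      obtain ⟨w, h1, h2⟩ := inl_eq_inr.1 hxy
      rw [← hf] at h1
      exact inl_eq_inr.2 ⟨w, h.injective h1, h2⟩
    intro p q hpq
    induction p using GlueSpace.ind with
    | hl x =>
      induction q using GlueSpace.ind with
      | hl x' => exact congrArg _ (h.injective (inl_injective hpq))
      | hr y => exact key x y hpq
    | hr y =>
      induction q using GlueSpace.ind with
      | hr y' => exact congrArg _ (inr_injective hpq)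
      | hl x => exact (key x y hpq.symm).symm
  · intro m c
    rcases glue_openCell_cases A B c with ⟨i, hi⟩ | ⟨i, hi⟩
    · obtain ⟨j, hj⟩ := h.cell m i
      obtain ⟨c', hc'⟩ := glue_openCell_inl A' B j
      refine ⟨c', ?_⟩
      rw [hi, hc', ← hj, image_image]
      exact image_image _ _ _
    · obtain ⟨c', hc'⟩ := glue_openCell_inr A' B i
      refine ⟨c', ?_⟩
      rw [hi, hc']
      exact image_image _ _ _

theorem glueMap_expansion {A A' : BdCW n} (B : BdCW n) {f : A.cx → A'.cx}
    (hf : ∀ w, f (A.ι w) = A'.ι w) (h : FinCW.IsElemExpansion f) :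
    FinCW.IsElemExpansion (X := glueCx A B) (Y := glueCx A' B) (glueMap B f hf) := by
  obtain ⟨hemb, m, e, e', φ, he, he', hun, hφ, hinj, him, hinj', him', hrest⟩ := h
  obtain ⟨c, hc⟩ := glue_openCell_inl A' B e
  obtain ⟨c', hc'⟩ := glue_openCell_inl A' B e'
  have hl : ∀ x, inl A' B (f x) ∈ range (glueMap B f hf) := fun x => ⟨inl A B x, rfl⟩
  have hr : ∀ y, inr A' B y ∈ range (glueMap B f hf) := fun y => ⟨inr A B y, rfl⟩
  have hdisj : ∀ s : Set A'.cx, Disjoint s (range f) →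
      Disjoint (inl A' B '' s) (range (glueMap B f hf)) := by
    intro s hs
    rw [Set.disjoint_left] at hs ⊢
    rintro _ ⟨x, hx, rfl⟩ ⟨p, hp⟩
    induction p using GlueSpace.ind with
    | hl z =>
      have hz : f z = x := inl_injective hp
      exact hs hx ⟨z, hz⟩
    | hr y =>
      obtain ⟨w, rfl, -⟩ := inl_eq_inr.1 (Eq.symm hp)
      exact hs hx ⟨A.ι w, hf w⟩
  refine ⟨glueMap_embedding B hf hemb, m, c, c', fun x => inl A' B (φ x), ?_, ?_, ?_,
    GlueSpace.continuous_inl.comp_continuousOn hφ, fun x hx y hy hxy =>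
      hinj hx hy (inl_injective hxy), ?_, fun x hx y hy hxy =>
      hinj' hx hy (inl_injective hxy), ?_, ?_⟩
  · rw [hc]
    exact hdisj _ he
  · rw [hc']
    exact hdisj _ he'
  · rw [hc, hc']
    refine eq_univ_of_forall fun p => ?_
    induction p using GlueSpace.ind with
    | hl x =>
      have hx : x ∈ range f ∪ A'.cx.openCell e ∪ A'.cx.openCell e' := hun ▸ mem_univ x
      rcases hx with (⟨z, rfl⟩ | hx) | hx
      · exact Or.inl (Or.inl (hl z))
      · exact Or.inl (Or.inr (mem_image_of_mem _ hx))
      · exact Or.inr (mem_image_of_mem _ hx)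
    | hr y => exact Or.inl (Or.inl (hr y))
  · rw [hc', ← him, image_image]
    rfl
  · rw [hc, ← him', image_image]
    rfl
  · intro x hx hx'
    obtain ⟨z, hz⟩ := hrest x hx hx'
    exact ⟨inl A B z, congrArg (inl A' B) hz⟩

theorem Step.glue_right {d : ℕ} {A A' : BdCW n} (B : BdCW n) (hB : B.cx.DimLE d)
    (h : Step d A A') : Step d (glue A B) (glue A' B) := by
  obtain ⟨hA, hA', f, hf, h⟩ := h
  refine ⟨dimLE_glue hA hB, dimLE_glue hA' hB, glueMap B f hf,
    fun w => congrArg (inl A' B) (hf w), ?_⟩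
  rcases h with h | h
  · refine Or.inl ⟨glueMap_embedding B hf h.1, fun p => ?_⟩
    induction p using GlueSpace.ind with
    | hl x =>
      obtain ⟨z, rfl⟩ := h.2 x
      exact ⟨inl A B z, rfl⟩
    | hr y => exact ⟨inr A B y, rfl⟩
  · exact Or.inr (glueMap_expansion B hf h)

theorem Deform.glue_right {d : ℕ} {A A' : BdCW n} (B : BdCW n) (hB : B.cx.DimLE d)
    (h : Deform d A A') : Deform d (glue A B) (glue A' B) := by
  induction h with
  | rel _ _ h => exact .rel _ _ (h.glue_right B hB)
  | refl _ => exact .refl _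
  | symm _ _ _ ih => exact .symm _ _ ih
  | trans _ _ _ _ _ ih ih' => exact .trans _ _ _ ih ih'

theorem Deform.glue {d : ℕ} {A A' B B' : BdCW n} (hA' : A'.cx.DimLE d)
    (hB : B.cx.DimLE d) (hB' : B'.cx.DimLE d) (h : Deform d A A') (h' : Deform d B B') :
    Deform d (glue A B) (glue A' B') :=
  .trans _ _ _ (h.glue_right B hB) <| .trans _ _ _ (glue_comm d hA' hB) <|
    .trans _ _ _ (h'.glue_right A' hA') (glue_comm d hB' hA')

theorem Deform.forget {d : ℕ} {A B : BdCW n} (h : Deform d A B) : FinCW.Deform d A.cx B.cx := by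
  induction h with
  | rel _ _ h =>
    obtain ⟨h1, h2, f, -, h3⟩ := h
    exact .rel _ _ ⟨h1, h2, f, h3⟩
  | refl _ => exact .refl _
  | symm _ _ _ ih => exact .symm _ _ ih
  | trans _ _ _ _ _ ih ih' => exact .trans _ _ _ ih ih'

end BdCW

/-! ## The universal pairing -/

/-- `2`-complexes with boundary, up to `3`-deformations restricting to the identity on it. -/
def KnSetoid (n : ℕ) : Setoid {A : BdCW n // A.cx.DimLE 2} where
  r A B := BdCW.Deform 3 A.1 B.1
  iseqv := ⟨fun _ => .refl _, .symm _ _, .trans _ _ _⟩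

/-- `Kn n`: equivalence classes of finite `2`-complexes with a subgraph of the `1`-skeleton
identified with the wedge of `n` circles, up to `3`-deformations restricting to the identity on
the wedge of circles. -/
def Kn (n : ℕ) : Type 1 := Quotient (KnSetoid n)

/-- The class of a `2`-complex with boundary. -/
def Kn.mk {n : ℕ} (A : BdCW n) (hA : A.cx.DimLE 2) : Kn n := Quotient.mk (KnSetoid n) ⟨A, hA⟩

/-- The product: the union of two complexes along the common boundary. -/
noncomputable instance (n : ℕ) : Mul (Kn n) where
  mul := Quotient.map₂
    (fun A B => ⟨BdCW.glue A.1 B.1, BdCW.dimLE_glue A.2 B.2⟩)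
    (fun _ A' hA B B' hB => BdCW.Deform.glue (fun m hm => A'.2 m (by omega))
      (fun m hm => B.2 m (by omega)) (fun m hm => B'.2 m (by omega)) hA hB)

/-- `2`-complexes without boundary, up to `3`-deformations. -/
def KClosedSetoid : Setoid {X : FinCW // X.DimLE 2} where
  r X Y := FinCW.Deform 3 X.1 Y.1
  iseqv := ⟨fun _ => .refl _, .symm _ _, .trans _ _ _⟩

/-- Equivalence classes of finite `2`-complexes (without boundary) up to `3`-deformations. -/
def KClosed : Type 1 := Quotient KClosedSetoid

/-- Forgetting the boundary. -/
def Kn.forget {n : ℕ} : Kn n → KClosed :=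
  Quotient.map (fun A => ⟨A.1.cx, A.2⟩) fun _ _ h => BdCW.Deform.forget h

/-- The universal pairing: the bilinear extension of the product followed by forgetting the
boundary. `MonoidAlgebra k (Kn n)` is the free `k`-module on `Kn n` with the bilinear product. -/
noncomputable def universalPairing {k : Type*} [CommRing k] {n : ℕ}
    (x y : MonoidAlgebra k (Kn n)) : KClosed →₀ k :=
  Finsupp.mapDomain Kn.forget (x * y).coeff

/-!
Write `Γ` for the wedge of `n` circles. If `A` is a `2`-complex whose `1`-skeleton is `Γ`, and `B`
another one in which the same loops of `Γ` are null-homotopic, then in `A ∪ B` the `2`-cells of `B`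
are attached to `A` along null-homotopic maps. By a `3`-deformation which does not move `A` these
attaching maps can be made constant, so that, relative to `A` and hence to `Γ`, the union `A ∪ B`
is `A` with as many `2`-spheres wedged on as `B` has `2`-cells (`BdCW.Deform.glue_of_null`). If
moreover `B` has as many `2`-cells as `A`, the four unions of `A` or `B` with `A` or `B` are
therefore equivalent: `A ∪ A ≃ A ∪ B` and `B ∪ A ≃ B ∪ B` by the above, and `A ∪ B ≃ B ∪ A` by
symmetry. So the product of `A - B` with itself vanishes.

It remains to deform `L₁` and `L₂` into such `A` and `B`. Each is `3`-deformed to a complex with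
one vertex (`FinCW.exists_oneVertex`), whose edges are loops and represent elements `t₁`,
respectively `t₂`, of the fundamental group. An expansion by a `1`-cell and a `2`-cell adds an edge
representing a given element (`FinCW.IsEdgeLoops.exists_append`). Let `φ` be the isomorphism of the
fundamental groups. Adding edges for `φ⁻¹ t₂` to the first complex and for `φ t₁` to the second
one, the edges of both form the same tuple of group elements up to `φ`, which means that the same
loops of `Γ` are null-homotopic in both (`WedgeCircles.homotopic_refl_of_mulEquiv`). As both have
one vertex and equally many edges, and the Euler characteristic is invariant under deformations
(`FinCW.Deform.eulerChar_eq`), they have equally many `2`-cells.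

The geometric input is that homotopic attaching maps give complexes which are deformation
equivalent relative to the complex to which the cell is attached
(`FinCW.IsAttach.relDeform_of_homotopy`): attach a cell along the homotopy and collapse it from
either end. The topological input is a weak form of cellular approximation for paths
(`IsCellAttachment.path_induction`), which shows that the loops of a wedge of circles generate its
fundamental group, and that a path in a `2`-complex can be pushed into the `1`-skeleton.
-/

namespace FinCW

/-! ### Cells, skeleta and subcomplexes -/

/-- The characteristic map of a cell, as a plain function; it is only meaningful on the closed
unit ball. -/
noncomputable abbrev cmap (X : FinCW) {m : ℕ} (i : X.Cell m) : (Fin m → ℝ) → X :=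
  RelCWComplex.map (C := (univ : Set X)) m i

theorem continuousOn_cmap (X : FinCW) {m : ℕ} (i : X.Cell m) :
    ContinuousOn (X.cmap i) (closedBall 0 1) :=
  RelCWComplex.continuousOn (C := (univ : Set X)) m i

theorem injOn_cmap (X : FinCW) {m : ℕ} (i : X.Cell m) : InjOn (X.cmap i) (ball 0 1) := by
  have h := (RelCWComplex.map (C := (univ : Set X)) m i).injOn
  rwa [RelCWComplex.source_eq] at h

theorem cmap_mem_openCell (X : FinCW) {m : ℕ} (i : X.Cell m) {u : Fin m → ℝ}
    (hu : u ∈ ball (0 : Fin m → ℝ) 1) : X.cmap i u ∈ X.openCell i := mem_image_of_mem _ hu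

instance finite_sigma_cell (X : FinCW) : Finite (Σ m, X.Cell m) :=
  CWComplex.finite_iff_finite_cells.1 inferInstance

instance finite_cell (X : FinCW) (m : ℕ) : Finite (X.Cell m) :=
  RelCWComplex.FiniteType.finite_cell m

theorem cell_unique {X : FinCW} {m k : ℕ} {i : X.Cell m} {j : X.Cell k} {x : X}
    (hi : x ∈ X.openCell i) (hj : x ∈ X.openCell j) :
    (⟨m, i⟩ : Σ m, X.Cell m) = ⟨k, j⟩ :=
  RelCWComplex.eq_of_not_disjoint_openCell (Set.not_disjoint_iff.2 ⟨x, hi, hj⟩)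

theorem openCell_nonempty (X : FinCW) {m : ℕ} (i : X.Cell m) : (X.openCell i).Nonempty :=
  ⟨_, X.cmap_mem_openCell i (mem_ball_self one_pos)⟩

theorem openCell_injective (X : FinCW) {m : ℕ} : Function.Injective (X.openCell (m := m)) := by
  intro i j h
  obtain ⟨x, hx⟩ := X.openCell_nonempty i
  cases cell_unique hx (h ▸ hx)
  rfl

/-- The union of the open cells of dimension less than `m`. -/
def skelLT (X : FinCW) (m : ℕ) : Set X := {x | ∃ k < m, ∃ j : X.Cell k, x ∈ X.openCell j}

theorem skelLT_mono (X : FinCW) {m k : ℕ} (h : m ≤ k) : X.skelLT m ⊆ X.skelLT k :=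
  fun _ ⟨l, hl, j, hj⟩ => ⟨l, hl.trans_le h, j, hj⟩

theorem openCell_subset_skelLT (X : FinCW) {m k : ℕ} (h : m < k) (i : X.Cell m) :
    X.openCell i ⊆ X.skelLT k := fun _ hx => ⟨m, h, i, hx⟩

theorem cmap_mem_skelLT (X : FinCW) {m : ℕ} (i : X.Cell m) {u : Fin m → ℝ}
    (hu : u ∈ sphere (0 : Fin m → ℝ) 1) : X.cmap i u ∈ X.skelLT m := by
  obtain ⟨I, hI⟩ := CWComplex.cellFrontier_subset_finite_openCell (C := (univ : Set X)) m i
  have h := hI (mem_image_of_mem _ hu)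
  simp only [mem_iUnion] at h
  obtain ⟨k, hk, j, -, hj⟩ := h
  exact ⟨k, hk, j, hj⟩

theorem DimLE.mem_skelLT {X : FinCW} {d m : ℕ} (h : X.DimLE d) (hm : d < m) (x : X) :
    x ∈ X.skelLT m := by
  obtain ⟨k, i, hi⟩ := X.exists_mem_openCell x
  refine ⟨k, ?_, i, hi⟩
  by_contra hk
  exact (h k (by omega)).false i

theorem DimLE.mono {X : FinCW} {d d' : ℕ} (h : X.DimLE d) (hd : d ≤ d') : X.DimLE d' :=
  fun m hm => h m (by omega)

theorem notMem_skelLT {X : FinCW} {m k : ℕ} {i : X.Cell m} {x : X} (hx : x ∈ X.openCell i)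
    (hk : k ≤ m) : x ∉ X.skelLT k := by
  rintro ⟨l, hl, j, hj⟩
  cases cell_unique hx hj
  omega

theorem closure_openCell (X : FinCW) {m : ℕ} (i : X.Cell m) :
    closure (X.openCell i) = X.cmap i '' closedBall 0 1 :=
  RelCWComplex.closure_openCell_eq_closedCell (C := (univ : Set X))

theorem mem_closure_openCell {X : FinCW} {m : ℕ} {i : X.Cell m} {x : X}
    (hx : x ∈ closure (X.openCell i)) : x ∈ X.openCell i ∨ x ∈ X.skelLT m := by
  rw [closure_openCell] at hx
  obtain ⟨u, hu, rfl⟩ := hx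
  rcases (mem_closedBall_zero_iff.1 hu).lt_or_eq with h | h
  · exact Or.inl (X.cmap_mem_openCell i (mem_ball_zero_iff.2 h))
  · exact Or.inr (X.cmap_mem_skelLT i (mem_sphere_zero_iff_norm.2 h))

theorem isClosed_skelLT (X : FinCW) (m : ℕ) : IsClosed (X.skelLT m) := by
  have h : X.skelLT m = ⋃ p : {p : Σ k, X.Cell k // p.1 < m}, closure (X.openCell p.1.2) := by
    ext x
    rw [mem_iUnion]
    constructor
    · rintro ⟨k, hk, j, hj⟩
      exact ⟨⟨⟨k, j⟩, hk⟩, subset_closure hj⟩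
    · rintro ⟨⟨⟨k, j⟩, hk⟩, hx⟩
      rcases mem_closure_openCell hx with h | h
      · exact ⟨k, hk, j, h⟩
      · exact X.skelLT_mono (le_of_lt hk) h
  rw [h]
  exact isClosed_iUnion_of_finite fun _ => isClosed_closure

/-- The image of the closed ball under a continuous map consists of limits of the image of the
open ball. -/
theorem mem_closure_image_ball {Y : Type*} [TopologicalSpace Y] {m : ℕ} {φ : (Fin m → ℝ) → Y}
    (hφ : ContinuousOn φ (closedBall 0 1)) {u : Fin m → ℝ}
    (hu : u ∈ closedBall (0 : Fin m → ℝ) 1) : φ u ∈ closure (φ '' ball 0 1) := by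
  have h := closure_ball (0 : Fin m → ℝ) one_ne_zero
  rw [← h] at hφ hu
  exact hφ.image_closure (mem_image_of_mem φ hu)

namespace IsCellEmbedding

variable {X Y Z : FinCW} {f : X → Y}

theorem isClosedEmbedding (h : IsCellEmbedding f) : IsClosedEmbedding f :=
  h.continuous.isClosedEmbedding h.injective

protected theorem id (X : FinCW) : IsCellEmbedding (id : X → X) :=
  ⟨continuous_id, Function.injective_id, fun _ i => ⟨i, image_id _⟩⟩

theorem comp {g : Y → Z} (hg : IsCellEmbedding g) (hf : IsCellEmbedding f) :
    IsCellEmbedding (g ∘ f) := by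
  refine ⟨hg.continuous.comp hf.continuous, hg.injective.comp hf.injective, fun m i => ?_⟩
  obtain ⟨j, hj⟩ := hf.cell m i
  obtain ⟨k, hk⟩ := hg.cell m j
  exact ⟨k, by rw [image_comp, hj, hk]⟩

theorem exists_cell (h : IsCellEmbedding f) {m : ℕ} {j : Y.Cell m} {x : X}
    (hx : f x ∈ Y.openCell j) : ∃ i : X.Cell m, x ∈ X.openCell i ∧
      f '' X.openCell i = Y.openCell j := by
  obtain ⟨k, i, hi⟩ := X.exists_mem_openCell x
  obtain ⟨j', hj'⟩ := h.cell k i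
  cases cell_unique (hj' ▸ mem_image_of_mem f hi) hx
  exact ⟨i, hi, hj'⟩

theorem mem_skelLT_iff (h : IsCellEmbedding f) {m : ℕ} {x : X} :
    f x ∈ Y.skelLT m ↔ x ∈ X.skelLT m := by
  constructor
  · rintro ⟨k, hk, j, hj⟩
    obtain ⟨i, hi, -⟩ := h.exists_cell hj
    exact ⟨k, hk, i, hi⟩
  · rintro ⟨k, hk, i, hi⟩
    obtain ⟨j, hj⟩ := h.cell k i
    exact ⟨k, hk, j, hj ▸ mem_image_of_mem f hi⟩

theorem dimLE (h : IsCellEmbedding f) {d : ℕ} (hY : Y.DimLE d) : X.DimLE d :=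
  fun m hm => ⟨fun i => (hY m hm).false (h.cell m i).choose⟩

end IsCellEmbedding

theorem IsCellIso.isHomeomorph {X Y : FinCW} {f : X → Y} (h : IsCellIso f) : IsHomeomorph f :=
  isHomeomorph_iff_continuous_bijective.2 ⟨h.1.continuous, h.1.injective, h.2⟩

theorem IsCellIso.exists_inverse {X Y : FinCW} {f : X → Y} (h : IsCellIso f) :
    ∃ g : Y → X, IsCellIso g ∧ (∀ x, g (f x) = x) ∧ ∀ y, f (g y) = y := by
  let e := Equiv.ofBijective f ⟨h.1.injective, h.2⟩
  have h1 : ∀ x, e.symm (f x) = x := e.symm_apply_apply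
  have h2 : ∀ y, f (e.symm y) = y := e.apply_symm_apply
  refine ⟨e.symm, ⟨⟨?_, e.symm.injective, fun m j => ?_⟩, e.symm.surjective⟩, h1, h2⟩
  · exact (h.isHomeomorph.homeomorph f).symm.continuous.congr fun y => by
      apply h.1.injective
      rw [h2]
      exact (h.isHomeomorph.homeomorph f).apply_symm_apply y
  · obtain ⟨x, hx⟩ := Y.openCell_nonempty j
    obtain ⟨i, -, hi⟩ := h.1.exists_cell (x := e.symm x) (by rwa [h2])
    refine ⟨i, ?_⟩
    rw [← hi, image_image]
    simp [h1]

/-! ### Constructing complexes from their characteristic maps -/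

/-- A finite CW complex from a list of characteristic maps. That the inverses of the
characteristic maps are continuous on the open cells follows from compactness. -/
noncomputable def ofCells (Z : Type) [TopologicalSpace Z] [T2Space Z] (cell : ℕ → Type)
    (φ : ∀ m, cell m → (Fin m → ℝ) → Z) (hfin : Finite (Σ m, cell m))
    (hc : ∀ m i, ContinuousOn (φ m i) (closedBall 0 1))
    (hinj : ∀ m i, InjOn (φ m i) (ball 0 1))
    (hdisj : ∀ m k (i : cell m) (j : cell k), ∀ u ∈ ball (0 : Fin m → ℝ) 1,
      ∀ v ∈ ball (0 : Fin k → ℝ) 1, φ m i u = φ k j v → (⟨m, i⟩ : Σ m, cell m) = ⟨k, j⟩)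
    (hbd : ∀ m i, ∀ u ∈ sphere (0 : Fin m → ℝ) 1, ∃ k < m, ∃ j : cell k,
      φ m i u ∈ φ k j '' ball 0 1)
    (hcov : ∀ z, ∃ m, ∃ i : cell m, z ∈ φ m i '' ball 0 1) : FinCW :=
  have h1 : ∀ᶠ m in Filter.atTop, IsEmpty (cell m) := by
    have hb : BddAbove (range (Sigma.fst : (Σ m, cell m) → ℕ)) := (finite_range _).bddAbove
    obtain ⟨N, hN⟩ := hb
    filter_upwards [Filter.eventually_gt_atTop N] with m hm
    refine ⟨fun i => ?_⟩
    have := hN ⟨⟨m, i⟩, rfl⟩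
    dsimp only at this
    omega
  have h2 : ∀ m, Finite (cell m) := fun m =>
    Finite.of_injective (fun i => (⟨m, i⟩ : Σ m, cell m)) sigma_mk_injective
  have h3 : ∀ m i, ContinuousOn (InjOn.toPartialEquiv (φ m i) (ball 0 1) (hinj m i)).symm
      (InjOn.toPartialEquiv (φ m i) (ball 0 1) (hinj m i)).target := by
    intro m i
    set p := InjOn.toPartialEquiv (φ m i) (ball 0 1) (hinj m i) with hp
    have hps : ∀ u ∈ ball (0 : Fin m → ℝ) 1, p.symm (φ m i u) = u := fun u hu => p.left_inv hu
    change ContinuousOn p.symm (φ m i '' ball 0 1)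
    rw [continuousOn_iff_isClosed]
    intro C hC
    refine ⟨φ m i '' (C ∩ closedBall 0 1), ?_, ?_⟩
    · exact ((((isCompact_closedBall _ _).inter_left hC).image_of_continuousOn
        ((hc m i).mono inter_subset_right))).isClosed
    -- in the open cell, closedness is tested on images of compact subsets of the closed ball
    · ext z
      constructor
      · rintro ⟨h, u, hu, rfl⟩
        rw [mem_preimage, hps u hu] at h
        exact ⟨⟨u, ⟨h, ball_subset_closedBall hu⟩, rfl⟩, u, hu, rfl⟩
      · rintro ⟨⟨v, ⟨hv, hv'⟩, hvu⟩, u, hu, rfl⟩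
        refine ⟨?_, u, hu, rfl⟩
        rcases (mem_closedBall_zero_iff.1 hv').lt_or_eq with h | h
        · rw [mem_preimage, hps u hu, ← hinj m i (mem_ball_zero_iff.2 h) hu hvu]
          exact hv
        · -- a boundary point of the ball cannot be mapped into the open cell
          exfalso
          obtain ⟨k, hk, j, w, hw, hwv⟩ := hbd m i v (mem_sphere_zero_iff_norm.2 h)
          have := hdisj m k i j u hu w hw (by rw [hwv, hvu])
          cases this
          omega
  let cw : CWComplex (univ : Set Z) := CWComplex.mkFinite univ cell
    (fun m i => InjOn.toPartialEquiv (φ m i) (ball 0 1) (hinj m i)) h1 h2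
    (fun _ _ => rfl) hc h3
    (by
      rintro ⟨m, i⟩ - ⟨k, j⟩ - hne
      refine Set.disjoint_left.2 ?_
      rintro _ ⟨u, hu, rfl⟩ ⟨v, hv, huv⟩
      exact hne (hdisj m k i j u hu v hv huv.symm))
    (by
      intro m i u hu
      obtain ⟨k, hk, j, hj⟩ := hbd m i u hu
      simp only [mem_iUnion]
      exact ⟨k, hk, j, image_mono ball_subset_closedBall hj⟩)
    (by
      refine eq_univ_of_forall fun z => ?_
      obtain ⟨m, i, hi⟩ := hcov z
      simp only [mem_iUnion]
      exact ⟨m, i, image_mono ball_subset_closedBall hi⟩)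
  have hfin : CWComplex.Finite (univ : Set Z) := CWComplex.finite_mkFinite ..
  { carrier := Z }

/-- A closed union of open cells. -/
structure IsSub (X : FinCW) (S : Set X) : Prop where
  isClosed : IsClosed S
  cell : ∀ (m : ℕ) (i : X.Cell m), X.openCell i ⊆ S ∨ Disjoint (X.openCell i) S

theorem IsSub.subset_of_mem {X : FinCW} {S : Set X} (hS : X.IsSub S) {m : ℕ} {i : X.Cell m}
    {x : X} (hx : x ∈ X.openCell i) (hxS : x ∈ S) : X.openCell i ⊆ S :=
  (hS.cell m i).resolve_right fun h => Set.disjoint_left.1 h hx hxS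

theorem IsSub.cmap_mem {X : FinCW} {S : Set X} (hS : X.IsSub S) {m : ℕ} {i : X.Cell m}
    (hi : X.openCell i ⊆ S) {u : Fin m → ℝ} (hu : u ∈ closedBall (0 : Fin m → ℝ) 1) :
    X.cmap i u ∈ S :=
  hS.isClosed.closure_subset_iff.2 hi (mem_closure_image_ball (X.continuousOn_cmap i) hu)

open Classical in
/-- The characteristic map of a cell of a subcomplex. Outside the closed ball its value is
immaterial. -/
noncomputable def subMap {X : FinCW} {S : Set X} {m : ℕ}
    (i : {i : X.Cell m // X.openCell i ⊆ S}) (u : Fin m → ℝ) : S :=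
  if h : X.cmap i.1 u ∈ S then ⟨X.cmap i.1 u, h⟩
  else ⟨X.cmap i.1 0, i.2 (X.cmap_mem_openCell i.1 (mem_ball_self one_pos))⟩

theorem subMap_coe {X : FinCW} {S : Set X} (hS : X.IsSub S) {m : ℕ}
    (i : {i : X.Cell m // X.openCell i ⊆ S}) {u : Fin m → ℝ}
    (hu : u ∈ closedBall (0 : Fin m → ℝ) 1) : (subMap i u : X) = X.cmap i.1 u := by
  rw [subMap, dif_pos (hS.cmap_mem i.2 hu)]

/-- The subcomplex with underlying set `S`, as a complex of its own. -/
noncomputable def sub (X : FinCW) (S : Set X) (hS : X.IsSub S) : FinCW :=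
  ofCells S (fun m => {i : X.Cell m // X.openCell i ⊆ S}) (fun _ i => subMap i)
    (Finite.of_injective (fun p => (⟨p.1, p.2.1⟩ : Σ m, X.Cell m)) (by
      rintro ⟨m, i, hi⟩ ⟨k, j, hj⟩ h
      cases h
      rfl))
    (fun _ i => IsInducing.subtypeVal.continuousOn_iff.2
      ((X.continuousOn_cmap i.1).congr fun _ hu => subMap_coe hS i hu))
    (fun _ i u hu v hv huv => X.injOn_cmap i.1 hu hv (by
      rw [← subMap_coe hS i (ball_subset_closedBall hu), huv,
        subMap_coe hS i (ball_subset_closedBall hv)]))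
    (fun m k i j u hu v hv huv => by
      have h := congrArg (Subtype.val : S → X) huv
      rw [subMap_coe hS i (ball_subset_closedBall hu),
        subMap_coe hS j (ball_subset_closedBall hv)] at h
      have h' := X.cmap_mem_openCell i.1 hu
      rw [h] at h'
      obtain ⟨i, hi⟩ := i
      obtain ⟨j, hj⟩ := j
      cases cell_unique h' (X.cmap_mem_openCell j hv)
      rfl)
    (fun m i u hu => by
      have h := subMap_coe hS i (sphere_subset_closedBall hu)
      obtain ⟨k, hk, j, hj⟩ := X.cmap_mem_skelLT i.1 hu
      have hS' := hS.cmap_mem i.2 (sphere_subset_closedBall hu)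
      refine ⟨k, hk, ⟨j, hS.subset_of_mem hj hS'⟩, ?_⟩
      obtain ⟨v, hv, hv'⟩ := hj
      refine ⟨v, hv, Subtype.ext ?_⟩
      rw [subMap_coe hS _ (ball_subset_closedBall hv), h]
      exact hv')
    (fun z => by
      obtain ⟨m, i, hi⟩ := X.exists_mem_openCell z.1
      refine ⟨m, ⟨i, hS.subset_of_mem hi z.2⟩, ?_⟩
      obtain ⟨v, hv, hv'⟩ := hi
      refine ⟨v, hv, Subtype.ext ?_⟩
      rw [subMap_coe hS _ (ball_subset_closedBall hv)]
      exact hv')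

/-- The inclusion of a subcomplex. -/
def incl (X : FinCW) (S : Set X) (hS : X.IsSub S) (x : X.sub S hS) : X := Subtype.val (p := (· ∈ S)) x

theorem incl_image_openCell (X : FinCW) (S : Set X) (hS : X.IsSub S) {m : ℕ}
    (i : {i : X.Cell m // X.openCell i ⊆ S}) :
    X.incl S hS '' (X.sub S hS).openCell (m := m) i = X.openCell i.1 := by
  change Subtype.val '' (subMap i '' ball 0 1) = X.cmap i.1 '' ball 0 1
  rw [image_image]
  exact image_congr fun u hu => subMap_coe hS i (ball_subset_closedBall hu)

theorem isCellEmbedding_incl (X : FinCW) (S : Set X) (hS : X.IsSub S) :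
    IsCellEmbedding (X.incl S hS) :=
  ⟨continuous_subtype_val, Subtype.val_injective,
    fun _ i => ⟨i.1, X.incl_image_openCell S hS i⟩⟩

theorem range_incl (X : FinCW) (S : Set X) (hS : X.IsSub S) : range (X.incl S hS) = S :=
  Subtype.range_val

/-- A cell embedding into `X` with image in the subcomplex `S` factors through `S`. -/
theorem IsCellEmbedding.exists_factor {A X : FinCW} {f : A → X} (hf : IsCellEmbedding f)
    {S : Set X} (hS : X.IsSub S) (h : range f ⊆ S) :
    ∃ g : A → X.sub S hS, IsCellEmbedding g ∧ ∀ a, X.incl S hS (g a) = f a := by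
  refine ⟨fun a => (⟨f a, h ⟨a, rfl⟩⟩ : S), ⟨hf.continuous.subtype_mk _, fun a b hab =>
    hf.injective (congrArg Subtype.val hab), fun m i => ?_⟩, fun a => rfl⟩
  obtain ⟨j, hj⟩ := hf.cell m i
  refine ⟨⟨j, hj ▸ (image_subset_range _ _).trans h⟩, ?_⟩
  apply (Subtype.val_injective (p := (· ∈ S))).image_injective
  refine Eq.trans ?_ (X.incl_image_openCell S hS ⟨j, _⟩).symm
  rw [← hj]
  exact image_image _ _ _

end FinCW

/-! ### Attaching a cell -/

/-- A function out of a Hausdorff space covered by the images of two compact spaces is continuous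
as soon as its composites with the two maps are. -/
theorem continuous_of_compact_cover {A B Y Z : Type*} [TopologicalSpace A] [TopologicalSpace B]
    [TopologicalSpace Y] [TopologicalSpace Z] [CompactSpace A] [CompactSpace B] [T2Space Y]
    {a : A → Y} {b : B → Y} (ha : Continuous a) (hb : Continuous b)
    (hab : ∀ y, (∃ x, a x = y) ∨ ∃ x, b x = y) {h : Y → Z}
    (hha : Continuous (h ∘ a)) (hhb : Continuous (h ∘ b)) : Continuous h := by
  rw [continuous_iff_isClosed]
  intro C hC
  have : h ⁻¹' C = a '' ((h ∘ a) ⁻¹' C) ∪ b '' ((h ∘ b) ⁻¹' C) := by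
    ext y
    constructor
    · intro hy
      rcases hab y with ⟨x, rfl⟩ | ⟨x, rfl⟩
      · exact Or.inl ⟨x, hy, rfl⟩
      · exact Or.inr ⟨x, hy, rfl⟩
    · rintro (⟨x, hx, rfl⟩ | ⟨x, hx, rfl⟩) <;> exact hx
  rw [this]
  exact (ha.isClosedMap _ (hC.preimage hha)).union (hb.isClosedMap _ (hC.preimage hhb))

namespace FinCW

/-- `Y` is obtained from `X` by attaching an `m`-cell `e` along `γ : S^(m-1) → X`; here `f` is the
inclusion and `φ` is a characteristic map of `e`. Only the values of `γ` on the unit sphere and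
those of `φ` on the closed unit ball matter. -/
structure IsAttach {X Y : FinCW} {m : ℕ} (γ : (Fin m → ℝ) → X) (f : X → Y)
    (φ : (Fin m → ℝ) → Y) (e : Y.Cell m) : Prop where
  emb : IsCellEmbedding f
  cont : ContinuousOn φ (closedBall 0 1)
  inj : InjOn φ (ball 0 1)
  image : φ '' ball 0 1 = Y.openCell e
  disj : Disjoint (Y.openCell e) (range f)
  cover : range f ∪ Y.openCell e = univ
  bd : ∀ u ∈ sphere (0 : Fin m → ℝ) 1, φ u = f (γ u)

/-- A complex with one cell more than an embedded complex is obtained by attaching that cell. -/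
theorem IsCellEmbedding.isAttach {X Y : FinCW} [Nonempty X] {m : ℕ} {f : X → Y} {e : Y.Cell m}
    (hf : IsCellEmbedding f) (hd : Disjoint (Y.openCell e) (range f))
    (hc : range f ∪ Y.openCell e = univ) :
    IsAttach (fun u => Function.invFun f (Y.cmap e u)) f (Y.cmap e) e := by
  refine ⟨hf, Y.continuousOn_cmap e, Y.injOn_cmap e, rfl, hd, hc, fun u hu => ?_⟩
  have h : Y.cmap e u ∈ range f ∪ Y.openCell e := hc ▸ mem_univ _
  rcases h with h | h
  · exact (Function.invFun_eq h).symm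
  · exact absurd (Y.cmap_mem_skelLT e hu) (notMem_skelLT h le_rfl)

namespace IsAttach

variable {X Y : FinCW} {m : ℕ} {γ : (Fin m → ℝ) → X} {f : X → Y} {φ : (Fin m → ℝ) → Y}
  {e : Y.Cell m}

theorem mem_range_or (h : IsAttach γ f φ e) (y : Y) :
    (∃ x, f x = y) ∨ ∃ u ∈ ball (0 : Fin m → ℝ) 1, φ u = y := by
  have hy : y ∈ range f ∪ Y.openCell e := h.cover ▸ mem_univ y
  rw [← h.image] at hy
  exact hy

theorem ne (h : IsAttach γ f φ e) {u : Fin m → ℝ} (hu : u ∈ ball (0 : Fin m → ℝ) 1) (x : X) :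
    φ u ≠ f x := fun hx =>
  Set.disjoint_left.1 h.disj (h.image ▸ mem_image_of_mem φ hu) ⟨x, hx.symm⟩

theorem mem_openCell (h : IsAttach γ f φ e) {u : Fin m → ℝ} (hu : u ∈ ball (0 : Fin m → ℝ) 1) :
    φ u ∈ Y.openCell e := h.image ▸ mem_image_of_mem φ hu

theorem continuousOn_attaching (h : IsAttach γ f φ e) : ContinuousOn γ (sphere 0 1) := by
  rw [h.emb.isClosedEmbedding.isInducing.continuousOn_iff]
  exact (h.cont.mono sphere_subset_closedBall).congr fun u hu => (h.bd u hu).symm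

theorem attaching_mem (h : IsAttach γ f φ e) {u : Fin m → ℝ}
    (hu : u ∈ sphere (0 : Fin m → ℝ) 1) : γ u ∈ X.skelLT m := by
  have h1 := mem_closure_image_ball h.cont (sphere_subset_closedBall hu)
  rw [h.image, h.bd u hu] at h1
  rcases mem_closure_openCell h1 with h2 | h2
  · exact absurd ⟨γ u, rfl⟩ (Set.disjoint_left.1 h.disj h2)
  · exact h.emb.mem_skelLT_iff.1 h2

/-- Maps out of a complex with an attached cell. -/
theorem exists_desc (h : IsAttach γ f φ e) {Z : Type*} [TopologicalSpace Z] {a : X → Z}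
    {b : (Fin m → ℝ) → Z} (ha : Continuous a) (hb : ContinuousOn b (closedBall 0 1))
    (hab : ∀ u ∈ sphere (0 : Fin m → ℝ) 1, b u = a (γ u)) :
    ∃ g : Y → Z, Continuous g ∧ (∀ x, g (f x) = a x) ∧
      ∀ u ∈ closedBall (0 : Fin m → ℝ) 1, g (φ u) = b u := by
  classical
  let g : Y → Z := fun y =>
    if hy : ∃ x, f x = y then a hy.choose else b ((h.mem_range_or y).resolve_left hy).choose
  have h1 : ∀ x, g (f x) = a x := by
    intro x
    have hx : ∃ x', f x' = f x := ⟨x, rfl⟩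
    change dite _ _ _ = _
    rw [dif_pos hx, h.emb.injective hx.choose_spec]
  have h2 : ∀ u ∈ closedBall (0 : Fin m → ℝ) 1, g (φ u) = b u := by
    intro u hu
    rcases (mem_closedBall_zero_iff.1 hu).lt_or_eq with hu' | hu'
    · replace hu' := mem_ball_zero_iff.2 hu'
      have hx : ¬ ∃ x, f x = φ u := fun ⟨x, hx⟩ => h.ne hu' x hx.symm
      change dite _ _ _ = _
      rw [dif_neg hx]
      have hs := ((h.mem_range_or (φ u)).resolve_left hx).choose_spec
      rw [h.inj hs.1 hu' hs.2]
    · replace hu' := mem_sphere_zero_iff_norm.2 hu'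
      rw [h.bd u hu', h1, hab u hu']
  refine ⟨g, ?_, h1, h2⟩
  have : CompactSpace (closedBall (0 : Fin m → ℝ) 1) :=
    isCompact_iff_compactSpace.1 (isCompact_closedBall _ _)
  refine continuous_of_compact_cover (b := fun u : closedBall (0 : Fin m → ℝ) 1 => φ u)
    h.emb.continuous h.cont.domRestrict (fun y => ?_) (ha.congr fun x => (h1 x).symm)
    (hb.domRestrict.congr fun u => (h2 u.1 u.2).symm)
  rcases h.mem_range_or y with hx | ⟨u, hu, hu'⟩
  · exact Or.inl hx
  · exact Or.inr ⟨⟨u, ball_subset_closedBall hu⟩, hu'⟩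

theorem cell_cases (h : IsAttach γ f φ e) {k : ℕ} (j : Y.Cell k) :
    (∃ i : X.Cell k, f '' X.openCell i = Y.openCell j) ∨
      (⟨k, j⟩ : Σ k, Y.Cell k) = ⟨m, e⟩ := by
  obtain ⟨y, hy⟩ := Y.openCell_nonempty j
  rcases h.mem_range_or y with ⟨x, rfl⟩ | ⟨u, hu, rfl⟩
  · obtain ⟨i, -, hi⟩ := h.emb.exists_cell hy
    exact Or.inl ⟨i, hi⟩
  · exact Or.inr (cell_unique hy (h.mem_openCell hu))

theorem dimLE (h : IsAttach γ f φ e) {d : ℕ} (hX : X.DimLE d) (hm : m ≤ d) : Y.DimLE d := by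
  refine fun k hk => ⟨fun j => ?_⟩
  rcases h.cell_cases j with ⟨i, -⟩ | h'
  · exact (hX k hk).false i
  · cases h'
    omega

variable {X' Y' : FinCW} {γ' : (Fin m → ℝ) → X'} {f' : X' → Y'} {φ' : (Fin m → ℝ) → Y'}
  {e' : Y'.Cell m}

/-- Attaching a cell is functorial for embeddings. -/
theorem exists_map (h : IsAttach γ f φ e) (h' : IsAttach γ' f' φ' e') {g : X → X'}
    (hg : IsCellEmbedding g) (hγ : ∀ u ∈ sphere (0 : Fin m → ℝ) 1, γ' u = g (γ u)) :
    ∃ G : Y → Y', IsCellEmbedding G ∧ (∀ x, G (f x) = f' (g x)) ∧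
      (∀ u ∈ closedBall (0 : Fin m → ℝ) 1, G (φ u) = φ' u) ∧
      G '' Y.openCell e = Y'.openCell e' := by
  obtain ⟨G, hG, h1, h2⟩ := h.exists_desc (a := f' ∘ g) (b := φ')
    (h'.emb.continuous.comp hg.continuous) h'.cont (fun u hu => by
      rw [h'.bd u hu, hγ u hu]
      rfl)
  have h3 : G '' Y.openCell e = Y'.openCell e' := by
    rw [← h.image, ← h'.image, image_image]
    exact image_congr fun u hu => h2 u (ball_subset_closedBall hu)
  refine ⟨G, ⟨hG, ?_, fun k j => ?_⟩, h1, h2, h3⟩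
  · intro y z hyz
    rcases h.mem_range_or y with ⟨x, rfl⟩ | ⟨u, hu, rfl⟩ <;>
    rcases h.mem_range_or z with ⟨x', rfl⟩ | ⟨v, hv, rfl⟩
    · rw [h1, h1] at hyz
      exact congrArg f (hg.injective (h'.emb.injective hyz))
    · rw [h1, h2 v (ball_subset_closedBall hv)] at hyz
      exact absurd hyz.symm (h'.ne hv _)
    · rw [h1, h2 u (ball_subset_closedBall hu)] at hyz
      exact absurd hyz (h'.ne hu _)
    · rw [h2 u (ball_subset_closedBall hu), h2 v (ball_subset_closedBall hv)] at hyz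
      rw [h'.inj hu hv hyz]
  · rcases h.cell_cases j with ⟨i, hi⟩ | hj
    · obtain ⟨i', hi'⟩ := hg.cell k i
      obtain ⟨j', hj'⟩ := h'.emb.cell k i'
      refine ⟨j', ?_⟩
      rw [← hi, ← hj', ← hi', image_image, image_image]
      exact image_congr fun x _ => h1 x
    · cases hj
      exact ⟨e', h3⟩

theorem exists_map_iso (h : IsAttach γ f φ e) (h' : IsAttach γ' f' φ' e') {g : X → X'}
    (hg : IsCellIso g) (hγ : ∀ u ∈ sphere (0 : Fin m → ℝ) 1, γ' u = g (γ u)) :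
    ∃ G : Y → Y', IsCellIso G ∧ (∀ x, G (f x) = f' (g x)) ∧
      ∀ u ∈ closedBall (0 : Fin m → ℝ) 1, G (φ u) = φ' u := by
  obtain ⟨G, hG, h1, h2, -⟩ := h.exists_map h' hg.1 hγ
  refine ⟨G, ⟨hG, fun y => ?_⟩, h1, h2⟩
  rcases h'.mem_range_or y with ⟨x, rfl⟩ | ⟨u, hu, rfl⟩
  · obtain ⟨x, rfl⟩ := hg.2 x
    exact ⟨f x, h1 x⟩
  · exact ⟨φ u, h2 u (ball_subset_closedBall hu)⟩

/-- Attaching the same cell to both complexes of an elementary expansion gives an elementary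
expansion. -/
theorem exists_map_expansion (h : IsAttach γ f φ e) (h' : IsAttach γ' f' φ' e') {g : X → X'}
    (hg : IsElemExpansion g) (hγ : ∀ u ∈ sphere (0 : Fin m → ℝ) 1, γ' u = g (γ u)) :
    ∃ G : Y → Y', IsElemExpansion G ∧ ∀ x, G (f x) = f' (g x) := by
  obtain ⟨hemb, k, a, a', ψ, ha, ha', hun, hψ, hinj, him, hinj', him', hrest⟩ := hg
  obtain ⟨G, hG, h1, h2, h3⟩ := h.exists_map h' hemb hγ
  obtain ⟨c, hc⟩ := h'.emb.cell k a
  obtain ⟨c', hc'⟩ := h'.emb.cell (k + 1) a'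
  have hdisj : ∀ s : Set X', Disjoint s (range g) → Disjoint (f' '' s) (range G) := by
    intro s hs
    rw [Set.disjoint_left] at hs ⊢
    rintro _ ⟨x, hx, rfl⟩ ⟨y, hy⟩
    rcases h.mem_range_or y with ⟨z, rfl⟩ | ⟨u, hu, rfl⟩
    · rw [h1] at hy
      exact hs hx ⟨z, h'.emb.injective hy⟩
    · rw [h2 u (ball_subset_closedBall hu)] at hy
      exact h'.ne hu _ hy
  refine ⟨G, ⟨hG, k, c, c', f' ∘ ψ, hc ▸ hdisj _ ha, hc' ▸ hdisj _ ha', ?_,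
    h'.emb.continuous.comp_continuousOn hψ, h'.emb.injective.comp_injOn hinj, ?_,
    h'.emb.injective.comp_injOn hinj', ?_, ?_⟩, h1⟩
  · refine eq_univ_of_forall fun y => ?_
    rcases h'.mem_range_or y with ⟨x, rfl⟩ | ⟨u, hu, rfl⟩
    · have hx : x ∈ range g ∪ X'.openCell a ∪ X'.openCell a' := hun ▸ mem_univ x
      rcases hx with (⟨z, rfl⟩ | hx) | hx
      · exact Or.inl (Or.inl ⟨f z, h1 z⟩)
      · exact Or.inl (Or.inr (hc ▸ mem_image_of_mem _ hx))
      · exact Or.inr (hc' ▸ mem_image_of_mem _ hx)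
    · exact Or.inl (Or.inl ⟨φ u, h2 u (ball_subset_closedBall hu)⟩)
  · rw [← hc', ← him, image_comp]
  · rw [← hc, ← him', image_image]
    rfl
  · intro x hx hx'
    obtain ⟨z, hz⟩ := hrest x hx hx'
    exact ⟨f z, by rw [h1, hz]; rfl⟩

end IsAttach

/-! ### The adjunction space -/

/-- The points of the space obtained from `X` by attaching an `m`-cell: those of `X` and those of
the open ball. -/
def AttachSpace (X : FinCW) {m : ℕ} (_γ : (Fin m → ℝ) → X) : Type :=
  X ⊕ ball (0 : Fin m → ℝ) 1

namespace AttachSpace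

variable {X : FinCW} {m : ℕ} (γ : (Fin m → ℝ) → X)

/-- The inclusion of `X`. -/
def base (x : X) : AttachSpace X γ := Sum.inl x

open Classical in
/-- The characteristic map of the new cell. -/
noncomputable def char (u : Fin m → ℝ) : AttachSpace X γ :=
  if h : u ∈ ball (0 : Fin m → ℝ) 1 then Sum.inr ⟨u, h⟩ else Sum.inl (γ u)

/-- The quotient topology from the disjoint union of `X` and the closed ball. -/
noncomputable instance : TopologicalSpace (AttachSpace X γ) :=
  TopologicalSpace.coinduced
    (Sum.elim (base γ) fun u : closedBall (0 : Fin m → ℝ) 1 => char γ u) inferInstance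

theorem continuous_base : Continuous (base γ) :=
  (continuous_coinduced_rng (f := Sum.elim (base γ)
    fun u : closedBall (0 : Fin m → ℝ) 1 => char γ u)).comp continuous_inl

theorem continuousOn_char : ContinuousOn (char γ) (closedBall 0 1) := by
  rw [continuousOn_iff_continuous_domRestrict]
  exact (continuous_coinduced_rng (f := Sum.elim (base γ)
    fun u : closedBall (0 : Fin m → ℝ) 1 => char γ u)).comp continuous_inr

theorem char_of_mem_ball {u : Fin m → ℝ} (hu : u ∈ ball (0 : Fin m → ℝ) 1) :
    char γ u = Sum.inr ⟨u, hu⟩ := dif_pos hu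

theorem char_of_mem_sphere {u : Fin m → ℝ} (hu : u ∈ sphere (0 : Fin m → ℝ) 1) :
    char γ u = base γ (γ u) :=
  dif_neg fun h => by
    rw [mem_ball_zero_iff] at h
    rw [mem_sphere_zero_iff_norm] at hu
    exact h.ne hu

theorem base_injective : Function.Injective (base γ) := Sum.inl_injective

theorem char_injOn : InjOn (char γ) (ball 0 1) := by
  intro u hu v hv h
  rw [char_of_mem_ball γ hu, char_of_mem_ball γ hv] at h
  exact congrArg Subtype.val (Sum.inr_injective h)

theorem char_ne_base {u : Fin m → ℝ} (hu : u ∈ ball (0 : Fin m → ℝ) 1) (x : X) :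
    char γ u ≠ base γ x := by
  rw [char_of_mem_ball γ hu]
  exact Sum.inr_ne_inl

variable {γ} in
theorem cases (p : AttachSpace X γ) :
    (∃ x, base γ x = p) ∨ ∃ u ∈ ball (0 : Fin m → ℝ) 1, char γ u = p := by
  rcases p with x | ⟨u, hu⟩
  · exact Or.inl ⟨x, rfl⟩
  · exact Or.inr ⟨u, hu, char_of_mem_ball γ hu⟩

theorem exists_function (g : C(X, ℝ)) (h : C((Fin m → ℝ), ℝ))
    (hgh : ∀ u ∈ sphere (0 : Fin m → ℝ) 1, h u = g (γ u)) :
    ∃ F : AttachSpace X γ → ℝ, Continuous F ∧ (∀ x, F (base γ x) = g x) ∧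
      ∀ u ∈ ball (0 : Fin m → ℝ) 1, F (char γ u) = h u := by
  have h1 : ∀ u ∈ ball (0 : Fin m → ℝ) 1,
      (Sum.elim g (fun u => h u) : X ⊕ ball (0 : Fin m → ℝ) 1 → ℝ) (char γ u) = h u := by
    intro u hu
    rw [char_of_mem_ball γ hu]
    rfl
  refine ⟨Sum.elim g fun u => h u, ?_, fun x => rfl, h1⟩
  refine continuous_coinduced_dom.2 (continuous_sum_dom.2 ⟨g.continuous, ?_⟩)
  refine (h.continuous.comp continuous_subtype_val).congr fun u => ?_
  rcases (mem_closedBall_zero_iff.1 u.2).lt_or_eq with hu | hu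
  · exact (h1 u (mem_ball_zero_iff.2 hu)).symm
  · have hu' := mem_sphere_zero_iff_norm.2 hu
    refine (hgh u hu').trans ?_
    change _ = (Sum.elim g (fun u => h u) : X ⊕ ball (0 : Fin m → ℝ) 1 → ℝ) (char γ u)
    rw [char_of_mem_sphere γ hu']
    rfl

variable {γ}

theorem exists_separating (hγ : ContinuousOn γ (sphere 0 1)) (p q : AttachSpace X γ)
    (hpq : p ≠ q) : ∃ F : AttachSpace X γ → ℝ, Continuous F ∧ F p ≠ F q := by
  have key : ∀ u ∈ ball (0 : Fin m → ℝ) 1, ∀ q, char γ u ≠ q →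
      ∃ F : AttachSpace X γ → ℝ, Continuous F ∧ F (char γ u) ≠ F q := by
    intro u hu q hq
    have hu' : 1 - ‖u‖ ≠ 0 := by
      rw [mem_ball_zero_iff] at hu
      linarith
    rcases cases q with ⟨x, rfl⟩ | ⟨v, hv, rfl⟩
    · obtain ⟨F, hF, h1, h2⟩ := exists_function γ 0 ⟨fun v => 1 - ‖v‖, by fun_prop⟩
        (fun v hv => by simp [mem_sphere_zero_iff_norm.1 hv])
      refine ⟨F, hF, ?_⟩
      rw [h1, h2 u hu]
      exact hu'
    · obtain ⟨F, hF, h1, h2⟩ := exists_function γ 0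
        ⟨fun w => (1 - ‖w‖) * dist w v, by fun_prop⟩
        (fun v hv => by simp [mem_sphere_zero_iff_norm.1 hv])
      refine ⟨F, hF, ?_⟩
      rw [h2 u hu, h2 v hv]
      have huv : u ≠ v := fun h => hq (by rw [h])
      simpa [hu'] using huv
  rcases cases p with ⟨x, rfl⟩ | ⟨u, hu, rfl⟩
  · rcases cases q with ⟨x', rfl⟩ | ⟨v, hv, rfl⟩
    · have hx : x ≠ x' := fun h => hpq (by rw [h])
      obtain ⟨g, hg0, hg1, -⟩ := exists_continuous_zero_one_of_isClosed
        (isClosed_singleton (x := x)) (isClosed_singleton (x := x')) (by simpa using hx)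
      obtain ⟨h, hh⟩ := ContinuousMap.exists_restrict_eq (Y := ℝ)
        (isClosed_sphere (x := (0 : Fin m → ℝ)) (ε := 1))
        ⟨fun u => g (γ u), g.continuous.comp hγ.domRestrict⟩
      obtain ⟨F, hF, h1, -⟩ := exists_function γ g h fun u hu => DFunLike.congr_fun hh ⟨u, hu⟩
      refine ⟨F, hF, ?_⟩
      rw [h1, h1, hg0 rfl, hg1 rfl]
      simp
    · obtain ⟨F, hF, h⟩ := key v hv _ hpq.symm
      exact ⟨F, hF, h.symm⟩
  · exact key u hu q hpq

theorem t2Space (hγ : ContinuousOn γ (sphere 0 1)) : T2Space (AttachSpace X γ) := by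
  refine ⟨fun p q hpq => ?_⟩
  obtain ⟨F, hF, hne⟩ := exists_separating hγ p q hpq
  exact separated_by_continuous hF hne

variable (γ)

/-- The characteristic maps: those of `X` and that of the new cell. -/
noncomputable def cellMap (k : ℕ) : X.Cell k ⊕ {_u : Unit // k = m} → (Fin k → ℝ) → AttachSpace X γ
  | .inl i => fun u => base γ (X.cmap i u)
  | .inr h => fun u => char γ fun a => u (Fin.cast h.2.symm a)

theorem cellMap_inr (h : {_u : Unit // m = m}) : cellMap γ m (.inr h) = char γ := rfl

end AttachSpace

open AttachSpace in
/-- A cell can be attached along any map of the boundary of the cube to the lower skeleton. -/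
theorem exists_attach (X : FinCW) {m : ℕ} (γ : (Fin m → ℝ) → X)
    (hγ : ContinuousOn γ (sphere 0 1)) (hs : ∀ u ∈ sphere (0 : Fin m → ℝ) 1, γ u ∈ X.skelLT m) :
    ∃ (Y : FinCW) (f : X → Y) (φ : (Fin m → ℝ) → Y) (e : Y.Cell m), IsAttach γ f φ e := by
  have := t2Space hγ
  have hbase : ∀ {k : ℕ} {x : X} {i : X.Cell k}, x ∈ X.openCell i →
      base γ x ∈ cellMap γ k (.inl i) '' ball 0 1 := by
    rintro k _ i ⟨v, hv, rfl⟩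
    exact ⟨v, hv, rfl⟩
  let Y : FinCW := ofCells (AttachSpace X γ) (fun k => X.Cell k ⊕ {_u : Unit // k = m}) (cellMap γ)
    (by
      -- one cell more than `X` has
      refine Finite.of_injective
        (β := (Σ k, X.Cell k) ⊕ Unit) (fun p => match p with
          | ⟨k, .inl i⟩ => .inl ⟨k, i⟩
          | ⟨k, .inr _⟩ => .inr ()) ?_
      rintro ⟨k, i | ⟨_, rfl⟩⟩ ⟨l, j | ⟨_, rfl⟩⟩ h
      · cases h
        rfl
      · cases h
      · cases h
      · rfl)
    (by
      rintro k (i | ⟨_, rfl⟩)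
      · exact (continuous_base γ).comp_continuousOn (X.continuousOn_cmap i)
      · exact continuousOn_char γ)
    (by
      rintro k (i | ⟨_, rfl⟩)
      · exact (base_injective γ).comp_injOn (X.injOn_cmap i)
      · exact char_injOn γ)
    (by
      rintro k l (i | ⟨_, rfl⟩) (j | ⟨_, rfl⟩) u hu v hv huv
      · have h := X.cmap_mem_openCell i hu
        rw [base_injective γ huv] at h
        cases cell_unique h (X.cmap_mem_openCell j hv)
        rfl
      · exact absurd huv.symm (char_ne_base γ hv _)
      · exact absurd huv (char_ne_base γ hu _)
      · rfl)
    (by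
      rintro k (i | ⟨_, rfl⟩) u hu
      · obtain ⟨l, hl, j, hj⟩ := X.cmap_mem_skelLT i hu
        exact ⟨l, hl, .inl j, hbase hj⟩
      · obtain ⟨l, hl, j, hj⟩ := hs u hu
        refine ⟨l, hl, .inl j, ?_⟩
        rw [cellMap_inr, char_of_mem_sphere γ hu]
        exact hbase hj)
    (by
      intro z
      rcases AttachSpace.cases z with ⟨x, rfl⟩ | ⟨u, hu, rfl⟩
      · obtain ⟨k, i, hi⟩ := X.exists_mem_openCell x
        exact ⟨k, .inl i, hbase hi⟩
      · exact ⟨m, .inr ⟨(), rfl⟩, u, hu, rfl⟩)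
  let e : Y.Cell m := (Sum.inr ⟨(), rfl⟩ : X.Cell m ⊕ {_u : Unit // m = m})
  have he : char γ '' ball 0 1 = Y.openCell e := rfl
  refine ⟨Y, base γ, char γ, e, ⟨continuous_base γ, base_injective γ, fun k i =>
    ⟨(Sum.inl i : X.Cell k ⊕ {_u : Unit // k = m}), ?_⟩⟩, continuousOn_char γ, char_injOn γ, he,
    ?_, ?_, fun u hu => char_of_mem_sphere γ hu⟩
  · change base γ '' (X.cmap i '' ball 0 1) = (fun u => base γ (X.cmap i u)) '' ball 0 1
    rw [image_image]
  · rw [← he]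
    refine Set.disjoint_left.2 ?_
    rintro _ ⟨u, hu, rfl⟩ ⟨x, hx⟩
    exact char_ne_base γ hu x hx.symm
  · refine eq_univ_of_forall fun z => ?_
    rw [← he]
    exact AttachSpace.cases z

end FinCW

namespace FinCW

/-! ### Deformations relative to a space -/

/-- One step of a `d`-deformation between complexes under a fixed space `P`. -/
def RelStep (d : ℕ) {P : Type} (A B : Σ X : FinCW, P → X) : Prop :=
  A.1.DimLE d ∧ B.1.DimLE d ∧
    ∃ f : A.1 → B.1, (∀ p, f (A.2 p) = B.2 p) ∧ (IsCellIso f ∨ IsElemExpansion f)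

/-- `d`-deformation equivalence of complexes under a fixed space `P`. For `P` empty this is
`FinCW.Deform`, for `P` a wedge of circles it is `BdCW.Deform`. -/
def RelDeform (d : ℕ) {P : Type} : (Σ X : FinCW, P → X) → (Σ X : FinCW, P → X) → Prop :=
  Relation.EqvGen (RelStep d)

variable {d : ℕ} {P : Type} {A B : Σ X : FinCW, P → X}

theorem RelDeform.forget (h : RelDeform d A B) : Deform d A.1 B.1 := by
  induction h with
  | rel _ _ h =>
    obtain ⟨h1, h2, f, -, h3⟩ := h
    exact .rel _ _ ⟨h1, h2, f, h3⟩
  | refl _ => exact .refl _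
  | symm _ _ _ ih => exact .symm _ _ ih
  | trans _ _ _ _ _ ih ih' => exact .trans _ _ _ ih ih'

theorem RelDeform.comp {Q : Type} (h : RelDeform d A B) (g : Q → P) :
    RelDeform d ⟨A.1, A.2 ∘ g⟩ ⟨B.1, B.2 ∘ g⟩ := by
  induction h with
  | rel _ _ h =>
    obtain ⟨h1, h2, f, hf, h3⟩ := h
    exact .rel _ _ ⟨h1, h2, f, fun q => hf (g q), h3⟩
  | refl _ => exact .refl _
  | symm _ _ _ ih => exact .symm _ _ ih
  | trans _ _ _ _ _ ih ih' => exact .trans _ _ _ ih ih'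

theorem IsCellIso.relDeform {X Y : FinCW} {f : X → Y} (h : IsCellIso f) (hX : X.DimLE d)
    {ι : P → X} {κ : P → Y} (hf : ∀ p, f (ι p) = κ p) : RelDeform d ⟨X, ι⟩ ⟨Y, κ⟩ := by
  obtain ⟨g, hg, -⟩ := h.exists_inverse
  exact .rel _ _ ⟨hX, hg.1.dimLE hX, f, hf, Or.inl h⟩

theorem RelStep.isCellEmbedding {f : A.1 → B.1} (h : IsCellIso f ∨ IsElemExpansion f) :
    IsCellEmbedding f := by
  rcases h with h | h
  exacts [h.1, h.1]

/-- Attaching the same cell, along a map into the fixed space, to both ends of a deformation. -/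
theorem RelDeform.attach_aux {m : ℕ} (hm : m ≤ d) (γ : (Fin m → ℝ) → P)
    (h : RelDeform d A B) :
    ((A.1.DimLE d ∧ ContinuousOn (A.2 ∘ γ) (sphere 0 1) ∧
        ∀ u ∈ sphere (0 : Fin m → ℝ) 1, A.2 (γ u) ∈ A.1.skelLT m) ↔
      (B.1.DimLE d ∧ ContinuousOn (B.2 ∘ γ) (sphere 0 1) ∧
        ∀ u ∈ sphere (0 : Fin m → ℝ) 1, B.2 (γ u) ∈ B.1.skelLT m)) ∧
    (A.1.DimLE d → ∀ (Y Y' : FinCW) (f : A.1 → Y) (f' : B.1 → Y') (φ : (Fin m → ℝ) → Y)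
      (φ' : (Fin m → ℝ) → Y') (e : Y.Cell m) (e' : Y'.Cell m), IsAttach (A.2 ∘ γ) f φ e →
      IsAttach (B.2 ∘ γ) f' φ' e' → RelDeform d ⟨Y, f ∘ A.2⟩ ⟨Y', f' ∘ B.2⟩) := by
  induction h with
  | rel A B h =>
    obtain ⟨h1, h2, g, hg, h3⟩ := h
    have hemb := RelStep.isCellEmbedding h3
    refine ⟨?_, ?_⟩
    · rw [hemb.isClosedEmbedding.isInducing.continuousOn_iff]
      have e1 : g ∘ (A.2 ∘ γ) = B.2 ∘ γ := funext fun u => hg (γ u)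
      rw [e1]
      simp only [← hg, hemb.mem_skelLT_iff, h1, h2]
    · intro _ Y Y' f f' φ φ' e e' hY hY'
      have hγ : ∀ u ∈ sphere (0 : Fin m → ℝ) 1, (B.2 ∘ γ) u = g ((A.2 ∘ γ) u) :=
        fun u _ => (hg (γ u)).symm
      rcases h3 with h3 | h3
      · obtain ⟨G, hG, hG', -⟩ := hY.exists_map_iso hY' h3 hγ
        exact .rel _ _ ⟨hY.dimLE h1 hm, hY'.dimLE h2 hm, G,
          fun p => (hG' _).trans (congrArg f' (hg p)), Or.inl hG⟩
      · obtain ⟨G, hG, hG'⟩ := hY.exists_map_expansion hY' h3 hγ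
        exact .rel _ _ ⟨hY.dimLE h1 hm, hY'.dimLE h2 hm, G,
          fun p => (hG' _).trans (congrArg f' (hg p)), Or.inr hG⟩
  | refl A =>
    refine ⟨Iff.rfl, fun hA Y Y' f f' φ φ' e e' hY hY' => ?_⟩
    obtain ⟨G, hG, hG', -⟩ := hY.exists_map_iso hY' (g := id)
      ⟨IsCellEmbedding.id _, Function.surjective_id⟩ (fun _ _ => rfl)
    exact hG.relDeform (hY.dimLE hA hm) fun p => hG' _
  | symm A B _ ih =>
    refine ⟨ih.1.symm, fun hB Y Y' f f' φ φ' e e' hY hY' => .symm _ _ ?_⟩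
    refine ih.2 (ih.1.2 ⟨hB, ?_, ?_⟩).1 _ _ _ _ _ _ _ _ hY' hY
    · exact hY.continuousOn_attaching
    · exact fun u hu => hY.attaching_mem hu
  | trans A B C _ _ ih ih' =>
    refine ⟨ih.1.trans ih'.1, fun hA Y Y' f f' φ φ' e e' hY hY' => ?_⟩
    have hB := ih.1.1 ⟨hA, hY.continuousOn_attaching, fun u hu => hY.attaching_mem hu⟩
    obtain ⟨Z, f'', φ'', e'', hZ⟩ := exists_attach B.1 (B.2 ∘ γ) hB.2.1 hB.2.2
    exact .trans _ _ _ (ih.2 hA _ _ _ _ _ _ _ _ hY hZ)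
      (ih'.2 hB.1 _ _ _ _ _ _ _ _ hZ hY')

theorem RelDeform.attach {m : ℕ} (hm : m ≤ d) {γ : (Fin m → ℝ) → P} (h : RelDeform d A B)
    (hA : A.1.DimLE d) {Y Y' : FinCW} {f : A.1 → Y} {f' : B.1 → Y'} {φ : (Fin m → ℝ) → Y}
    {φ' : (Fin m → ℝ) → Y'} {e : Y.Cell m} {e' : Y'.Cell m} (hY : IsAttach (A.2 ∘ γ) f φ e)
    (hY' : IsAttach (B.2 ∘ γ) f' φ' e') : RelDeform d ⟨Y, f ∘ A.2⟩ ⟨Y', f' ∘ B.2⟩ :=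
  (h.attach_aux hm γ).2 hA _ _ _ _ _ _ _ _ hY hY'

/-! ### Elementary expansions are deformation retractions -/

theorem norm_cons {m : ℕ} (a : ℝ) (y : Fin m → ℝ) :
    ‖(Fin.cons a y : Fin (m + 1) → ℝ)‖ = max |a| ‖y‖ := by
  apply le_antisymm
  · refine (pi_norm_le_iff_of_nonneg (le_max_of_le_left (abs_nonneg a))).2 fun i => ?_
    refine Fin.cases ?_ (fun i => ?_) i
    · exact le_max_left _ _
    · exact (norm_le_pi_norm y i).trans (le_max_right _ _)
  · refine max_le (norm_le_pi_norm (Fin.cons a y : Fin (m + 1) → ℝ) 0) ?_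
    exact (pi_norm_le_iff_of_nonneg (norm_nonneg _)).2 fun i =>
      norm_le_pi_norm (Fin.cons a y : Fin (m + 1) → ℝ) i.succ

theorem cons_mem_closedBall {m : ℕ} {a : ℝ} {y : Fin m → ℝ} :
    (Fin.cons a y : Fin (m + 1) → ℝ) ∈ closedBall (0 : Fin (m + 1) → ℝ) 1 ↔
      |a| ≤ 1 ∧ y ∈ closedBall (0 : Fin m → ℝ) 1 := by
  rw [mem_closedBall_zero_iff, norm_cons, max_le_iff, mem_closedBall_zero_iff]

theorem cons_mem_sphere {m : ℕ} {a : ℝ} {y : Fin m → ℝ} :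
    (Fin.cons a y : Fin (m + 1) → ℝ) ∈ sphere (0 : Fin (m + 1) → ℝ) 1 ↔
      (|a| = 1 ∧ y ∈ closedBall (0 : Fin m → ℝ) 1) ∨
        |a| ≤ 1 ∧ y ∈ sphere (0 : Fin m → ℝ) 1 := by
  rw [mem_sphere_zero_iff_norm, norm_cons, mem_closedBall_zero_iff, mem_sphere_zero_iff_norm,
    max_eq_iff]
  constructor
  · rintro (⟨h1, h2⟩ | ⟨h1, h2⟩)
    · exact Or.inl ⟨h1, h1 ▸ h2⟩
    · exact Or.inr ⟨h1 ▸ h2, h1⟩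
  · rintro (⟨h1, h2⟩ | ⟨h1, h2⟩)
    · exact Or.inl ⟨h1, h1.symm ▸ h2⟩
    · exact Or.inr ⟨h2, h2.symm ▸ h1⟩

/-- The boundary of the cube without the open face `x 0 = 1`. -/
def openBox (m : ℕ) : Set (Fin (m + 1) → ℝ) :=
  {x | x ∈ sphere (0 : Fin (m + 1) → ℝ) 1 ∧ ¬ ∃ y ∈ ball (0 : Fin m → ℝ) 1, x = Fin.cons 1 y}

theorem mem_closedBall_cases {m : ℕ} {x : Fin (m + 1) → ℝ}
    (hx : x ∈ closedBall (0 : Fin (m + 1) → ℝ) 1) :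
    x ∈ ball (0 : Fin (m + 1) → ℝ) 1 ∨ (∃ y ∈ ball (0 : Fin m → ℝ) 1, x = Fin.cons 1 y) ∨
      x ∈ openBox m := by
  rcases (mem_closedBall_zero_iff.1 hx).lt_or_eq with h | h
  · exact Or.inl (mem_ball_zero_iff.2 h)
  · by_cases h' : ∃ y ∈ ball (0 : Fin m → ℝ) 1, x = Fin.cons 1 y
    · exact Or.inr (Or.inl h')
    · exact Or.inr (Or.inr ⟨mem_sphere_zero_iff_norm.2 h, h'⟩)

/-- The cube deformation retracts onto the box consisting of all faces but one: project from a
point above the missing face. -/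
theorem exists_cube_deformation (m : ℕ) :
    ∃ ρ : (Fin (m + 1) → ℝ) × unitInterval → Fin (m + 1) → ℝ,
      ContinuousOn ρ (closedBall 0 1 ×ˢ univ) ∧ (∀ x, ρ (x, 0) = x) ∧
      (∀ x ∈ closedBall (0 : Fin (m + 1) → ℝ) 1, ∀ t,
        ρ (x, t) ∈ closedBall (0 : Fin (m + 1) → ℝ) 1) ∧
      (∀ x ∈ openBox m, ∀ t, ρ (x, t) = x) ∧
      ∀ x ∈ closedBall (0 : Fin (m + 1) → ℝ) 1, ρ (x, 1) ∈ openBox m := by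
  -- the ray from `(3, 0)` through `x` leaves the cube at distance `1 / M x` times that of `x`
  let M : (Fin (m + 1) → ℝ) → ℝ := fun x => max ‖Fin.tail x‖ ((3 - x 0) / 4)
  have hM : Continuous M := by
    have : Continuous fun x : Fin (m + 1) → ℝ => Fin.tail x :=
      continuous_pi fun i => continuous_apply i.succ
    fun_prop
  let r : (Fin (m + 1) → ℝ) → Fin (m + 1) → ℝ := fun x =>
    Fin.cons (3 + (M x)⁻¹ * (x 0 - 3)) ((M x)⁻¹ • Fin.tail x)
  have hMpos : ∀ x ∈ closedBall (0 : Fin (m + 1) → ℝ) 1, 0 < M x := by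
    intro x hx
    have h0 := (norm_le_pi_norm x 0).trans (mem_closedBall_zero_iff.1 hx)
    rw [Real.norm_eq_abs, abs_le] at h0
    exact lt_max_of_lt_right (by linarith)
  have hr : ContinuousOn r (closedBall 0 1) := by
    have h1 : ContinuousOn (fun x => (M x)⁻¹) (closedBall 0 1) :=
      hM.continuousOn.inv₀ fun x hx => (hMpos x hx).ne'
    refine continuousOn_pi.2 fun i => ?_
    refine Fin.cases ?_ (fun i => ?_) i
    · exact continuousOn_const.add (h1.mul ((continuous_apply 0).continuousOn.sub
        continuousOn_const))
    · exact h1.mul (continuous_apply i.succ).continuousOn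
  have hrbox : ∀ x ∈ closedBall (0 : Fin (m + 1) → ℝ) 1, r x ∈ openBox m := by
    intro x hx
    have hpos := hMpos x hx
    rw [← Fin.cons_self_tail x, cons_mem_closedBall, mem_closedBall_zero_iff, abs_le] at hx
    obtain ⟨⟨h1, h2⟩, h3⟩ := hx
    have h4 : ‖Fin.tail x‖ ≤ M x := le_max_left _ _
    have h5 : (3 - x 0) / 4 ≤ M x := le_max_right _ _
    have h6 : M x ≤ 1 := max_le h3 (by linarith)
    have h7 : ‖(M x)⁻¹ • Fin.tail x‖ = (M x)⁻¹ * ‖Fin.tail x‖ := by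
      rw [norm_smul, Real.norm_eq_abs, abs_of_pos (inv_pos.2 hpos)]
    have h8 : ‖(M x)⁻¹ • Fin.tail x‖ ≤ 1 := by
      rw [h7, inv_mul_le_iff₀ hpos]
      simpa using h4
    have h9 : 1 ≤ (M x)⁻¹ := (one_le_inv₀ hpos).2 h6
    have h10 : (M x)⁻¹ * (3 - x 0) ≤ 4 := by
      rw [inv_mul_le_iff₀ hpos]
      linarith
    have h11 : |3 + (M x)⁻¹ * (x 0 - 3)| ≤ 1 := by
      rw [abs_le]
      constructor <;> nlinarith
    -- `M x` is the larger of two terms: the ray leaves through a side or through the bottom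
    rcases max_choice ‖Fin.tail x‖ ((3 - x 0) / 4) with h | h
    · have h12 : ‖(M x)⁻¹ • Fin.tail x‖ = 1 := by
        rw [h7]
        change (max _ _)⁻¹ * _ = _
        rw [h]
        refine inv_mul_cancel₀ fun h0 => ?_
        rw [h0] at h
        exact hpos.ne' (by simp only [M, h0]; exact h)
      refine ⟨cons_mem_sphere.2 (Or.inr ⟨h11, mem_sphere_zero_iff_norm.2 h12⟩), ?_⟩
      rintro ⟨y, hy, hxy⟩
      rw [← (Fin.cons_injective2 hxy).2, mem_ball_zero_iff] at hy
      exact hy.ne h12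
    · have h12 : 3 + (M x)⁻¹ * (x 0 - 3) = -1 := by
        have : M x = (3 - x 0) / 4 := h
        rw [this]
        have : 3 - x 0 ≠ 0 := by linarith
        field_simp
        ring
      refine ⟨cons_mem_sphere.2 (Or.inl ⟨by rw [h12]; simp, mem_closedBall_zero_iff.2 h8⟩), ?_⟩
      rintro ⟨y, -, hxy⟩
      have := (Fin.cons_injective2 hxy).1
      linarith
  have hrfix : ∀ x ∈ openBox m, r x = x := by
    rintro x ⟨hx, hx'⟩
    have hM1 : M x = 1 := by
      rw [← Fin.cons_self_tail x, cons_mem_sphere] at hx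
      rcases hx with ⟨h0, h1⟩ | ⟨h0, h1⟩
      · rw [mem_closedBall_zero_iff] at h1
        rcases eq_or_eq_neg_of_abs_eq h0 with h | h
        · have : ‖Fin.tail x‖ = 1 := by
            by_contra hne
            exact hx' ⟨Fin.tail x, mem_ball_zero_iff.2 (lt_of_le_of_ne h1 hne),
              by rw [← h, Fin.cons_self_tail]⟩
          simp only [M, this, h]
          norm_num
        · simp only [M, h]
          norm_num
          exact h1
      · rw [mem_sphere_zero_iff_norm] at h1
        rw [abs_le] at h0
        simp only [M, h1]
        exact max_eq_left (by linarith)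
    simp only [r, hM1]
    simp
  refine ⟨fun p => p.1 + (p.2 : ℝ) • (r p.1 - p.1), ?_, fun x => by simp, ?_, ?_, ?_⟩
  · have h1 : ContinuousOn (fun p : (Fin (m + 1) → ℝ) × unitInterval => r p.1)
        (closedBall 0 1 ×ˢ univ) := hr.comp continuousOn_fst fun p hp => hp.1
    have h2 : ContinuousOn (fun p : (Fin (m + 1) → ℝ) × unitInterval => (p.2 : ℝ))
        (closedBall 0 1 ×ˢ univ) := (continuous_subtype_val.comp continuous_snd).continuousOn
    exact continuousOn_fst.add (h2.smul (h1.sub continuousOn_fst))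
  · intro x hx t
    exact (convex_closedBall (0 : Fin (m + 1) → ℝ) 1).add_smul_sub_mem hx
      (sphere_subset_closedBall (hrbox x hx).1) t.2
  · intro x hx t
    simp [hrfix x hx]
  · intro x hx
    simpa using hrbox x hx

/-- An elementary expansion deformation retracts onto the subcomplex. The retraction is cellular,
and the homotopy raises dimensions by at most one. -/
theorem IsElemExpansion.exists_deformation {X Y : FinCW} {f : X → Y} (h : IsElemExpansion f) :
    ∃ H : Y × unitInterval → Y, Continuous H ∧ (∀ y, H (y, 0) = y) ∧
      (∀ x t, H (f x, t) = f x) ∧ (∀ y, H (y, 1) ∈ range f) ∧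
      ∀ k, ∀ y ∈ Y.skelLT k, (∀ t, H (y, t) ∈ Y.skelLT (k + 1)) ∧ H (y, 1) ∈ Y.skelLT k := by
  classical
  obtain ⟨hemb, m, e, e', φ, he, he', hun, hφ, hinj, him, hinj', him', hrest⟩ := h
  obtain ⟨ρ, hρ, hρ0, hρD, hρfix, hρ1⟩ := exists_cube_deformation m
  set D := closedBall (0 : Fin (m + 1) → ℝ) 1 with hD
  have hbox : ∀ u ∈ openBox m, φ u ∈ range f := fun u hu => hrest u hu.1 hu.2
  have hee : ∀ y, y ∈ Y.openCell e → y ∉ Y.openCell e' := by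
    intro y h1 h2
    cases cell_unique h1 h2
  have hcases : ∀ y ∉ range f, ∃ u ∈ D, φ u = y := by
    intro y hy
    have h1 : y ∈ range f ∪ Y.openCell e ∪ Y.openCell e' := hun ▸ mem_univ y
    rcases h1 with (h1 | h1) | h1
    · exact absurd h1 hy
    · rw [← him'] at h1
      obtain ⟨v, hv, rfl⟩ := h1
      exact ⟨_, cons_mem_closedBall.2 ⟨by simp, ball_subset_closedBall hv⟩, rfl⟩
    · rw [← him] at h1
      obtain ⟨u, hu, rfl⟩ := h1
      exact ⟨u, ball_subset_closedBall hu, rfl⟩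
  have hcell : ∀ u ∈ D, φ u ∉ range f → u ∈ ball (0 : Fin (m + 1) → ℝ) 1 ∨
      ∃ y ∈ ball (0 : Fin m → ℝ) 1, u = Fin.cons 1 y := by
    intro u hu hu'
    rcases mem_closedBall_cases hu with h1 | h1 | h1
    · exact Or.inl h1
    · exact Or.inr h1
    · exact absurd (hbox u h1) hu'
  have hface : ∀ v ∈ ball (0 : Fin m → ℝ) 1, φ (Fin.cons 1 v) ∈ Y.openCell e :=
    fun v hv => him' ▸ mem_image_of_mem (fun y : Fin m → ℝ => φ (Fin.cons 1 y)) hv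
  have hint : ∀ u ∈ ball (0 : Fin (m + 1) → ℝ) 1, φ u ∈ Y.openCell e' :=
    fun u hu => him ▸ mem_image_of_mem φ hu
  -- outside of the subcomplex the homotopy of the cube descends, as `φ` is injective there
  have hunique : ∀ u ∈ D, ∀ v ∈ D, φ u ∉ range f → φ u = φ v → u = v := by
    intro u hu v hv hu' huv
    rcases hcell u hu hu' with h1 | ⟨y, hy, rfl⟩ <;>
    rcases hcell v hv (huv ▸ hu') with h2 | ⟨z, hz, rfl⟩
    · exact hinj h1 h2 huv
    · exact absurd (hint u h1) (hee _ (huv ▸ hface z hz))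
    · exact absurd (hint v h2) (hee _ (huv ▸ hface y hy))
    · exact congrArg _ (hinj' hy hz huv)
  let H : Y × unitInterval → Y := fun p =>
    if hp : p.1 ∈ range f then p.1 else φ (ρ ((hcases p.1 hp).choose, p.2))
  have hH1 : ∀ x t, H (f x, t) = f x := fun x t => dif_pos ⟨x, rfl⟩
  have hH2 : ∀ u ∈ D, ∀ t, H (φ u, t) = φ (ρ (u, t)) := by
    intro u hu t
    by_cases hu' : φ u ∈ range f
    · have h1 : u ∈ openBox m := by
        rcases mem_closedBall_cases hu with h1 | ⟨y, hy, rfl⟩ | h1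
        · exact absurd hu' (Set.disjoint_left.1 he' (hint u h1))
        · exact absurd hu' (Set.disjoint_left.1 he (hface y hy))
        · exact h1
      rw [hρfix u h1]
      exact dif_pos hu'
    · have h1 := (hcases (φ u) hu').choose_spec
      change dite _ _ _ = _
      rw [dif_neg hu', ← hunique u hu _ h1.1 hu' h1.2.symm]
  have : CompactSpace D := isCompact_iff_compactSpace.1 (isCompact_closedBall _ _)
  refine ⟨H, ?_, ?_, hH1, ?_, ?_⟩
  · have hφ' : Continuous fun u : D => φ u := hφ.domRestrict
    refine continuous_of_compact_cover
      (a := fun p : X × unitInterval => ((f p.1, p.2) : Y × unitInterval))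
      (b := fun p : D × unitInterval => ((φ p.1, p.2) : Y × unitInterval))
      ((hemb.continuous.comp continuous_fst).prodMk continuous_snd)
      ((hφ'.comp continuous_fst).prodMk continuous_snd) ?_ ?_ ?_
    · rintro ⟨y, t⟩
      by_cases hy : y ∈ range f
      · obtain ⟨x, rfl⟩ := hy
        exact Or.inl ⟨(x, t), rfl⟩
      · obtain ⟨u, hu, rfl⟩ := hcases y hy
        exact Or.inr ⟨(⟨u, hu⟩, t), rfl⟩
    · exact (hemb.continuous.comp continuous_fst).congr fun p => (hH1 p.1 p.2).symm
    · have h1 : ContinuousOn (φ ∘ ρ) (D ×ˢ univ) :=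
        hφ.comp hρ fun p hp => hρD p.1 hp.1 p.2
      refine (h1.comp_continuous (f := fun p : D × unitInterval => ((p.1 : Fin (m + 1) → ℝ), p.2))
        (by fun_prop) fun p => ⟨p.1.2, mem_univ _⟩).congr fun p => (hH2 p.1 p.1.2 p.2).symm
  · intro y
    by_cases hy : y ∈ range f
    · exact dif_pos hy
    · obtain ⟨u, hu, rfl⟩ := hcases y hy
      rw [hH2 u hu, hρ0]
  · intro y
    by_cases hy : y ∈ range f
    · obtain ⟨x, rfl⟩ := hy
      exact ⟨x, (hH1 x 1).symm⟩
    · obtain ⟨u, hu, rfl⟩ := hcases y hy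
      rw [hH2 u hu]
      exact hbox _ (hρ1 u hu)
  · intro k y hy
    by_cases hyf : y ∈ range f
    · obtain ⟨x, rfl⟩ := hyf
      exact ⟨fun t => by rw [hH1]; exact Y.skelLT_mono (by omega) hy, by rwa [hH1]⟩
    -- a point outside of the subcomplex lies in one of the two new cells
    · have hk : m + 1 ≤ k := by
        obtain ⟨l, hl, j, hj⟩ := hy
        have h1 : y ∈ range f ∪ Y.openCell e ∪ Y.openCell e' := hun ▸ mem_univ y
        rcases h1 with (h1 | h1) | h1
        · exact absurd h1 hyf
        · cases cell_unique h1 hj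
          omega
        · cases cell_unique h1 hj
          omega
      obtain ⟨u, hu, rfl⟩ := hcases y hyf
      have hcl : ∀ v ∈ D, φ v ∈ Y.openCell e' ∨ φ v ∈ Y.skelLT (m + 1) := fun v hv =>
        mem_closure_openCell (him ▸ mem_closure_image_ball hφ hv)
      refine ⟨fun t => ?_, ?_⟩
      · rw [hH2 u hu]
        rcases hcl _ (hρD u hu t) with h1 | h1
        · exact ⟨m + 1, by omega, e', h1⟩
        · exact Y.skelLT_mono (by omega) h1
      · rw [hH2 u hu]
        rcases hcl _ (hρD u hu 1) with h1 | h1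
        · exact absurd (hbox _ (hρ1 u hu)) (Set.disjoint_left.1 he' h1)
        · exact Y.skelLT_mono hk h1

open ContinuousMap in
theorem IsElemExpansion.homotopyEquiv {X Y : FinCW} {f : X → Y} (h : IsElemExpansion f) :
    ∃ E : X ≃ₕ Y, ∀ x, E x = f x := by
  obtain ⟨H, hH, h0, hf, h1, -⟩ := h.exists_deformation
  choose r hr using h1
  have hrc : Continuous r := by
    rw [h.1.isClosedEmbedding.isInducing.continuous_iff]
    exact (hH.comp (Continuous.prodMk_left 1)).congr fun y => (hr y).symm
  refine ⟨⟨⟨f, h.1.continuous⟩, ⟨r, hrc⟩, ?_, ?_⟩, fun x => rfl⟩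
  · have : (ContinuousMap.mk r hrc).comp ⟨f, h.1.continuous⟩ = ContinuousMap.id X := by
      ext x
      exact h.1.injective ((hr (f x)).trans (hf x 1))
    rw [this]
  · refine Homotopic.symm ⟨⟨⟨fun p => H (p.2, p.1), hH.comp continuous_swap⟩, fun y => h0 y,
      fun y => (hr y).symm⟩⟩

open ContinuousMap in
theorem Deform.homotopyEquiv {d : ℕ} {X Y : FinCW} (h : Deform d X Y) : Nonempty (X ≃ₕ Y) := by
  induction h with
  | rel X Y h =>
    obtain ⟨-, -, f, h | h⟩ := h
    · exact ⟨(h.isHomeomorph.homeomorph f).toHomotopyEquiv⟩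
    · exact ⟨h.homotopyEquiv.choose⟩
  | refl X => exact ⟨ContinuousMap.HomotopyEquiv.refl X⟩
  | symm _ _ _ ih => exact ⟨ih.some.symm⟩
  | trans _ _ _ _ _ ih ih' => exact ⟨ih.some.trans ih'.some⟩

end FinCW

namespace FinCW

/-! ### Attaching along homotopic maps -/

theorem IsAttach.char_mem_skelLT {X Y : FinCW} {m : ℕ} {γ : (Fin m → ℝ) → X} {f : X → Y}
    {φ : (Fin m → ℝ) → Y} {e : Y.Cell m} (h : IsAttach γ f φ e) {u : Fin m → ℝ}
    (hu : u ∈ closedBall (0 : Fin m → ℝ) 1) : φ u ∈ Y.skelLT (m + 1) := by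
  rcases mem_closure_openCell (h.image ▸ mem_closure_image_ball h.cont hu) with h1 | h1
  · exact ⟨m, by omega, e, h1⟩
  · exact Y.skelLT_mono (by omega) h1

/-- Given a disc `ψ` in `X`, a homotopy `H` from its boundary to `γ` and a cell attached along
`γ`, attach the cylinder whose bottom is `ψ`, whose top is the new cell and whose side is `H`. -/
theorem exists_cylinder {X Y : FinCW} {m : ℕ} {γ ψ : (Fin m → ℝ) → X}
    (hψ : ContinuousOn ψ (closedBall 0 1))
    (hψs : ∀ u ∈ closedBall (0 : Fin m → ℝ) 1, ψ u ∈ X.skelLT (m + 1))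
    {H : ℝ → (Fin m → ℝ) → X}
    (hH : ContinuousOn (fun p : ℝ × (Fin m → ℝ) => H p.1 p.2) (Icc (-1) 1 ×ˢ sphere 0 1))
    (hHs : ∀ t ∈ Icc (-1 : ℝ) 1, ∀ u ∈ sphere (0 : Fin m → ℝ) 1, H t u ∈ X.skelLT (m + 1))
    (h0 : ∀ u ∈ sphere (0 : Fin m → ℝ) 1, H (-1) u = ψ u)
    (h1 : ∀ u ∈ sphere (0 : Fin m → ℝ) 1, H 1 u = γ u)
    {g : X → Y} {φ : (Fin m → ℝ) → Y} {e : Y.Cell m} (hY : IsAttach γ g φ e) :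
    ∃ (Z : FinCW) (Θ : (Fin (m + 1) → ℝ) → Y) (k : Y → Z) (Φ : (Fin (m + 1) → ℝ) → Z)
      (E : Z.Cell (m + 1)), IsAttach Θ k Φ E ∧
      (∀ u ∈ closedBall (0 : Fin m → ℝ) 1, Φ (Fin.cons 1 u) = k (φ u)) ∧
      (∀ u ∈ closedBall (0 : Fin m → ℝ) 1, Φ (Fin.cons (-1) u) = k (g (ψ u))) ∧
      ∀ t ∈ Icc (-1 : ℝ) 1, ∀ u ∈ sphere (0 : Fin m → ℝ) 1,
        Φ (Fin.cons t u) = k (g (H t u)) := by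
  classical
  -- the attaching map of the cylinder, with the coordinate `x 0` as its height
  let Θ : (Fin (m + 1) → ℝ) → Y := fun x =>
    if x 0 = 1 then φ (Fin.tail x) else if x 0 = -1 then g (ψ (Fin.tail x))
    else g (H (x 0) (Fin.tail x))
  have ht : Continuous fun x : Fin (m + 1) → ℝ => (Fin.tail x : Fin m → ℝ) :=
    continuous_pi fun i => continuous_apply i.succ
  have ht0 : Continuous fun x : Fin (m + 1) → ℝ => x 0 := continuous_apply 0
  have hΘ1 : ∀ x : Fin (m + 1) → ℝ, x 0 = 1 → Θ x = φ (Fin.tail x) := fun x hx => if_pos hx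
  have hΘ2 : ∀ x : Fin (m + 1) → ℝ, x 0 = -1 → Θ x = g (ψ (Fin.tail x)) := by
    intro x hx
    have : x 0 ≠ 1 := by
      rw [hx]
      norm_num
    change ite _ _ _ = _
    rw [if_neg this, if_pos hx]
  have hΘ3 : ∀ x : Fin (m + 1) → ℝ, Fin.tail x ∈ sphere (0 : Fin m → ℝ) 1 →
      Θ x = g (H (x 0) (Fin.tail x)) := by
    intro x hx
    by_cases hx1 : x 0 = 1
    · rw [hΘ1 x hx1, hY.bd _ hx, hx1, h1 _ hx]
    · by_cases hx2 : x 0 = -1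
      · rw [hΘ2 x hx2, hx2, h0 _ hx]
      · change ite _ _ _ = _
        rw [if_neg hx1, if_neg hx2]
  have hcover : ∀ x ∈ sphere (0 : Fin (m + 1) → ℝ) 1,
      (x 0 = 1 ∧ Fin.tail x ∈ closedBall (0 : Fin m → ℝ) 1) ∨
      (x 0 = -1 ∧ Fin.tail x ∈ closedBall (0 : Fin m → ℝ) 1) ∨
      (x 0 ∈ Icc (-1 : ℝ) 1 ∧ Fin.tail x ∈ sphere (0 : Fin m → ℝ) 1) := by
    intro x hx
    rw [← Fin.cons_self_tail x, cons_mem_sphere] at hx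
    rcases hx with ⟨h, h'⟩ | ⟨h, h'⟩
    · rcases eq_or_eq_neg_of_abs_eq h with h | h
      · exact Or.inl ⟨h, h'⟩
      · exact Or.inr (Or.inl ⟨h, h'⟩)
    · exact Or.inr (Or.inr ⟨abs_le.1 h, h'⟩)
  have hΘc : ContinuousOn Θ (sphere 0 1) := by
    let S1 : Set (Fin (m + 1) → ℝ) := {x | x 0 = 1 ∧ Fin.tail x ∈ closedBall (0 : Fin m → ℝ) 1}
    let S2 : Set (Fin (m + 1) → ℝ) := {x | x 0 = -1 ∧ Fin.tail x ∈ closedBall (0 : Fin m → ℝ) 1}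
    let S3 : Set (Fin (m + 1) → ℝ) :=
      {x | x 0 ∈ Icc (-1 : ℝ) 1 ∧ Fin.tail x ∈ sphere (0 : Fin m → ℝ) 1}
    have c1 : IsClosed S1 :=
      (isClosed_eq ht0 continuous_const).inter (isClosed_closedBall.preimage ht)
    have c2 : IsClosed S2 :=
      (isClosed_eq ht0 continuous_const).inter (isClosed_closedBall.preimage ht)
    have c3 : IsClosed S3 := (isClosed_Icc.preimage ht0).inter (isClosed_sphere.preimage ht)
    have k1 : ContinuousOn Θ S1 :=
      (hY.cont.comp ht.continuousOn fun x hx => hx.2).congr fun x hx => hΘ1 x hx.1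
    have k2 : ContinuousOn Θ S2 :=
      (hY.emb.continuous.comp_continuousOn
        (hψ.comp ht.continuousOn fun x hx => hx.2)).congr fun x hx => hΘ2 x hx.1
    have k3 : ContinuousOn Θ S3 :=
      (hY.emb.continuous.comp_continuousOn (hH.comp (ht0.prodMk ht).continuousOn
        fun x hx => hx)).congr fun x hx => hΘ3 x hx.2
    refine ((k1.union_of_isClosed k2 c1 c2).union_of_isClosed k3 (c1.union c2) c3).mono ?_
    intro x hx
    rcases hcover x hx with h | h | h
    exacts [Or.inl (Or.inl h), Or.inl (Or.inr h), Or.inr h]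
  have hΘs : ∀ x ∈ sphere (0 : Fin (m + 1) → ℝ) 1, Θ x ∈ Y.skelLT (m + 1) := by
    intro x hx
    rcases hcover x hx with h | h | h
    · rw [hΘ1 x h.1]
      exact hY.char_mem_skelLT h.2
    · rw [hΘ2 x h.1]
      exact hY.emb.mem_skelLT_iff.2 (hψs _ h.2)
    · rw [hΘ3 x h.2]
      exact hY.emb.mem_skelLT_iff.2 (hHs _ h.1 _ h.2)
  obtain ⟨Z, k, Φ, E, hZ⟩ := exists_attach Y Θ hΘc hΘs
  refine ⟨Z, Θ, k, Φ, E, hZ, fun u hu => ?_, fun u hu => ?_, fun t ht u hu => ?_⟩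
  · rw [hZ.bd _ (cons_mem_sphere.2 (Or.inl ⟨by simp, hu⟩)), hΘ1 _ rfl, Fin.tail_cons]
  · rw [hZ.bd _ (cons_mem_sphere.2 (Or.inl ⟨by simp, hu⟩)), hΘ2 _ rfl, Fin.tail_cons]
  · have := hΘ3 (Fin.cons t u) (by rwa [Fin.tail_cons])
    rw [hZ.bd _ (cons_mem_sphere.2 (Or.inr ⟨abs_le.2 ht, hu⟩)), this, Fin.tail_cons,
      Fin.cons_zero]

/-- Attaching an `m`-cell and then an `(m + 1)`-cell which has the first one as a free face is an
elementary expansion. The free face may be the top or the bottom of the cube. -/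
theorem IsAttach.isElemExpansion {W Y Z : FinCW} {m : ℕ} {γ : (Fin m → ℝ) → W} {g : W → Y}
    {φ : (Fin m → ℝ) → Y} {e : Y.Cell m} (hg : IsAttach γ g φ e)
    {Θ : (Fin (m + 1) → ℝ) → Y} {k : Y → Z} {Φ : (Fin (m + 1) → ℝ) → Z} {E : Z.Cell (m + 1)}
    (hk : IsAttach Θ k Φ E) {s : ℝ} (hs : |s| = 1)
    (hface : ∀ u ∈ closedBall (0 : Fin m → ℝ) 1, Φ (Fin.cons s u) = k (φ u))
    (hother : ∀ x ∈ sphere (0 : Fin (m + 1) → ℝ) 1,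
      (¬ ∃ y ∈ ball (0 : Fin m → ℝ) 1, x = Fin.cons s y) → Φ x ∈ range (k ∘ g)) :
    IsElemExpansion (k ∘ g) := by
  -- precompose with the reflection which moves the free face to `x 0 = 1`
  let F : (Fin (m + 1) → ℝ) → Fin (m + 1) → ℝ := fun x => Fin.cons (s * x 0) (Fin.tail x)
  have hs0 : s * s = 1 := by
    rw [← abs_mul_abs_self s, hs, one_mul]
  have hF0 : ∀ a (u : Fin m → ℝ), F (Fin.cons a u) = Fin.cons (s * a) u := fun a u => by
    simp only [F, Fin.cons_zero, Fin.tail_cons]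
  have hFF : ∀ x, F (F x) = x := by
    intro x
    simp only [F, Fin.cons_zero, Fin.tail_cons]
    rw [← mul_assoc, hs0, one_mul, Fin.cons_self_tail]
  have hFn : ∀ x, ‖F x‖ = ‖x‖ := by
    intro x
    rw [← Fin.cons_self_tail x, hF0, norm_cons, norm_cons, abs_mul, hs, one_mul]
  have hFc : Continuous F := by
    refine continuous_pi fun i => ?_
    refine Fin.cases ?_ (fun i => ?_) i
    · exact continuous_const.mul (continuous_apply 0)
    · exact continuous_apply i.succ
  have hFball : F '' ball 0 1 = ball 0 1 := by
    ext x
    constructor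
    · rintro ⟨y, hy, rfl⟩
      rw [mem_ball_zero_iff] at hy ⊢
      rwa [hFn]
    · intro hx
      refine ⟨F x, ?_, hFF x⟩
      rw [mem_ball_zero_iff] at hx ⊢
      rwa [hFn]
  obtain ⟨c, hc⟩ := hk.emb.cell m e
  have hface' : ∀ u ∈ ball (0 : Fin m → ℝ) 1, Φ (F (Fin.cons 1 u)) = k (φ u) := by
    intro u hu
    rw [hF0, mul_one, hface u (ball_subset_closedBall hu)]
  refine ⟨hk.emb.comp hg.emb, m, c, E, Φ ∘ F, ?_, ?_, ?_, ?_, ?_, ?_, ?_, ?_, ?_⟩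
  · rw [← hc, range_comp, disjoint_image_iff hk.emb.injective]
    exact hg.disj
  · exact hk.disj.mono_right (range_comp_subset_range g k)
  · rw [← hc, range_comp, ← image_union, hg.cover, image_univ, hk.cover]
  · exact hk.cont.comp hFc.continuousOn fun x hx => by
      rw [mem_closedBall_zero_iff] at hx ⊢
      rwa [hFn]
  · intro x hx y hy hxy
    have h := hk.inj (hFball ▸ mem_image_of_mem F hx) (hFball ▸ mem_image_of_mem F hy) hxy
    rw [← hFF x, h, hFF]
  · rw [image_comp, hFball, hk.image]
  · intro x hx y hy hxy
    dsimp only [Function.comp_apply] at hxy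
    rw [hface' x hx, hface' y hy] at hxy
    exact hg.inj hx hy (hk.emb.injective hxy)
  · rw [← hc, ← hg.image, image_image]
    exact image_congr hface'
  · intro x hx hx'
    refine hother (F x) ?_ ?_
    · rw [mem_sphere_zero_iff_norm] at hx ⊢
      rwa [hFn]
    · rintro ⟨y, hy, hxy⟩
      refine hx' ⟨y, hy, ?_⟩
      rw [← hFF x, hxy, hF0, hs0]

/-- Two cells attached independently can be attached in either order. -/
theorem IsAttach.swap {X Y₀ Y₁ Y : FinCW} {m k : ℕ} {γ₀ : (Fin m → ℝ) → X} {f₀ : X → Y₀}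
    {φ₀ : (Fin m → ℝ) → Y₀} {e₀ : Y₀.Cell m} (h₀ : IsAttach γ₀ f₀ φ₀ e₀)
    {γ₁ : (Fin k → ℝ) → X} {f₁ : X → Y₁} {φ₁ : (Fin k → ℝ) → Y₁} {e₁ : Y₁.Cell k}
    (h₁ : IsAttach γ₁ f₁ φ₁ e₁) {g : Y₀ → Y} {φ : (Fin k → ℝ) → Y} {e : Y.Cell k}
    (h : IsAttach (f₀ ∘ γ₁) g φ e) :
    ∃ (G : Y₁ → Y) (e' : Y.Cell m), IsAttach (f₁ ∘ γ₀) G (g ∘ φ₀) e' ∧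
      (∀ x, G (f₁ x) = g (f₀ x)) ∧ ∀ u ∈ closedBall (0 : Fin k → ℝ) 1, G (φ₁ u) = φ u := by
  obtain ⟨G, hG, hG1, hG2, -⟩ := h₁.exists_map h h₀.emb (fun _ _ => rfl)
  obtain ⟨e', he'⟩ := h.emb.cell m e₀
  refine ⟨G, e', ⟨hG, h.emb.continuous.comp_continuousOn h₀.cont,
    h.emb.injective.comp_injOn h₀.inj, ?_, ?_, ?_, fun u hu => ?_⟩, hG1, hG2⟩
  · rw [image_comp, h₀.image, he']
  · rw [← he', Set.disjoint_left]
    rintro _ ⟨y, hy, rfl⟩ ⟨z, hz⟩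
    rcases h₁.mem_range_or z with ⟨x, rfl⟩ | ⟨u, hu, rfl⟩
    · rw [hG1] at hz
      exact Set.disjoint_left.1 h₀.disj hy ⟨x, h.emb.injective hz⟩
    · rw [hG2 u (ball_subset_closedBall hu)] at hz
      exact h.ne hu _ hz
  · refine eq_univ_of_forall fun y => ?_
    rcases h.mem_range_or y with ⟨z, rfl⟩ | ⟨u, hu, rfl⟩
    · rcases h₀.mem_range_or z with ⟨x, rfl⟩ | ⟨u, hu, rfl⟩
      · exact Or.inl ⟨f₁ x, hG1 x⟩
      · exact Or.inr (he' ▸ mem_image_of_mem g (h₀.mem_openCell hu))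
    · exact Or.inl ⟨φ₁ u, hG2 u (ball_subset_closedBall hu)⟩
  · dsimp only [Function.comp_apply]
    rw [h₀.bd u hu, hG1]

/-- Attaching an `m`-cell along homotopic maps gives complexes which are `(m + 1)`-deformation
equivalent relative to the base: both are elementary collapses of the complex with both cells and
the cylinder between them. -/
theorem IsAttach.relDeform_of_homotopy {d : ℕ} {X Y₀ Y₁ : FinCW} {m : ℕ} (hm : m + 1 ≤ d)
    (hX : X.DimLE d) {γ₀ : (Fin m → ℝ) → X} {f₀ : X → Y₀} {φ₀ : (Fin m → ℝ) → Y₀}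
    {e₀ : Y₀.Cell m} (h₀ : IsAttach γ₀ f₀ φ₀ e₀) {γ₁ : (Fin m → ℝ) → X} {f₁ : X → Y₁}
    {φ₁ : (Fin m → ℝ) → Y₁} {e₁ : Y₁.Cell m} (h₁ : IsAttach γ₁ f₁ φ₁ e₁)
    {H : (Fin m → ℝ) × unitInterval → X} (hH : ContinuousOn H (sphere 0 1 ×ˢ univ))
    (hHs : ∀ u ∈ sphere (0 : Fin m → ℝ) 1, ∀ t, H (u, t) ∈ X.skelLT (m + 1))
    (hH0 : ∀ u ∈ sphere (0 : Fin m → ℝ) 1, H (u, 0) = γ₀ u)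
    (hH1 : ∀ u ∈ sphere (0 : Fin m → ℝ) 1, H (u, 1) = γ₁ u) :
    RelDeform d ⟨Y₀, f₀⟩ ⟨Y₁, f₁⟩ := by
  -- `Y` carries both cells, and `Z` also the cylinder between them
  obtain ⟨Y, g, φ, e, hY⟩ := exists_attach Y₀ (f₀ ∘ γ₁)
    (h₀.emb.continuous.comp_continuousOn h₁.continuousOn_attaching)
    (fun u hu => h₀.emb.mem_skelLT_iff.2 (h₁.attaching_mem hu))
  -- the homotopy is reparametrized from `[0, 1]` to the height `[-1, 1]` of the cylinder
  let s : ℝ → unitInterval := fun t => projIcc 0 1 zero_le_one ((t + 1) / 2)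
  have hs : Continuous s := continuous_projIcc.comp (by fun_prop)
  have hs0 : s (-1) = 0 := by
    have : s (-1) = projIcc 0 1 zero_le_one (0 : ℝ) := by
      simp only [s]
      norm_num
    rw [this]
    exact projIcc_left _
  have hs1 : s 1 = 1 := by
    have : s 1 = projIcc 0 1 zero_le_one (1 : ℝ) := by
      simp only [s]
      norm_num
    rw [this]
    exact projIcc_right _
  obtain ⟨Z, Θ, k, Φ, E, hZ, hZ1, hZ0, hZs⟩ := exists_cylinder (ψ := φ₀)
    (H := fun t u => f₀ (H (u, s t))) h₀.cont (fun u hu => h₀.char_mem_skelLT hu)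
    (h₀.emb.continuous.comp_continuousOn (hH.comp (by fun_prop)
      fun p hp => ⟨hp.2, mem_univ _⟩))
    (fun t _ u hu => h₀.emb.mem_skelLT_iff.2 (hHs u hu _))
    (fun u hu => by rw [hs0, hH0 u hu, h₀.bd u hu])
    (fun u hu => by rw [hs1, hH1 u hu]; rfl) hY
  obtain ⟨G, e', hG, hG1, hG2⟩ := h₀.swap h₁ hY
  have hZd : Z.DimLE d := hZ.dimLE (hY.dimLE (h₀.dimLE hX (by omega)) (by omega)) hm
  have hside : ∀ t ∈ Icc (-1 : ℝ) 1, ∀ u ∈ sphere (0 : Fin m → ℝ) 1,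
      Φ (Fin.cons t u) ∈ range (k ∘ g) ∧ Φ (Fin.cons t u) ∈ range (k ∘ G) := by
    intro t ht u hu
    rw [hZs t ht u hu, ← hG1]
    exact ⟨⟨f₀ (H (u, s t)), by rw [hG1]; rfl⟩, mem_range_self (f := k ∘ G) _⟩
  have hcases : ∀ x ∈ sphere (0 : Fin (m + 1) → ℝ) 1,
      (∃ u ∈ ball (0 : Fin m → ℝ) 1, x = Fin.cons 1 u) ∨
      (∃ u ∈ ball (0 : Fin m → ℝ) 1, x = Fin.cons (-1) u) ∨
      ∃ t ∈ Icc (-1 : ℝ) 1, ∃ u ∈ sphere (0 : Fin m → ℝ) 1, x = Fin.cons t u := by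
    intro x hx
    have hx0 := hx
    rw [← Fin.cons_self_tail x, cons_mem_sphere] at hx
    rcases hx with ⟨h, h'⟩ | ⟨h, h'⟩
    · rcases (mem_closedBall_zero_iff.1 h').lt_or_eq with h2 | h2
      · rcases eq_or_eq_neg_of_abs_eq h with h | h
        · exact Or.inl ⟨Fin.tail x, mem_ball_zero_iff.2 h2, by rw [← h, Fin.cons_self_tail]⟩
        · exact Or.inr (Or.inl ⟨Fin.tail x, mem_ball_zero_iff.2 h2,
            by rw [← h, Fin.cons_self_tail]⟩)
      · exact Or.inr (Or.inr ⟨x 0, abs_le.1 h.le, Fin.tail x, mem_sphere_zero_iff_norm.2 h2,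
          (Fin.cons_self_tail x).symm⟩)
    · exact Or.inr (Or.inr ⟨x 0, abs_le.1 h, Fin.tail x, h', (Fin.cons_self_tail x).symm⟩)
  -- the cell along `γ₁` is the free top, the cell along `γ₀` the free bottom of the cylinder
  have hexp0 : IsElemExpansion (k ∘ g) := by
    refine hY.isElemExpansion hZ (s := 1) abs_one hZ1 fun x hx hx' => ?_
    rcases hcases x hx with h | ⟨u, hu, rfl⟩ | ⟨t, ht, u, hu, rfl⟩
    · exact absurd h hx'
    · rw [hZ0 u (ball_subset_closedBall hu)]
      exact mem_range_self (f := k ∘ g) _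
    · exact (hside t ht u hu).1
  have hexp1 : IsElemExpansion (k ∘ G) := by
    refine hG.isElemExpansion hZ (s := -1) (by simp) hZ0 fun x hx hx' => ?_
    rcases hcases x hx with ⟨u, hu, rfl⟩ | h | ⟨t, ht, u, hu, rfl⟩
    · rw [hZ1 u (ball_subset_closedBall hu), ← hG2 u (ball_subset_closedBall hu)]
      exact mem_range_self (f := k ∘ G) _
    · exact absurd h hx'
    · exact (hside t ht u hu).2
  refine .trans _ ⟨Z, k ∘ g ∘ f₀⟩ _ (.rel _ _ ⟨h₀.dimLE hX (by omega), hZd, k ∘ g, fun _ => rfl,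
    Or.inr hexp0⟩) (.symm _ _ (.rel _ _ ⟨h₁.dimLE hX (by omega), hZd, k ∘ G, fun x => ?_,
    Or.inr hexp1⟩))
  exact congrArg k (hG1 x)

/-! ### Transporting attached cells along deformations -/

/-- Every complex obtained from `X` by attaching an `m`-cell is `d`-deformation equivalent to one
obtained from `X'` by attaching an `m`-cell. -/
def AttachTransport (d m : ℕ) (X X' : FinCW) : Prop :=
  ∀ (Y : FinCW) (γ : (Fin m → ℝ) → X) (f : X → Y) (φ : (Fin m → ℝ) → Y) (e : Y.Cell m),
    IsAttach γ f φ e → ∃ (Y' : FinCW) (γ' : (Fin m → ℝ) → X') (f' : X' → Y')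
      (φ' : (Fin m → ℝ) → Y') (e' : Y'.Cell m), IsAttach γ' f' φ' e' ∧ Deform d Y Y'

theorem IsCellEmbedding.exists_attach_comp {X X' Y : FinCW} {m : ℕ} {γ : (Fin m → ℝ) → X}
    {f : X → Y} {φ : (Fin m → ℝ) → Y} {e : Y.Cell m} {g : X → X'} (hg : IsCellEmbedding g)
    (h : IsAttach γ f φ e) : ∃ (Y' : FinCW) (f' : X' → Y') (φ' : (Fin m → ℝ) → Y')
      (e' : Y'.Cell m), IsAttach (g ∘ γ) f' φ' e' :=
  exists_attach X' (g ∘ γ) (hg.continuous.comp_continuousOn h.continuousOn_attaching)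
    (fun _ hu => hg.mem_skelLT_iff.2 (h.attaching_mem hu))

theorem IsCellIso.attachTransport {d m : ℕ} (hm : m ≤ d) {X X' : FinCW} (hX : X.DimLE d)
    {g : X → X'} (hg : IsCellIso g) : AttachTransport d m X X' := by
  intro Y γ f φ e h
  obtain ⟨Y', f', φ', e', h'⟩ := hg.1.exists_attach_comp h
  obtain ⟨G, hG, -⟩ := h.exists_map_iso h' hg (fun _ _ => rfl)
  exact ⟨Y', _, f', φ', e', h', .rel _ _ ⟨h.dimLE hX hm, hG.exists_inverse.choose_spec.1.1.dimLE
    (h.dimLE hX hm), G, Or.inl hG⟩⟩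

theorem IsElemExpansion.attachTransport {d m : ℕ} (hm : m ≤ d) {X X' : FinCW} (hX : X'.DimLE d)
    {g : X → X'} (hg : IsElemExpansion g) : AttachTransport d m X X' := by
  intro Y γ f φ e h
  obtain ⟨Y', f', φ', e', h'⟩ := hg.1.exists_attach_comp h
  obtain ⟨G, hG, -⟩ := h.exists_map_expansion h' hg (fun _ _ => rfl)
  exact ⟨Y', _, f', φ', e', h', .rel _ _ ⟨h.dimLE (hg.1.dimLE hX) hm, h'.dimLE hX hm, G,
    Or.inr hG⟩⟩

/-- To transport a cell along an elementary collapse, first push its attaching map into the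
subcomplex by the deformation retraction. -/
theorem IsElemExpansion.attachTransport_symm {d m : ℕ} (hm : m + 1 ≤ d) {X X' : FinCW}
    (hX : X'.DimLE d) {g : X → X'} (hg : IsElemExpansion g) : AttachTransport d m X' X := by
  intro Y' γ' f' φ' e' h'
  obtain ⟨H, hH, hH0, hHf, hH1, hHs⟩ := hg.exists_deformation
  choose r hr using hH1
  have hrc : ContinuousOn (r ∘ γ') (sphere 0 1) := by
    rw [hg.1.isClosedEmbedding.isInducing.continuousOn_iff]
    refine ((hH.comp (Continuous.prodMk_left 1)).comp_continuousOn
      h'.continuousOn_attaching).congr fun u _ => hr _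
  obtain ⟨Y, f, φ, e, h⟩ := exists_attach X (r ∘ γ') hrc fun u hu => by
    rw [← hg.1.mem_skelLT_iff]
    have h1 := (hHs m _ (h'.attaching_mem hu)).2
    rwa [← hr] at h1
  -- `Y''` has the cell attached to the larger complex along the pushed map
  obtain ⟨Y'', f'', φ'', e'', h''⟩ := hg.1.exists_attach_comp h
  obtain ⟨G, hG, -⟩ := h.exists_map_expansion h'' hg (fun _ _ => rfl)
  refine ⟨Y, _, f, φ, e, h, .trans _ _ _ (RelDeform.forget (A := ⟨Y', f'⟩) (B := ⟨Y'', f''⟩)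
    (h'.relDeform_of_homotopy hm hX h'' (H := fun p => H (γ' p.1, p.2)) ?_ ?_ ?_ ?_))
    (.symm _ _ (.rel _ _ ⟨h.dimLE (hg.1.dimLE hX) (by omega), h''.dimLE hX (by omega), G,
      Or.inr hG⟩))⟩
  · exact hH.comp_continuousOn ((h'.continuousOn_attaching.comp continuousOn_fst
      fun p hp => hp.1).prodMk continuousOn_snd)
  · exact fun u hu t => (hHs m _ (h'.attaching_mem hu)).1 t
  · exact fun u _ => hH0 _
  · exact fun u _ => (hr _).symm

theorem Deform.attachTransport {d m : ℕ} (hm : m + 1 ≤ d) {X X' : FinCW} (h : Deform d X X') :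
    X.DimLE d → X'.DimLE d ∧ AttachTransport d m X X' := by
  suffices (X.DimLE d ↔ X'.DimLE d) ∧
      (X.DimLE d → AttachTransport d m X X' ∧ AttachTransport d m X' X) from
    fun hX => ⟨this.1.1 hX, (this.2 hX).1⟩
  induction h with
  | rel X X' h =>
    obtain ⟨h1, h2, g, h | h⟩ := h
    · obtain ⟨g', hg', -⟩ := h.exists_inverse
      exact ⟨iff_of_true h1 h2, fun _ => ⟨h.attachTransport (by omega) h1,
        hg'.attachTransport (by omega) h2⟩⟩
    · exact ⟨iff_of_true h1 h2, fun _ => ⟨h.attachTransport (by omega) h2,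
        h.attachTransport_symm hm h2⟩⟩
  | refl X =>
    have h : X.DimLE d → AttachTransport d m X X := fun _ Y γ f φ e h =>
      ⟨Y, γ, f, φ, e, h, .refl _⟩
    exact ⟨Iff.rfl, fun hX => ⟨h hX, h hX⟩⟩
  | symm _ _ _ ih => exact ⟨ih.1.symm, fun hX => (ih.2 (ih.1.2 hX)).symm⟩
  | trans X X' X'' _ _ ih ih' =>
    refine ⟨ih.1.trans ih'.1, fun hX => ⟨?_, ?_⟩⟩
    · intro Y γ f φ e h
      obtain ⟨Y', γ', f', φ', e', h', hd⟩ := (ih.2 hX).1 Y γ f φ e h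
      obtain ⟨Y'', γ'', f'', φ'', e'', h'', hd'⟩ := (ih'.2 (ih.1.1 hX)).1 Y' γ' f' φ' e' h'
      exact ⟨Y'', γ'', f'', φ'', e'', h'', .trans _ _ _ hd hd'⟩
    · intro Y γ f φ e h
      obtain ⟨Y', γ', f', φ', e', h', hd⟩ := (ih'.2 (ih.1.1 hX)).2 Y γ f φ e h
      obtain ⟨Y'', γ'', f'', φ'', e'', h'', hd'⟩ := (ih.2 hX).2 Y' γ' f' φ' e' h'
      exact ⟨Y'', γ'', f'', φ'', e'', h'', .trans _ _ _ hd hd'⟩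

end FinCW

namespace FinCW

/-! ### Reduction to complexes with one vertex -/

/-- There is exactly one `0`-cell. -/
def OneVertex (X : FinCW) : Prop := ∃ v : X.Cell 0, ∀ w, w = v

theorem IsAttach.oneVertex {X Y : FinCW} {m : ℕ} {γ : (Fin m → ℝ) → X} {f : X → Y}
    {φ : (Fin m → ℝ) → Y} {e : Y.Cell m} (h : IsAttach γ f φ e) (hX : X.OneVertex)
    (hm : 1 ≤ m) : Y.OneVertex := by
  obtain ⟨v, hv⟩ := hX
  obtain ⟨v', hv'⟩ := h.emb.cell 0 v
  refine ⟨v', fun w => ?_⟩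
  rcases h.cell_cases w with ⟨i, hi⟩ | hw
  · rw [hv i, hv'] at hi
    exact (Y.openCell_injective hi).symm
  · cases hw
    omega

theorem exists_vertex (X : FinCW) [Nonempty X] : Nonempty (X.Cell 0) := by
  classical
  have h : ∃ m, Nonempty (X.Cell m) := by
    obtain ⟨m, i, -⟩ := X.exists_mem_openCell (Classical.arbitrary X)
    exact ⟨m, ⟨i⟩⟩
  obtain ⟨i⟩ := Nat.find_spec h
  rcases Nat.eq_zero_or_pos (Nat.find h) with h0 | h0
  · rw [h0] at i
    exact ⟨i⟩
  · exfalso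
    have : Nonempty (Fin (Nat.find h)) := ⟨⟨0, h0⟩⟩
    obtain ⟨u, hu⟩ := NormedSpace.sphere_nonempty (E := Fin (Nat.find h) → ℝ) (x := 0) (r := 1)
      |>.2 zero_le_one
    obtain ⟨k, hk, j, -⟩ := X.cmap_mem_skelLT i hu
    exact Nat.find_min h hk ⟨j⟩

theorem openCell_zero_eq {X : FinCW} (v : X.Cell 0) {x : X} (hx : x ∈ X.openCell v) :
    X.openCell v = {x} := by
  obtain ⟨u, -, rfl⟩ := hx
  refine Subset.antisymm ?_ (singleton_subset_iff.2 ⟨u, ?_, rfl⟩)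
  · rintro _ ⟨w, -, rfl⟩
    rw [Subsingleton.elim w u]
    rfl
  · rw [Subsingleton.elim u 0]
    exact mem_ball_self one_pos

theorem isSub_vertex (X : FinCW) (v : X.Cell 0) : X.IsSub (X.openCell v) := by
  refine ⟨?_, fun m i => ?_⟩
  · obtain ⟨x, hx⟩ := X.openCell_nonempty v
    rw [openCell_zero_eq v hx]
    exact isClosed_singleton
  · by_cases h : Disjoint (X.openCell i) (X.openCell v)
    · exact Or.inr h
    · obtain ⟨x, hx, hx'⟩ := Set.not_disjoint_iff.1 h
      cases cell_unique hx hx'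
      exact Or.inl Subset.rfl

theorem IsSub.union_openCell {X : FinCW} {S : Set X} (hS : X.IsSub S) {m : ℕ} {e : X.Cell m}
    (he : ∀ u ∈ sphere (0 : Fin m → ℝ) 1, X.cmap e u ∈ S) : X.IsSub (S ∪ X.openCell e) := by
  refine ⟨?_, fun k i => ?_⟩
  · have : S ∪ X.openCell e = S ∪ closure (X.openCell e) := by
      refine Subset.antisymm (union_subset_union_right _ subset_closure) ?_
      rw [closure_openCell]
      rintro x (hx | ⟨u, hu, rfl⟩)
      · exact Or.inl hx
      · rcases (mem_closedBall_zero_iff.1 hu).lt_or_eq with h | h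
        · exact Or.inr (X.cmap_mem_openCell e (mem_ball_zero_iff.2 h))
        · exact Or.inl (he u (mem_sphere_zero_iff_norm.2 h))
    rw [this]
    exact hS.isClosed.union isClosed_closure
  · by_cases h : Disjoint (X.openCell i) (X.openCell e)
    · rcases hS.cell k i with h' | h'
      · exact Or.inl (h'.trans subset_union_left)
      · exact Or.inr (disjoint_union_right.2 ⟨h', h⟩)
    · obtain ⟨x, hx, hx'⟩ := Set.not_disjoint_iff.1 h
      cases cell_unique hx hx'
      exact Or.inl subset_union_right

theorem finite_isSub (X : FinCW) : {S : Set X | X.IsSub S}.Finite := by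
  refine Set.Finite.of_finite_image (f := fun S => {p : Σ m, X.Cell m | X.openCell p.2 ⊆ S})
    (Set.toFinite _) ?_
  have key : ∀ S T : Set X, X.IsSub S →
      {p : Σ m, X.Cell m | X.openCell p.2 ⊆ S} = {p : Σ m, X.Cell m | X.openCell p.2 ⊆ T} →
      S ⊆ T := by
    intro S T hS h x hx
    obtain ⟨m, i, hi⟩ := X.exists_mem_openCell x
    have h1 : (⟨m, i⟩ : Σ m, X.Cell m) ∈ {p : Σ m, X.Cell m | X.openCell p.2 ⊆ S} :=
      hS.subset_of_mem hi hx
    rw [h] at h1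
    exact h1 hi
  intro S hS T hT h
  exact Subset.antisymm (key S T hS h) (key T S hT h.symm)

/-- The larger of two nested subcomplexes which differ by one cell is obtained from the smaller one
by attaching that cell. -/
theorem IsSub.exists_isAttach {X : FinCW} {S : Set X} (hS : X.IsSub S) (hne : S.Nonempty) {m : ℕ}
    {e : X.Cell m} (heS : ¬ X.openCell e ⊆ S) (hT : X.IsSub (S ∪ X.openCell e)) :
    ∃ (γ : (Fin m → ℝ) → X.sub S hS) (f : X.sub S hS → X.sub _ hT)
      (φ : (Fin m → ℝ) → X.sub _ hT) (e' : (X.sub _ hT).Cell m), IsAttach γ f φ e' := by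
  obtain ⟨f, hf, hf'⟩ := (X.isCellEmbedding_incl S hS).exists_factor hT
    (by rw [range_incl]; exact subset_union_left)
  have hinj := (X.isCellEmbedding_incl _ hT).injective
  have : Nonempty (X.sub S hS) := hne.to_subtype
  let e' : (X.sub _ hT).Cell m :=
    (⟨e, subset_union_right⟩ : {i : X.Cell m // X.openCell i ⊆ S ∪ X.openCell e})
  have he' : X.incl _ hT '' (X.sub _ hT).openCell e' = X.openCell e :=
    X.incl_image_openCell _ hT ⟨e, subset_union_right⟩
  have hr : X.incl _ hT '' range f = S := by
    rw [← range_comp]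
    exact (congrArg range (funext hf')).trans (X.range_incl S hS)
  refine ⟨_, f, _, e', hf.isAttach (e := e') ?_ ?_⟩
  · rw [← disjoint_image_iff hinj, he', hr]
    exact (hS.cell m e).resolve_left heS
  · apply hinj.image_injective
    rw [image_union, he', hr, image_univ, range_incl]

theorem notMem_sphere_fin_zero (u : Fin 0 → ℝ) : u ∉ sphere (0 : Fin 0 → ℝ) 1 := by
  rw [mem_sphere_zero_iff_norm, Subsingleton.elim u 0, norm_zero]
  exact zero_ne_one

theorem eq_const_fin_one (u : Fin 1 → ℝ) : u = fun _ => u 0 :=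
  funext fun i => by rw [Subsingleton.elim i 0]

theorem mem_sphere_fin_one {u : Fin 1 → ℝ} (hu : u ∈ sphere (0 : Fin 1 → ℝ) 1) :
    u = (fun _ => 1) ∨ u = fun _ => -1 := by
  rw [mem_sphere_zero_iff_norm, Pi.norm_def] at hu
  have h : |u 0| = 1 := by simpa using hu
  rcases eq_or_eq_neg_of_abs_eq h with h | h
  · exact Or.inl (by rw [eq_const_fin_one u, h])
  · exact Or.inr (by rw [eq_const_fin_one u, h])

theorem const_mem_sphere_fin_one {s : ℝ} (hs : |s| = 1) :
    (fun _ => s) ∈ sphere (0 : Fin 1 → ℝ) 1 := by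
  rw [mem_sphere_zero_iff_norm, Pi.norm_def]
  simpa using hs

/-- A subcomplex together with an edge which leaves it and the far end of that edge is an
elementary expansion of the subcomplex. -/
theorem IsSub.exists_isElemExpansion {X : FinCW} {S : Set X} (hS : X.IsSub S)
    {e : X.Cell 1} {w : X.Cell 0} {s : ℝ} (hs : |s| = 1) (h1 : X.cmap e (fun _ => -s) ∈ S)
    (h2 : X.cmap e (fun _ => s) ∈ X.openCell w) (h3 : ¬ X.openCell w ⊆ S)
    (hT : X.IsSub (S ∪ X.openCell w ∪ X.openCell e)) :
    ∃ f : X.sub S hS → X.sub _ hT, IsElemExpansion f := by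
  obtain ⟨f, hf, hf'⟩ := (X.isCellEmbedding_incl S hS).exists_factor hT
    (by rw [range_incl]; exact subset_union_left.trans subset_union_left)
  have hinj := (X.isCellEmbedding_incl _ hT).injective
  let w' : (X.sub _ hT).Cell 0 := (⟨w, subset_union_right.trans subset_union_left⟩ :
    {i : X.Cell 0 // X.openCell i ⊆ S ∪ X.openCell w ∪ X.openCell e})
  let e' : (X.sub _ hT).Cell 1 := (⟨e, subset_union_right⟩ :
    {i : X.Cell 1 // X.openCell i ⊆ S ∪ X.openCell w ∪ X.openCell e})
  have hw' : X.incl _ hT '' (X.sub _ hT).openCell w' = X.openCell w :=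
    X.incl_image_openCell _ hT ⟨w, _⟩
  have he' : X.incl _ hT '' (X.sub _ hT).openCell e' = X.openCell e :=
    X.incl_image_openCell _ hT ⟨e, _⟩
  have hr : X.incl _ hT '' range f = S := by
    rw [← range_comp]
    exact (congrArg range (funext hf')).trans (X.range_incl S hS)
  have hwS : Disjoint (X.openCell w) S := (hS.cell 0 w).resolve_left h3
  have heS : Disjoint (X.openCell e) S := by
    refine (hS.cell 1 e).resolve_left fun h => ?_
    exact Set.disjoint_left.1 hwS h2
      (hS.cmap_mem h (sphere_subset_closedBall (const_mem_sphere_fin_one hs)))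
  -- the characteristic map of the edge, reversed if necessary so that `1` is the far end
  let φ : (Fin 1 → ℝ) → X.sub _ hT := fun u => subMap
    (⟨e, subset_union_right⟩ : {i : X.Cell 1 // X.openCell i ⊆ S ∪ X.openCell w ∪ X.openCell e})
    (s • u)
  have hnorm : ∀ u : Fin 1 → ℝ, ‖s • u‖ = ‖u‖ := fun u => by
    rw [norm_smul, Real.norm_eq_abs, hs, one_mul]
  have hs0 : s * s = 1 := by
    rw [← abs_mul_abs_self s, hs, one_mul]
  have hφ : ∀ u ∈ closedBall (0 : Fin 1 → ℝ) 1, X.incl _ hT (φ u) = X.cmap e (s • u) := by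
    intro u hu
    refine subMap_coe hT _ ?_
    rw [mem_closedBall_zero_iff] at hu ⊢
    rwa [hnorm]
  have hmul : (fun u : Fin 1 → ℝ => s • u) '' ball 0 1 = ball 0 1 := by
    ext u
    constructor
    · rintro ⟨v, hv, rfl⟩
      rw [mem_ball_zero_iff] at hv ⊢
      rwa [hnorm]
    · intro hu
      refine ⟨s • u, ?_, by simp only [smul_smul, hs0, one_smul]⟩
      rw [mem_ball_zero_iff] at hu ⊢
      rwa [hnorm]
  have hsm : ∀ u ∈ ball (0 : Fin 1 → ℝ) 1, s • u ∈ ball (0 : Fin 1 → ℝ) 1 := fun u hu =>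
    hmul ▸ mem_image_of_mem (fun u : Fin 1 → ℝ => s • u) hu
  have hone : ∀ y : Fin 0 → ℝ, X.incl _ hT (φ (Fin.cons 1 y)) = X.cmap e (fun _ => s) := by
    intro y
    have h4 : (Fin.cons 1 y : Fin 1 → ℝ) = fun _ => 1 := by
      rw [eq_const_fin_one (Fin.cons 1 y)]
      rfl
    rw [h4, hφ _ (sphere_subset_closedBall (const_mem_sphere_fin_one abs_one))]
    congr 1
    ext i
    simp
  refine ⟨f, hf, 0, w', e', φ, ?_, ?_, ?_, ?_, ?_, ?_, ?_, ?_, ?_⟩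
  · rw [← disjoint_image_iff hinj, hw', hr]
    exact hwS
  · rw [← disjoint_image_iff hinj, he', hr]
    exact heS
  · apply hinj.image_injective
    rw [image_union, image_union, he', hw', hr, image_univ, range_incl]
  · rw [(X.isCellEmbedding_incl _ hT).isClosedEmbedding.isInducing.continuousOn_iff]
    refine ((X.continuousOn_cmap e).comp (continuous_const_smul s).continuousOn
      fun u hu => ?_).congr hφ
    rw [mem_closedBall_zero_iff] at hu ⊢
    rwa [hnorm]
  · intro u hu v hv huv
    have h := congrArg (X.incl _ hT) huv
    rw [hφ u (ball_subset_closedBall hu), hφ v (ball_subset_closedBall hv)] at h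
    have h' := congrArg (s • ·) (X.injOn_cmap e (hsm u hu) (hsm v hv) h)
    simpa only [smul_smul, hs0, one_smul] using h'
  · apply hinj.image_injective
    rw [he', image_image, image_congr fun u hu => hφ u (ball_subset_closedBall hu)]
    exact (image_image (X.cmap e) (fun u => s • u) _).symm.trans (congrArg _ hmul)
  · exact fun u _ v _ _ => Subsingleton.elim u v
  · apply hinj.image_injective
    rw [hw', image_image, image_congr fun u _ => hone u, openCell_zero_eq w h2]
    exact Nonempty.image_const ⟨0, mem_ball_self one_pos⟩ _
  · intro u hu hu'
    have h5 : u = fun _ => -1 := by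
      refine (mem_sphere_fin_one hu).resolve_left fun h => hu' ⟨0, mem_ball_self one_pos, ?_⟩
      rw [h, eq_const_fin_one (Fin.cons 1 0)]
      rfl
    have h6 : X.incl _ hT (φ u) ∈ X.incl _ hT '' range f := by
      rw [hφ u (sphere_subset_closedBall hu), hr, h5]
      convert h1 using 2
      ext i
      simp
    obtain ⟨y, hy, hy'⟩ := h6
    rwa [← hinj hy']

/-- A connected `2`-complex is `3`-deformation equivalent to one with a single vertex. Consider a
maximal subcomplex for which this holds; were it proper, one could add an edge leaving it together
with its far end, or a further cell of positive dimension. -/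
theorem exists_oneVertex (X : FinCW) (hX : X.DimLE 2) [ConnectedSpace X] :
    ∃ Y : FinCW, Y.OneVertex ∧ Y.DimLE 2 ∧ Deform 3 X Y := by
  let Q : Set (Set X) := {S | S.Nonempty ∧ ∃ hS : X.IsSub S, ∃ Y : FinCW, Y.OneVertex ∧
    Y.DimLE 2 ∧ Deform 3 (X.sub S hS) Y}
  have hQfin : Q.Finite := X.finite_isSub.subset fun S hS => hS.2.1
  have hsubdim : ∀ S hS, (X.sub S hS).DimLE 2 := fun S hS =>
    (X.isCellEmbedding_incl S hS).dimLE hX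
  have hQne : Q.Nonempty := by
    obtain ⟨v⟩ := X.exists_vertex
    refine ⟨X.openCell v, X.openCell_nonempty v, X.isSub_vertex v, _, ?_, hsubdim _ _, .refl _⟩
    refine ⟨(⟨v, Subset.rfl⟩ : {i : X.Cell 0 // X.openCell i ⊆ X.openCell v}), ?_⟩
    rintro ⟨w, hw⟩
    obtain ⟨x, hx⟩ := X.openCell_nonempty w
    cases cell_unique hx (hw hx)
    rfl
  obtain ⟨S, hSmax⟩ := hQfin.exists_maximal hQne
  obtain ⟨hne, hS, Y, hY1, hY2, hd⟩ := hSmax.prop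
  -- a cell of positive dimension whose boundary lies in `S` lies in `S`
  have hcell : ∀ m (e : X.Cell m), 1 ≤ m → (∀ u ∈ sphere (0 : Fin m → ℝ) 1, X.cmap e u ∈ S) →
      X.openCell e ⊆ S := by
    intro m e hm he
    by_contra heS
    have hm2 : m ≤ 2 := by
      by_contra h
      exact (hX m (by omega)).false e
    have hT := hS.union_openCell he
    obtain ⟨γ, f, φ, e', h⟩ := hS.exists_isAttach hne heS hT
    obtain ⟨-, htr⟩ := hd.attachTransport (m := m) (by omega) ((hsubdim S hS).mono (by omega))
    obtain ⟨Y', γ', f', φ', e'', h', hd'⟩ := htr _ _ _ _ _ h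
    have hmem : S ∪ X.openCell e ∈ Q :=
      ⟨hne.mono subset_union_left, hT, Y', h'.oneVertex hY1 hm, h'.dimLE hY2 hm2, hd'⟩
    exact heS (subset_union_right.trans (hSmax.le_of_ge hmem subset_union_left))
  -- an edge with one end in `S` has both ends in `S`
  have hedge : ∀ (e : X.Cell 1) (s : ℝ), |s| = 1 → X.cmap e (fun _ => -s) ∈ S →
      X.cmap e (fun _ => s) ∈ S := by
    intro e s hs h1
    by_contra h2
    obtain ⟨k, hk, w, hw⟩ := X.cmap_mem_skelLT e (const_mem_sphere_fin_one hs)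
    obtain rfl : k = 0 := by omega
    have hwS : ¬ X.openCell w ⊆ S := fun h => h2 (h hw)
    have hT1 : X.IsSub (S ∪ X.openCell w) := hS.union_openCell fun u hu => by
      exact absurd hu (notMem_sphere_fin_zero u)
    have hT : X.IsSub (S ∪ X.openCell w ∪ X.openCell e) := hT1.union_openCell fun u hu => by
      rcases mem_sphere_fin_one hu with rfl | rfl <;>
      rcases eq_or_eq_neg_of_abs_eq hs with rfl | rfl
      · exact Or.inr hw
      · exact Or.inl (by simpa using h1)
      · exact Or.inl h1
      · exact Or.inr hw
    obtain ⟨f, hf⟩ := hS.exists_isElemExpansion hs h1 hw hwS hT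
    have hmem : S ∪ X.openCell w ∪ X.openCell e ∈ Q :=
      ⟨hne.mono (subset_union_left.trans subset_union_left), hT, Y, hY1, hY2,
        .trans _ _ _ (.symm _ _ (.rel _ _ ⟨(hsubdim _ _).mono (by omega),
          (hsubdim _ _).mono (by omega), f, Or.inr hf⟩)) hd⟩
    exact hwS ((subset_union_right.trans subset_union_left).trans
      (hSmax.le_of_ge hmem (subset_union_left.trans subset_union_left)))
  -- hence the closure of a cell outside of `S` is disjoint from `S`
  have hout : ∀ m (e : X.Cell m), ¬ X.openCell e ⊆ S → Disjoint (closure (X.openCell e)) S := by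
    intro m
    induction m using Nat.strong_induction_on with
    | _ m ih =>
      intro e he
      have hd1 : Disjoint (X.openCell e) S := (hS.cell m e).resolve_left he
      suffices h : ∀ u ∈ sphere (0 : Fin m → ℝ) 1, X.cmap e u ∉ S by
        rw [closure_openCell, Set.disjoint_left]
        rintro _ ⟨u, hu, rfl⟩
        rcases (mem_closedBall_zero_iff.1 hu).lt_or_eq with h' | h'
        · exact Set.disjoint_left.1 hd1 (X.cmap_mem_openCell e (mem_ball_zero_iff.2 h'))
        · exact h u (mem_sphere_zero_iff_norm.2 h')
      rcases Nat.lt_trichotomy m 1 with hm | rfl | hm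
      · obtain rfl : m = 0 := by omega
        intro u hu
        exact absurd hu (notMem_sphere_fin_zero u)
      · intro u hu huS
        refine he (hcell 1 e le_rfl fun v hv => ?_)
        rcases mem_sphere_fin_one hu with rfl | rfl <;>
        rcases mem_sphere_fin_one hv with rfl | rfl
        · exact huS
        · exact hedge e (-1) (by simp) (by simpa using huS)
        · exact hedge e 1 abs_one huS
        · exact huS
      -- the boundary is connected and covered by `S` and the closed cells outside of `S`
      · let C : Set X := ⋃ p : {p : Σ k, X.Cell k // p.1 < m ∧ ¬ X.openCell p.2 ⊆ S},
          closure (X.openCell p.1.2)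
        have hC : IsClosed C := isClosed_iUnion_of_finite fun _ => isClosed_closure
        have hCS : Disjoint C S :=
          disjoint_iUnion_left.2 fun p => ih p.1.1 p.2.1 p.1.2 p.2.2
        have hcov : X.cmap e '' sphere 0 1 ⊆ S ∪ C := by
          rintro _ ⟨u, hu, rfl⟩
          obtain ⟨k, hk, j, hj⟩ := X.cmap_mem_skelLT e hu
          by_cases hjS : X.openCell j ⊆ S
          · exact Or.inl (hjS hj)
          · exact Or.inr (mem_iUnion.2 ⟨⟨⟨k, j⟩, hk, hjS⟩, subset_closure hj⟩)
        have hconn : IsPreconnected (X.cmap e '' sphere 0 1) := by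
          refine (isPreconnected_sphere ?_ _ _).image _
            ((X.continuousOn_cmap e).mono sphere_subset_closedBall)
          rw [rank_fin_fun]
          exact_mod_cast hm
        intro u hu huS
        refine he (hcell m e hm.le fun v hv => ?_)
        by_contra hvS
        obtain ⟨x, -, hx1, hx2⟩ := isPreconnected_closed_iff.1 hconn S C hS.isClosed hC hcov
          ⟨_, mem_image_of_mem _ hu, huS⟩
          ⟨_, mem_image_of_mem _ hv, (hcov (mem_image_of_mem _ hv)).resolve_left hvS⟩
        exact Set.disjoint_left.1 hCS hx2 hx1
  have hSu : S = univ := by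
    refine IsClopen.eq_univ ⟨hS.isClosed, ?_⟩ hne
    have : Sᶜ = ⋃ p : {p : Σ k, X.Cell k // ¬ X.openCell p.2 ⊆ S},
        closure (X.openCell p.1.2) := by
      ext x
      rw [mem_iUnion]
      constructor
      · intro hx
        obtain ⟨k, j, hj⟩ := X.exists_mem_openCell x
        exact ⟨⟨⟨k, j⟩, fun h => hx (h hj)⟩, subset_closure hj⟩
      · rintro ⟨p, hp⟩
        exact Set.disjoint_left.1 (hout _ _ p.2) hp
    rw [← isClosed_compl_iff, this]
    exact isClosed_iUnion_of_finite fun _ => isClosed_closure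
  refine ⟨Y, hY1, hY2, .trans _ _ _ (.symm _ _ (.rel _ _ ⟨(hsubdim S hS).mono (by omega),
    hX.mono (by omega), X.incl S hS, Or.inl ⟨X.isCellEmbedding_incl S hS, ?_⟩⟩)) hd⟩
  intro x
  have : x ∈ range (X.incl S hS) := by
    rw [range_incl, hSu]
    trivial
  exact this

end FinCW

/-! ### Generation of the fundamental groupoid by cells of one dimension -/

section Generation

open CategoryTheory unitInterval

/-- The class of a path, as a morphism of the fundamental groupoid. -/
abbrev Path.cls {X : Type*} [TopologicalSpace X] {a b : X} (p : Path a b) :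
    FundamentalGroupoid.mk a ⟶ FundamentalGroupoid.mk b :=
  FundamentalGroupoid.fromPath (Path.Homotopic.Quotient.mk p)

theorem Path.cls_trans {X : Type*} [TopologicalSpace X] {a b c : X} (p : Path a b)
    (q : Path b c) : (p.trans q).cls = p.cls ≫ q.cls := rfl

theorem Path.cls_symm {X : Type*} [TopologicalSpace X] {a b : X} (p : Path a b) :
    p.symm.cls = CategoryTheory.inv p.cls := by
  rw [← Groupoid.inv_eq_inv]
  rfl

theorem Path.cls_refl {X : Type*} [TopologicalSpace X] (a : X) :
    (Path.refl a).cls = 𝟙 (FundamentalGroupoid.mk a) := rfl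

theorem Path.cls_eq_iff {X : Type*} [TopologicalSpace X] {a b : X} {p q : Path a b} :
    p.cls = q.cls ↔ p.Homotopic q :=
  FundamentalGroupoid.fromPath_eq_iff_homotopic p q

/-- The images of two paths with the same ends in a convex set are homotopic. -/
theorem Path.homotopic_of_convex {E X : Type*} [NormedAddCommGroup E] [NormedSpace ℝ E]
    [TopologicalSpace X] {K : Set E} (hK : Convex ℝ K) {φ : E → X} (hφ : ContinuousOn φ K)
    {u w : E} {δ δ' : Path u w} (hδ : ∀ t, δ t ∈ K) (hδ' : ∀ t, δ' t ∈ K) {a b : X}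
    {p p' : Path a b} (hp : ∀ t, p t = φ (δ t)) (hp' : ∀ t, p' t = φ (δ' t)) :
    p.Homotopic p' := by
  have hmem : ∀ x : I × I, (1 - (x.1 : ℝ)) • δ x.2 + (x.1 : ℝ) • δ' x.2 ∈ K := fun x =>
    hK (hδ _) (hδ' _) (sub_nonneg.2 x.1.2.2) x.1.2.1 (by ring)
  refine ⟨⟨⟨⟨fun x => φ ((1 - (x.1 : ℝ)) • δ x.2 + (x.1 : ℝ) • δ' x.2), ?_⟩, ?_, ?_⟩, ?_⟩⟩
  · exact hφ.comp_continuous (by fun_prop) hmem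
  · intro t
    simp [hp]
  · intro t
    simp [hp']
  · rintro t x (rfl | rfl)
    · simp only [Path.source, ContinuousMap.coe_mk, ← add_smul, sub_add_cancel, one_smul,
        Path.coe_toContinuousMap]
      rw [← p.source, hp 0, δ.source]
    · simp only [Path.target, ContinuousMap.coe_mk, ← add_smul, sub_add_cancel, one_smul,
        Path.coe_toContinuousMap]
      rw [← p.target, hp 1, δ.target]

/-- Radial inflation of the unit ball, stretching by the factor `1 + t` and then pushing the
overshooting points back to the sphere. -/
noncomputable def inflate {E : Type*} [NormedAddCommGroup E] [NormedSpace ℝ E] (t : ℝ) (u : E) :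
    E :=
  (max 1 ‖(1 + t) • u‖)⁻¹ • (1 + t) • u

section

variable {E : Type*} [NormedAddCommGroup E] [NormedSpace ℝ E]

theorem continuous_inflate : Continuous fun p : ℝ × E => inflate p.1 p.2 := by
  refine Continuous.smul (Continuous.inv₀ (by fun_prop) fun p => ?_) (by fun_prop)
  exact (zero_lt_one.trans_le (le_max_left _ _)).ne'

theorem norm_inflate (t : ℝ) (u : E) :
    ‖inflate t u‖ = (max 1 ‖(1 + t) • u‖)⁻¹ * ‖(1 + t) • u‖ := by
  rw [inflate, norm_smul, norm_inv, Real.norm_of_nonneg (zero_le_one.trans (le_max_left _ _))]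

theorem inflate_mem (t : ℝ) (u : E) : inflate t u ∈ closedBall (0 : E) 1 := by
  rw [mem_closedBall_zero_iff, norm_inflate, inv_mul_le_one₀ (by positivity)]
  exact le_max_right _ _

theorem inflate_zero {u : E} (hu : u ∈ closedBall (0 : E) 1) : inflate 0 u = u := by
  rw [mem_closedBall_zero_iff] at hu
  simp [inflate, hu]

theorem inflate_sphere {t : ℝ} (ht : 0 ≤ t) {u : E} (hu : u ∈ sphere (0 : E) 1) :
    inflate t u = u := by
  rw [mem_sphere_zero_iff_norm] at hu
  have h : ‖(1 + t) • u‖ = 1 + t := by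
    rw [norm_smul, hu, mul_one, Real.norm_of_nonneg (by positivity)]
  rw [inflate, h, max_eq_right (by linarith), smul_smul, inv_mul_cancel₀ (by positivity), one_smul]

theorem inflate_one_mem_sphere {u : E} (hu : 1 / 2 < ‖u‖) : inflate 1 u ∈ sphere (0 : E) 1 := by
  have h : 1 < ‖((1 : ℝ) + 1) • u‖ := by
    rw [norm_smul, Real.norm_of_nonneg (by norm_num)]
    linarith
  rw [mem_sphere_zero_iff_norm, norm_inflate, max_eq_right h.le, inv_mul_cancel₀ (by positivity)]

end

/-- `X` is obtained from its closed subset `A` by attaching finitely many cells, with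
characteristic maps `φ j` on the closed unit ball of `E`. -/
structure IsCellAttachment {X J E : Type*} [TopologicalSpace X] [NormedAddCommGroup E]
    (A : Set X) (φ : J → E → X) : Prop where
  isClosed : IsClosed A
  continuousOn : ∀ j, ContinuousOn (φ j) (closedBall 0 1)
  sphere : ∀ j, ∀ u ∈ sphere (0 : E) 1, φ j u ∈ A
  ball : ∀ j, ∀ u ∈ ball (0 : E) 1, φ j u ∉ A
  inj : ∀ j j', ∀ u ∈ Metric.ball (0 : E) 1, ∀ u' ∈ Metric.ball (0 : E) 1,
    φ j u = φ j' u' → j = j' ∧ u = u'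
  cover : ∀ x, x ∈ A ∨ ∃ j, ∃ u ∈ Metric.ball (0 : E) 1, φ j u = x

namespace IsCellAttachment

variable {X J E : Type*} [TopologicalSpace X] [NormedAddCommGroup E] {A : Set X} {φ : J → E → X}

theorem mem_ball_of_notMem (h : IsCellAttachment A φ) {j : J} {u : E}
    (hu : u ∈ closedBall (0 : E) 1) (hA : φ j u ∉ A) : u ∈ Metric.ball (0 : E) 1 := by
  rcases (mem_closedBall_zero_iff.1 hu).lt_or_eq with h' | h'
  · exact mem_ball_zero_iff.2 h'
  · exact absurd (h.sphere j u (mem_sphere_zero_iff_norm.2 h')) hA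

/-- The inflations of the cells assemble to a homotopy of the whole space, fixed on `A`. -/
theorem exists_inflation [T2Space X] [CompactSpace X] [Finite J] [NormedSpace ℝ E]
    [FiniteDimensional ℝ E] (h : IsCellAttachment A φ) :
    ∃ G : I × X → X, Continuous G ∧ (∀ t, ∀ x ∈ A, G (t, x) = x) ∧
      ∀ t j, ∀ u ∈ closedBall (0 : E) 1, G (t, φ j u) = φ j (inflate (t : ℝ) u) := by
  classical
  have hc : ∀ x, x ∉ A → ∃ p : J × E, p.2 ∈ Metric.ball (0 : E) 1 ∧ φ p.1 p.2 = x := fun x hx => by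
    obtain ⟨j, u, hu, rfl⟩ := (h.cover x).resolve_left hx
    exact ⟨(j, u), hu, rfl⟩
  choose c hcb hcx using hc
  let G : I × X → X := fun p => if hp : p.2 ∈ A then p.2 else
    φ (c p.2 hp).1 (inflate p.1 (c p.2 hp).2)
  have h1 : ∀ t, ∀ x ∈ A, G (t, x) = x := fun t x hx => dif_pos hx
  have h2 : ∀ (t : I) j, ∀ u ∈ closedBall (0 : E) 1, G (t, φ j u) = φ j (inflate (t : ℝ) u) := by
    intro t j u hu
    by_cases hA : φ j u ∈ A
    · have hs : u ∈ Metric.sphere (0 : E) 1 := by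
        rcases (mem_closedBall_zero_iff.1 hu).lt_or_eq with h' | h'
        · exact absurd hA (h.ball j u (mem_ball_zero_iff.2 h'))
        · exact mem_sphere_zero_iff_norm.2 h'
      rw [h1 _ _ hA, inflate_sphere t.2.1 hs]
    · obtain ⟨h3, h4⟩ := h.inj _ _ _ (hcb _ hA) _ (h.mem_ball_of_notMem hu hA) (hcx _ hA)
      change dite _ _ _ = _
      rw [dif_neg hA]
      dsimp only
      rw [h3, h4]
  refine ⟨G, ?_, h1, h2⟩
  have : CompactSpace A := isCompact_iff_compactSpace.1 h.isClosed.isCompact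
  have : CompactSpace (closedBall (0 : E) 1) :=
    isCompact_iff_compactSpace.1 (isCompact_closedBall 0 1)
  refine continuous_of_compact_cover (A := I × A) (B := Σ _ : J, I × closedBall (0 : E) 1)
    (a := fun p => (p.1, p.2.1)) (b := fun p => (p.2.1, φ p.1 p.2.2)) (by fun_prop) ?_ ?_ ?_ ?_
  · refine continuous_sigma fun j => Continuous.prodMk (by fun_prop) ?_
    exact (h.continuousOn j).comp_continuous (by fun_prop) fun p => p.2.2
  · rintro ⟨t, x⟩
    rcases h.cover x with hx | ⟨j, u, hu, rfl⟩
    · exact Or.inl ⟨(t, ⟨x, hx⟩), rfl⟩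
    · exact Or.inr ⟨⟨j, t, ⟨u, ball_subset_closedBall hu⟩⟩, rfl⟩
  · have : (G ∘ fun p : I × A => (p.1, p.2.1)) = fun p => p.2.1 := funext fun p => h1 _ _ p.2.2
    rw [this]
    fun_prop
  · refine continuous_sigma fun j => ?_
    have : ((G ∘ fun p : Σ _ : J, I × closedBall (0 : E) 1 => (p.2.1, φ p.1 p.2.2)) ∘ Sigma.mk j) =
        fun p : I × closedBall (0 : E) 1 => φ j (inflate (p.1 : ℝ) p.2.1) :=
      funext fun p => h2 _ _ _ p.2.2
    change Continuous ((G ∘ fun p : Σ _ : J, I × closedBall (0 : E) 1 => (p.2.1, φ p.1 p.2.2)) ∘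
      Sigma.mk j)
    rw [this]
    refine (h.continuousOn j).comp_continuous ?_ fun p => inflate_mem _ _
    exact continuous_inflate.comp ((continuous_subtype_val.comp continuous_fst).prodMk
      (continuous_subtype_val.comp continuous_snd))

/-- A path in an open cell is the image of a path in the open ball. -/
theorem exists_lift [T2Space X] [NormedSpace ℝ E] [FiniteDimensional ℝ E]
    (h : IsCellAttachment A φ) {j : J} {P : I → X} (hP : Continuous P)
    (hPj : ∀ t, P t ∈ φ j '' Metric.ball (0 : E) 1) :
    ∃ u : I → E, Continuous u ∧ (∀ t, u t ∈ Metric.ball (0 : E) 1) ∧ ∀ t, φ j (u t) = P t := by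
  choose u hu hu' using hPj
  refine ⟨u, continuous_iff_isClosed.2 fun C hC => ?_, hu, hu'⟩
  have : u ⁻¹' C = P ⁻¹' (φ j '' (closedBall 0 1 ∩ C)) := by
    ext t
    constructor
    · exact fun ht => ⟨u t, ⟨ball_subset_closedBall (hu t), ht⟩, hu' t⟩
    · rintro ⟨v, ⟨hv, hvC⟩, hv'⟩
      have hA : φ j v ∉ A := by
        rw [hv', ← hu' t]
        exact h.ball j _ (hu t)
      have := (h.inj _ _ _ (h.mem_ball_of_notMem hv hA) _ (hu t) (hv'.trans (hu' t).symm)).2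
      exact (this ▸ hvC : u t ∈ C)
  rw [this]
  exact ((((isCompact_closedBall (0 : E) 1).inter_right hC).image_of_continuousOn
    ((h.continuousOn j).mono inter_subset_left)).isClosed).preimage hP

theorem isOpen_cell [T2Space X] [Finite J] [NormedSpace ℝ E] [FiniteDimensional ℝ E]
    (h : IsCellAttachment A φ) (j : J) :
    IsOpen (φ j '' Metric.ball (0 : E) 1) := by
  have : (φ j '' Metric.ball (0 : E) 1)ᶜ =
      A ∪ ⋃ i : {i // i ≠ j}, φ i '' closedBall (0 : E) 1 := by
    ext x
    constructor
    · intro hx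
      rcases h.cover x with hA | ⟨i, u, hu, rfl⟩
      · exact Or.inl hA
      · refine Or.inr (mem_iUnion.2 ⟨⟨i, ?_⟩, mem_image_of_mem _ (ball_subset_closedBall hu)⟩)
        rintro rfl
        exact hx (mem_image_of_mem _ hu)
    · rintro (hA | hx) ⟨u, hu, rfl⟩
      · exact h.ball j u hu hA
      · obtain ⟨⟨i, hi⟩, v, hv, hv'⟩ := mem_iUnion.1 hx
        have hA : φ i v ∉ A := hv' ▸ h.ball j u hu
        exact hi (h.inj _ _ _ (h.mem_ball_of_notMem hv hA) _ hu hv').1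
  rw [← isClosed_compl_iff, this]
  exact h.isClosed.union (isClosed_iUnion_of_finite fun i =>
    ((isCompact_closedBall (0 : E) 1).image_of_continuousOn (h.continuousOn i)).isClosed)

/-- A path from an inflated point to the subset `A`, staying in `A` or in the cell of the point. -/
theorem exists_tail [NormedSpace ℝ E] [Nontrivial E] (h : IsCellAttachment A φ) {G : I × X → X}
    (hGA : ∀ t, ∀ x ∈ A, G (t, x) = x)
    (hG : ∀ t j, ∀ u ∈ closedBall (0 : E) 1, G (t, φ j u) = φ j (inflate (t : ℝ) u)) (x : X) :
    ∃ (a : X) (d : Path (G (1, x)) a), a ∈ A ∧ (G (1, x) ∈ A → ∀ t, d t ∈ A) ∧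
      ∀ j, ∀ u ∈ Metric.ball (0 : E) 1, φ j u = x → ∃ w ∈ Metric.sphere (0 : E) 1,
        ∃ δ : Path (inflate 1 u) w, (∀ t, δ t ∈ closedBall (0 : E) 1) ∧ ∀ t, d t = φ j (δ t) := by
  have hG1 : ∀ j, ∀ u ∈ closedBall (0 : E) 1, G (1, φ j u) = φ j (inflate 1 u) := fun j u hu =>
    hG 1 j u hu
  by_cases hx : G (1, x) ∈ A
  · refine ⟨_, Path.refl _, hx, fun _ _ => hx, ?_⟩
    rintro j u hu rfl
    rw [hG1 j u (ball_subset_closedBall hu)] at hx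
    refine ⟨inflate 1 u, ?_, Path.refl _, fun _ => inflate_mem _ _, fun _ =>
      hG1 j u (ball_subset_closedBall hu)⟩
    rcases (mem_closedBall_zero_iff.1 (inflate_mem 1 u)).lt_or_eq with h' | h'
    · exact absurd hx (h.ball j _ (mem_ball_zero_iff.2 h'))
    · exact mem_sphere_zero_iff_norm.2 h'
  · have hxA : x ∉ A := fun hA => hx (by rwa [hGA _ _ hA])
    obtain ⟨j, u, hu, rfl⟩ := (h.cover x).resolve_left hxA
    obtain ⟨w, hw⟩ := NormedSpace.sphere_nonempty (E := E) (x := 0) (r := 1) |>.2 zero_le_one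
    have hj : JoinedIn (closedBall (0 : E) 1) (inflate 1 u) w :=
      ((convex_closedBall (0 : E) 1).isPathConnected ⟨w, sphere_subset_closedBall hw⟩).joinedIn
        _ (inflate_mem _ _) _ (sphere_subset_closedBall hw)
    refine ⟨φ j w, ⟨⟨fun t => φ j (hj.somePath t), (h.continuousOn j).comp_continuous
      hj.somePath.continuous hj.somePath_mem⟩, ?_, ?_⟩, h.sphere j w hw,
      fun h' => absurd h' hx, ?_⟩
    · simp [hG1 j u (ball_subset_closedBall hu)]
    · simp
    · intro j' u' hu' he
      obtain ⟨rfl, rfl⟩ := h.inj _ _ _ hu' _ hu he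
      exact ⟨w, hw, hj.somePath, hj.somePath_mem, fun _ => rfl⟩

/-- A property of path classes with ends in `A` which is closed under composition, and which holds
for the paths in `A` and for the paths in a single closed cell, holds for all paths with ends in
`A`: inflate the cells, and cut the path into pieces which lie in a cell or are moved into `A`. -/
theorem path_induction [T2Space X] [CompactSpace X] [Finite J] [NormedSpace ℝ E]
    [FiniteDimensional ℝ E] [Nontrivial E] (h : IsCellAttachment A φ)
    {Q : ∀ {a b : FundamentalGroupoid X}, (a ⟶ b) → Prop}
    (hQ : ∀ {a b c : FundamentalGroupoid X} (f : a ⟶ b) (g : b ⟶ c), Q f → Q g → Q (f ≫ g))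
    (hQA : ∀ {a b : X} (p : Path a b), (∀ t, p t ∈ A) → Q p.cls)
    (hQc : ∀ (j : J) {u w : E} (δ : Path u w), u ∈ Metric.sphere (0 : E) 1 →
      w ∈ Metric.sphere (0 : E) 1 → (∀ t, δ t ∈ closedBall (0 : E) 1) →
      ∀ {a b : X} (p : Path a b), (∀ t, p t = φ j (δ t)) → Q p.cls)
    {a b : X} (ha : a ∈ A) (hb : b ∈ A) (p : Path a b) : Q p.cls := by
  obtain ⟨G, hGc, hGA, hG⟩ := h.exists_inflation
  choose e d heA hdA hdc using h.exists_tail hGA hG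
  have hG1c : Continuous fun x => G (1, x) := hGc.comp (Continuous.prodMk_right 1)
  have hG1 : ∀ j, ∀ u ∈ closedBall (0 : E) 1, G (1, φ j u) = φ j (inflate 1 u) := fun j u hu =>
    hG 1 j u hu
  let q : Path (G (1, a)) (G (1, b)) := p.map hG1c
  let sub : ∀ s t : I, Path (G (1, p s)) (G (1, p t)) := fun s t => q.subpath s t
  -- `Q` holds for the inflated piece of the path between `s` and `t`, completed by the tails
  let R : I → I → Prop := fun s t =>
    Q ((d (p s)).symm.trans ((sub s t).trans (d (p t)))).cls
  have hsub : ∀ s t r, ∃ r' ∈ uIcc s t, sub s t r = G (1, p r') := by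
    intro s t r
    have : sub s t r ∈ q '' uIcc s t := Path.range_subpath q s t ▸ mem_range_self r
    obtain ⟨r', hr', h'⟩ := this
    exact ⟨r', hr', h'.symm⟩
  have hRtrans : ∀ r s t, R r s → R s t → R r t := by
    intro r s t h1 h2
    have h3 := hQ _ _ h1 h2
    have h4 : (sub r t).cls = (sub r s).cls ≫ (sub s t).cls :=
      (Path.cls_eq_iff.2 ⟨Path.Homotopy.subpathTransSubpath q r s t⟩).symm
    have h5 : ((d (p r)).symm.trans ((sub r s).trans (d (p s)))).cls ≫
        ((d (p s)).symm.trans ((sub s t).trans (d (p t)))).cls =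
        ((d (p r)).symm.trans ((sub r t).trans (d (p t)))).cls := by
      simp only [Path.cls_trans, Path.cls_symm, h4, Category.assoc, IsIso.hom_inv_id_assoc]
    rwa [h5] at h3
  -- the part of the space which is moved into `A`
  let U : Set X := (⋃ j, φ j '' closedBall (0 : E) (1 / 2))ᶜ
  have hU : IsOpen U := by
    refine (isClosed_iUnion_of_finite fun j => IsCompact.isClosed ?_).isOpen_compl
    exact (isCompact_closedBall (0 : E) (1 / 2)).image_of_continuousOn
      ((h.continuousOn j).mono (closedBall_subset_closedBall (by norm_num)))
  have hUA : ∀ x ∈ U, G (1, x) ∈ A := by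
    intro x hx
    rcases h.cover x with hA | ⟨j, u, hu, rfl⟩
    · rwa [hGA _ _ hA]
    · rw [hG1 j u (ball_subset_closedBall hu)]
      refine h.sphere j _ (inflate_one_mem_sphere ?_)
      by_contra hle
      exact hx (mem_iUnion.2 ⟨j, u, mem_closedBall_zero_iff.2 (not_lt.1 hle), rfl⟩)
  have hRU : ∀ s t, s ≤ t → (∀ r ∈ Icc s t, p r ∈ U) → R s t := by
    intro s t hst hr
    refine hQA _ fun r => ?_
    have hs := hdA (p s) (hUA _ (hr s (left_mem_Icc.2 hst)))
    have ht := hdA (p t) (hUA _ (hr t (right_mem_Icc.2 hst)))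
    have hm : ∀ r, sub s t r ∈ A := fun r => by
      obtain ⟨r', hr', h'⟩ := hsub s t r
      rw [h']
      exact hUA _ (hr r' (uIcc_of_le hst ▸ hr'))
    rw [Path.trans_apply]
    split_ifs
    · exact hs _
    · rw [Path.trans_apply]
      split_ifs
      · exact hm _
      · exact ht _
  have hRV : ∀ s t, s ≤ t → ∀ j, (∀ r ∈ Icc s t, p r ∈ φ j '' Metric.ball (0 : E) 1) → R s t := by
    intro s t hst j hr
    have hp : ∀ r, p.subpath s t r ∈ φ j '' Metric.ball (0 : E) 1 := by
      intro r
      have : p.subpath s t r ∈ p '' uIcc s t := Path.range_subpath p s t ▸ mem_range_self r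
      obtain ⟨r', hr', h'⟩ := this
      exact h' ▸ hr r' (uIcc_of_le hst ▸ hr')
    obtain ⟨u, hu, hub, huP⟩ := h.exists_lift (p.subpath s t).continuous hp
    obtain ⟨w, hw, δ, hδ, hdδ⟩ := hdc (p s) j (u 0) (hub 0) (by rw [huP, Path.source])
    obtain ⟨w', hw', δ', hδ', hdδ'⟩ := hdc (p t) j (u 1) (hub 1) (by rw [huP, Path.target])
    let ε : Path (inflate 1 (u 0)) (inflate 1 (u 1)) :=
      ⟨⟨fun r => inflate 1 (u r), continuous_inflate.comp (continuous_const.prodMk hu)⟩, rfl, rfl⟩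
    have hε : ∀ r, ε r ∈ closedBall (0 : E) 1 := fun r => inflate_mem _ _
    have hsε : ∀ r, sub s t r = φ j (ε r) := fun r => by
      change G (1, p.subpath s t r) = φ j (inflate 1 (u r))
      rw [← huP, hG1 j _ (ball_subset_closedBall (hub r))]
    refine hQc j (δ.symm.trans (ε.trans δ')) hw hw' (fun r => ?_) _ (fun r => ?_)
    · rw [Path.trans_apply]
      split_ifs
      · exact hδ _
      · rw [Path.trans_apply]
        split_ifs
        · exact hε _
        · exact hδ' _
    · rw [Path.trans_apply, Path.trans_apply]
      split_ifs
      · exact hdδ _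
      · rw [Path.trans_apply, Path.trans_apply]
        split_ifs
        · exact hsε _
        · exact hdδ' _
  let c : Option J → Set I := fun i => i.elim (p ⁻¹' U) fun j => p ⁻¹' (φ j '' Metric.ball (0 : E) 1)
  have hco : ∀ i, IsOpen (c i) := by
    rintro (_ | j)
    · exact hU.preimage p.continuous
    · exact (h.isOpen_cell j).preimage p.continuous
  have hcu : univ ⊆ ⋃ i, c i := by
    intro r _
    rcases h.cover (p r) with hA | ⟨j, u, hu, hr⟩
    · refine mem_iUnion.2 ⟨none, fun hr => ?_⟩
      obtain ⟨j, u, hu, hr⟩ := mem_iUnion.1 hr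
      refine h.ball j u (closedBall_subset_ball (by norm_num) hu) ?_
      rwa [hr]
    · exact mem_iUnion.2 ⟨some j, u, hu, hr⟩
  obtain ⟨τ, hτ0, hτm, ⟨N, hN⟩, hτ⟩ := exists_monotone_Icc_subset_open_cover_unitInterval hco hcu
  have hRn : ∀ n, R (τ n) (τ (n + 1)) := by
    intro n
    obtain ⟨_ | j, hi⟩ := hτ n
    · exact hRU _ _ (hτm n.le_succ) hi
    · exact hRV _ _ (hτm n.le_succ) j hi
  have hR0 : ∀ n, R (τ 0) (τ (n + 1)) := by
    intro n
    induction n with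
    | zero => exact hRn 0
    | succ n ih => exact hRtrans _ _ _ ih (hRn _)
  have hR01 : R 0 1 := by
    have := hR0 N
    rwa [hτ0, hN (N + 1) (by omega)] at this
  -- undo the two tails, which lie in `A`
  have hd0 : Q (d (p 0)).cls := hQA _ (hdA _ (by rwa [p.source, hGA _ _ ha]))
  have hd1 : Q (d (p 1)).symm.cls := hQA _ fun t => hdA _ (by rwa [p.target, hGA _ _ hb]) _
  have hQq : Q (sub 0 1).cls := by
    have := hQ _ _ hd0 (hQ _ _ hR01 hd1)
    simpa only [Path.cls_trans, Path.cls_symm, Category.assoc, IsIso.hom_inv_id_assoc,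
      IsIso.hom_inv_id, Category.comp_id] using this
  have hcast : ∀ {x x' y y' : X} (hx : x' = x) (hy : y' = y) (p : Path x y), Q p.cls →
      Q (p.cast hx hy).cls := by
    rintro x _ y _ rfl rfl p hp
    exact hp
  -- the homotopy `G` connects the path with the inflated path
  have hG0 : ∀ x, G (0, x) = x := fun x => by
    rcases h.cover x with hA | ⟨j, u, hu, rfl⟩
    · exact hGA _ _ hA
    · rw [hG _ _ _ (ball_subset_closedBall hu)]
      exact congrArg _ (inflate_zero (ball_subset_closedBall hu))
  have hfin := hcast (x' := a) (y' := b) (by rw [p.source, hGA _ _ ha])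
    (by rw [p.target, hGA _ _ hb]) _ hQq
  convert hfin using 1
  rw [Path.cls_eq_iff]
  refine ⟨⟨⟨⟨fun x => G (x.1, p x.2), hGc.comp (by fun_prop)⟩, fun t => hG0 _, fun t => ?_⟩, ?_⟩⟩
  · change G (1, p t) = q.subpath 0 1 t
    rw [Path.subpath_zero_one]
    rfl
  · rintro t x (rfl | rfl)
    · change G (t, p 0) = p 0
      rw [p.source, hGA _ _ ha]
    · change G (t, p 1) = p 1
      rw [p.target, hGA _ _ hb]

end IsCellAttachment

end Generation

/-! ### The fundamental group of a wedge of circles -/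

namespace WedgeCircles

open CategoryTheory unitInterval

instance (n : ℕ) : T2Space (WedgeCircles n) :=
  inferInstanceAs (T2Space {z : Fin n → Circle // ∀ i j, i ≠ j → z i = 1 ∨ z j = 1})

variable {n : ℕ}

/-- The point `z` of the `i`-th circle. -/
noncomputable def point (i : Fin n) (z : Circle) : WedgeCircles n :=
  ⟨Function.update (fun _ => 1) i z, fun j k hjk => by
    by_cases hj : j = i
    · subst hj
      exact Or.inr (Function.update_of_ne hjk.symm _ _)
    · exact Or.inl (Function.update_of_ne hj _ _)⟩

theorem continuous_point (i : Fin n) : Continuous (point i) :=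
  Continuous.subtype_mk (f := fun z : Circle => Function.update (fun _ : Fin n => (1 : Circle)) i z)
    (continuous_const.update i continuous_id) _

theorem point_one (i : Fin n) : point i 1 = base n :=
  Subtype.ext (Function.update_eq_self i (fun _ => (1 : Circle)))

theorem point_apply_self (i : Fin n) (z : Circle) : (point i z).1 i = z := by
  change Function.update (fun _ => (1 : Circle)) i z i = z
  rw [Function.update_self]

theorem point_apply_of_ne {i j : Fin n} (h : j ≠ i) (z : Circle) : (point i z).1 j = 1 := by
  change Function.update (fun _ => (1 : Circle)) i z j = 1
  rw [Function.update_of_ne h]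

theorem point_inj {i j : Fin n} {z w : Circle} (hz : z ≠ 1) (h : point i z = point j w) :
    i = j ∧ z = w := by
  have hij : i = j := by
    by_contra hij
    apply hz
    rw [← point_apply_self i z, h, point_apply_of_ne hij]
  subst hij
  exact ⟨rfl, by rw [← point_apply_self i z, h, point_apply_self]⟩

theorem eq_point {w : WedgeCircles n} {i : Fin n} (hw : w ∈ openCircle i) :
    w = point i (w.1 i) := by
  refine Subtype.ext (funext fun j => ?_)
  by_cases hj : j = i
  · subst hj
    rw [point_apply_self]
  · rw [point_apply_of_ne hj]
    exact (w.2 j i hj).resolve_right hw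

/-- The characteristic map of the `i`-th circle, defined on the interval `[-1, 1]`. -/
noncomputable def charMap (i : Fin n) (u : Fin 1 → ℝ) : WedgeCircles n :=
  point i (Circle.exp (Real.pi * (u 0 + 1)))

theorem exp_ne_one {s : ℝ} (h1 : -1 < s) (h2 : s < 1) : Circle.exp (Real.pi * (s + 1)) ≠ 1 := by
  intro h
  obtain ⟨m, hm⟩ := Circle.exp_eq_one.1 h
  have h3 : s + 1 = 2 * m := by
    have := Real.pi_pos.ne'
    field_simp at hm
    linarith
  have h4 : (0 : ℝ) < m := by linarith
  have h5 : (m : ℝ) < 1 := by linarith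
  norm_cast at h4 h5
  omega

theorem abs_lt_of_mem_ball {u : Fin 1 → ℝ} (hu : u ∈ ball (0 : Fin 1 → ℝ) 1) :
    -1 < u 0 ∧ u 0 < 1 :=
  abs_lt.1 ((norm_le_pi_norm u 0).trans_lt (mem_ball_zero_iff.1 hu))

theorem charMap_of_mem_sphere (i : Fin n) {u : Fin 1 → ℝ} (hu : u ∈ sphere (0 : Fin 1 → ℝ) 1) :
    charMap i u = base n := by
  rcases FinCW.mem_sphere_fin_one hu with rfl | rfl
  · rw [charMap, one_add_one_eq_two, mul_comm, Circle.exp_two_pi, point_one]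
  · rw [charMap, neg_add_cancel, mul_zero, Circle.exp_zero, point_one]

theorem const_mem_ball {s : ℝ} (h1 : -1 < s) (h2 : s < 1) :
    (fun _ => s) ∈ ball (0 : Fin 1 → ℝ) 1 := by
  rw [mem_ball_zero_iff, pi_norm_lt_iff one_pos]
  exact fun _ => abs_lt.2 ⟨h1, h2⟩

/-- A wedge of circles is obtained from its wedge point by attaching `1`-cells. -/
theorem isCellAttachment (n : ℕ) :
    IsCellAttachment {base n} (charMap : Fin n → (Fin 1 → ℝ) → WedgeCircles n) where
  isClosed := isClosed_singleton
  continuousOn i := ((continuous_point i).comp (Circle.exp.continuous.comp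
    (by fun_prop))).continuousOn
  sphere i u hu := charMap_of_mem_sphere i hu
  ball i u hu h := by
    obtain ⟨h1, h2⟩ := abs_lt_of_mem_ball hu
    refine exp_ne_one h1 h2 ?_
    rw [← point_apply_self i (Circle.exp (Real.pi * (u 0 + 1)))]
    exact congrFun (congrArg Subtype.val h) i
  inj i j u hu v hv h := by
    obtain ⟨h1, h2⟩ := abs_lt_of_mem_ball hu
    obtain ⟨h3, h4⟩ := abs_lt_of_mem_ball hv
    obtain ⟨rfl, h5⟩ := point_inj (exp_ne_one h1 h2) h
    refine ⟨rfl, ?_⟩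
    have hpi := Real.pi_pos
    have h6 := Circle.exp_injOn_Ico (a := 0) (b := 2 * Real.pi) (by linarith)
      ⟨by nlinarith, by nlinarith⟩ ⟨by nlinarith, by nlinarith⟩ h5
    have h7 : u 0 = v 0 := by linarith [mul_left_cancel₀ hpi.ne' h6]
    rw [FinCW.eq_const_fin_one u, FinCW.eq_const_fin_one v, h7]
  cover w := by
    rcases eq_base_or_mem w with rfl | ⟨i, hi⟩
    · exact Or.inl rfl
    · have hpi := Real.pi_pos
      obtain ⟨t, ⟨ht1, ht2⟩, ht⟩ :=
        Circle.surjOn_exp_neg_pi_pi (mem_univ (w.1 i * Circle.exp (-Real.pi)))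
      have hw : Circle.exp (t + Real.pi) = w.1 i := by
        rw [Circle.exp_add, ht, mul_assoc, ← Circle.exp_add, neg_add_cancel, Circle.exp_zero,
          mul_one]
      have ht3 : t < Real.pi := by
        refine lt_of_le_of_ne ht2 ?_
        rintro rfl
        apply hi
        rw [← hw, ← two_mul, Circle.exp_two_pi]
      refine Or.inr ⟨i, fun _ => t / Real.pi, const_mem_ball ?_ ?_, ?_⟩
      · rw [lt_div_iff₀ hpi]
        linarith
      · rwa [div_lt_one hpi]
      · rw [charMap, mul_add, mul_div_cancel₀ _ hpi.ne', mul_one, hw, ← eq_point hi]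

/-- The loop running once around the `i`-th circle. -/
noncomputable def loop (i : Fin n) : Path (base n) (base n) where
  toFun t := charMap i fun _ => 2 * t - 1
  continuous_toFun := (continuous_point i).comp (Circle.exp.continuous.comp (by fun_prop))
  source' := charMap_of_mem_sphere i (FinCW.const_mem_sphere_fin_one (by simp))
  target' := charMap_of_mem_sphere i (FinCW.const_mem_sphere_fin_one (by norm_num))

theorem loop_apply (i : Fin n) (t : I) : loop i t = charMap i fun _ => 2 * (t : ℝ) - 1 := rfl

theorem mem_ball_of_loop_ne {i : Fin n} {t : I} (h : loop i t ≠ base n) :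
    (fun _ => 2 * (t : ℝ) - 1) ∈ ball (0 : Fin 1 → ℝ) 1 := by
  refine (isCellAttachment n).mem_ball_of_notMem ?_ h
  rw [mem_closedBall_zero_iff, pi_norm_le_iff_of_nonneg zero_le_one]
  exact fun _ => abs_le.2 ⟨by linarith [t.2.1], by linarith [t.2.2]⟩

theorem loop_inj {i j : Fin n} {t s : I} (h : loop i t = loop j s) (hne : loop i t ≠ base n) :
    i = j ∧ t = s := by
  obtain ⟨rfl, h1⟩ := (isCellAttachment n).inj _ _ _ (mem_ball_of_loop_ne hne) _
    (mem_ball_of_loop_ne (h ▸ hne)) h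
  have h2 := congrFun h1 0
  exact ⟨rfl, Subtype.ext (by linarith)⟩

theorem eq_base_or_loop (w : WedgeCircles n) :
    w = base n ∨ ∃ i, ∃ t ∈ Ioo (0 : I) 1, loop i t = w := by
  rcases (isCellAttachment n).cover w with h | ⟨i, u, hu, rfl⟩
  · exact Or.inl h
  · obtain ⟨h1, h2⟩ := abs_lt_of_mem_ball hu
    refine Or.inr ⟨i, ⟨(u 0 + 1) / 2, by linarith, by linarith⟩,
      ⟨Subtype.mk_lt_mk.2 (by linarith), Subtype.mk_lt_mk.2 (by linarith)⟩, ?_⟩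
    have : (fun _ => 2 * ((u 0 + 1) / 2) - 1) = u := by
      conv_rhs => rw [FinCW.eq_const_fin_one u]
      ext
      ring
    exact congrArg (charMap i) this

theorem loop_mem_openCircle (i : Fin n) {t : I} (ht : t ∈ Ioo (0 : I) 1) :
    loop i t ∈ openCircle i := by
  have h0 : (0 : ℝ) < t := ht.1
  have h1 : (t : ℝ) < 1 := ht.2
  change (loop i t).1 i ≠ 1
  rw [loop_apply, charMap, point_apply_self]
  exact exp_ne_one (by linarith) (by linarith)

theorem image_loop (i : Fin n) : loop i '' Ioo 0 1 = openCircle i := by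
  ext w
  constructor
  · rintro ⟨t, ht, rfl⟩
    exact loop_mem_openCircle i ht
  · intro hw
    rcases eq_base_or_loop w with rfl | ⟨j, t, ht, rfl⟩
    · exact absurd rfl hw
    · obtain rfl : i = j := by
        by_contra hij
        exact hw (point_apply_of_ne hij _)
      exact mem_image_of_mem _ ht

/-- The fundamental group of a wedge of circles is generated by the circles. -/
theorem hom_ext {G : Type*} [Group G] {f g : FundamentalGroup (WedgeCircles n) (base n) →* G}
    (h : ∀ i, f (loop i).cls = g (loop i).cls) : f = g := by
  let S : Subgroup (FundamentalGroup (WedgeCircles n) (base n)) := f.eqLocus g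
  have hS : ∀ i, (loop i).cls ∈ S := h
  -- `Q` says that a morphism is a loop at the base point whose class lies in `S`
  let Q : ∀ {a b : FundamentalGroupoid (WedgeCircles n)}, (a ⟶ b) → Prop := fun {a b} p =>
    ∃ (ha : a = ⟨base n⟩) (hb : b = ⟨base n⟩), eqToHom ha.symm ≫ p ≫ eqToHom hb ∈ S
  have hQ : ∀ {p : Path (base n) (base n)}, p.cls ∈ S → Q p.cls := fun {p} hp =>
    ⟨rfl, rfl, by simpa using hp⟩
  have key := fun p : Path (base n) (base n) =>
    (isCellAttachment n).path_induction (Q := Q) ?_ ?_ ?_ (mem_singleton _) (mem_singleton _) p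
  · ext p
    obtain ⟨p, rfl⟩ := Path.Homotopic.Quotient.mk_surjective p
    obtain ⟨_, _, hp⟩ := key p
    have hp' : p.cls ∈ S := by simpa using hp
    exact hp'
  · rintro a b c p q ⟨rfl, rfl, hp⟩ ⟨_, rfl, hq⟩
    refine ⟨rfl, rfl, ?_⟩
    have := S.mul_mem hq hp
    simpa using this
  · intro a b p hp
    obtain rfl : a = base n := by simpa using hp 0
    obtain rfl : b = base n := by simpa using hp 1
    refine hQ ?_
    have : p = Path.refl _ := by
      ext1
      exact funext hp
    rw [this]
    exact S.one_mem
  · intro i u w δ hu hw hδ a b p hp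
    obtain rfl : a = base n := by
      rw [← p.source, hp, δ.source, charMap_of_mem_sphere i hu]
    obtain rfl : b = base n := by
      rw [← p.target, hp, δ.target, charMap_of_mem_sphere i hw]
    refine hQ ?_
    -- a path in the interval is determined up to homotopy by its ends
    have hhom : ∀ (δ' : Path u w) (p' : Path (base n) (base n)),
        (∀ t, δ' t ∈ closedBall (0 : Fin 1 → ℝ) 1) → (∀ t, p' t = charMap i (δ' t)) →
        p'.cls ∈ S → p.cls ∈ S := by
      intro δ' p' hδ' hp' h
      rwa [Path.cls_eq_iff.2 (Path.homotopic_of_convex (convex_closedBall _ _)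
        ((isCellAttachment n).continuousOn i) hδ hδ' hp hp')]
    let κ : Path (fun _ => -1 : Fin 1 → ℝ) (fun _ => 1) :=
      ⟨⟨fun t _ => 2 * (t : ℝ) - 1, by fun_prop⟩, by ext; simp, by ext; simp; norm_num⟩
    have hκ : ∀ t, κ t ∈ closedBall (0 : Fin 1 → ℝ) 1 := by
      intro t
      rw [mem_closedBall_zero_iff, pi_norm_le_iff_of_nonneg zero_le_one]
      intro _
      change |2 * (t : ℝ) - 1| ≤ 1
      exact abs_le.2 ⟨by linarith [t.2.1], by linarith [t.2.2]⟩
    have hrefl : ∀ v ∈ sphere (0 : Fin 1 → ℝ) 1, ∀ t,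
        Path.refl (base n) t = charMap i (Path.refl v t) := fun v hv t => (charMap_of_mem_sphere i hv).symm
    rcases FinCW.mem_sphere_fin_one hu with rfl | rfl <;>
    rcases FinCW.mem_sphere_fin_one hw with rfl | rfl
    · exact hhom (Path.refl _) (Path.refl _) (fun _ => sphere_subset_closedBall hu) (hrefl _ hu)
        S.one_mem
    · refine hhom κ.symm (loop i).symm (fun t => hκ _) (fun _ => rfl) ?_
      exact S.inv_mem (hS i)
    · exact hhom κ (loop i) hκ (fun _ => rfl) (hS i)
    · exact hhom (Path.refl _) (Path.refl _) (fun _ => sphere_subset_closedBall hu) (hrefl _ hu)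
        S.one_mem

/-- Loops at a point assemble to a map from a wedge of circles. -/
theorem exists_desc {Y : Type*} [TopologicalSpace Y] {y : Y} (ε : Fin n → Path y y) :
    ∃ f : WedgeCircles n → Y, Continuous f ∧ f (base n) = y ∧ ∀ i t, f (loop i t) = ε i t := by
  classical
  have hc : ∀ w : WedgeCircles n, w ≠ base n → ∃ p : Fin n × I, loop p.1 p.2 = w := by
    intro w hw
    obtain ⟨i, t, -, h⟩ := (eq_base_or_loop w).resolve_left hw
    exact ⟨(i, t), h⟩
  choose c hc using hc
  let f : WedgeCircles n → Y := fun w =>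
    if h : w = base n then y else ε (c w h).1 (c w h).2
  have hbase : f (base n) = y := dif_pos rfl
  have hloop : ∀ i t, f (loop i t) = ε i t := by
    intro i t
    by_cases h : loop i t = base n
    · rw [h, hbase]
      rcases eq_or_ne t 0 with rfl | h0
      · exact (ε i).source.symm
      rcases eq_or_ne t 1 with rfl | h1
      · exact (ε i).target.symm
      have h0' : (0 : ℝ) < t := unitInterval.pos_iff_ne_zero.2 h0
      have h1' : (t : ℝ) < 1 := unitInterval.lt_one_iff_ne_one.2 h1
      exact absurd h ((isCellAttachment n).ball i _
        (const_mem_ball (by linarith) (by linarith)))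
    · change dite _ _ _ = _
      obtain ⟨h1, h2⟩ := loop_inj (hc _ h).symm h
      rw [dif_neg h, ← h1, ← h2]
  refine ⟨f, ?_, hbase, hloop⟩
  refine continuous_of_compact_cover (A := Unit) (B := Σ _ : Fin n, I) (a := fun _ => base n)
    (b := fun p => loop p.1 p.2) continuous_const (continuous_sigma fun i => (loop i).continuous)
    ?_ continuous_const (continuous_sigma fun i => ?_)
  · intro w
    by_cases h : w = base n
    · exact Or.inl ⟨(), h.symm⟩
    · exact Or.inr ⟨⟨_, _⟩, hc w h⟩
  · exact (ε i).continuous.congr fun t => (hloop i t).symm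

end WedgeCircles

/-! ### Complexes with one vertex and their edge loops -/

namespace FinCW

open CategoryTheory unitInterval

theorem skelLT_two_eq_skeleton (X : FinCW) :
    X.skelLT 2 = (RelCWComplex.skeleton (univ : Set X) 1 : Set X) := by
  ext x
  rw [SetLike.mem_coe, CWComplex.mem_skeleton_iff]
  constructor
  · rintro ⟨k, hk, j, hj⟩
    exact ⟨k, by exact_mod_cast Nat.le_of_lt_succ hk, j, hj⟩
  · rintro ⟨k, hk, j, hj⟩
    exact ⟨k, Nat.lt_succ_of_le (by exact_mod_cast hk), j, hj⟩

theorem DimLE.isCellAttachment {X : FinCW} {m : ℕ} (hX : X.DimLE m) :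
    IsCellAttachment (X.skelLT m) fun i : X.Cell m => X.cmap i where
  isClosed := X.isClosed_skelLT m
  continuousOn i := X.continuousOn_cmap i
  sphere i u hu := X.cmap_mem_skelLT i hu
  ball i u hu := notMem_skelLT (X.cmap_mem_openCell i hu) le_rfl
  inj i j u hu v hv h := by
    cases cell_unique (X.cmap_mem_openCell i hu) (h ▸ X.cmap_mem_openCell j hv)
    exact ⟨rfl, X.injOn_cmap i hu hv h⟩
  cover x := by
    obtain ⟨k, i, hi⟩ := X.exists_mem_openCell x
    rcases Nat.lt_trichotomy k m with h | rfl | h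
    · exact Or.inl ⟨k, h, i, hi⟩
    · obtain ⟨u, hu, rfl⟩ := hi
      exact Or.inr ⟨i, u, hu, rfl⟩
    · exact ((hX k h).false i).elim

/-- Cellular approximation for paths in a `2`-complex. -/
theorem exists_homotopic_skelLT_two {X : FinCW} (hX : X.DimLE 2) {a b : X}
    (ha : a ∈ X.skelLT 2) (hb : b ∈ X.skelLT 2) (p : Path a b) :
    ∃ q : Path a b, (∀ t, q t ∈ X.skelLT 2) ∧ p.Homotopic q := by
  have h := hX.isCellAttachment.path_induction
    (Q := fun {a b} f => ∃ q : Path a.as b.as, (∀ t, q t ∈ X.skelLT 2) ∧ f = q.cls)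
    ?_ ?_ ?_ ha hb p
  · obtain ⟨q, hq, h⟩ := h
    exact ⟨q, hq, Path.cls_eq_iff.1 h⟩
  · rintro a b c _ _ ⟨p, hp, rfl⟩ ⟨q, hq, rfl⟩
    refine ⟨p.trans q, fun t => ?_, rfl⟩
    rw [Path.trans_apply]
    split_ifs
    · exact hp _
    · exact hq _
  · exact fun p hp => ⟨p, hp, rfl⟩
  · intro j u w δ hu hw hδ a b p hp
    have hj : JoinedIn (sphere (0 : Fin 2 → ℝ) 1) u w :=
      (isPathConnected_sphere (by simp) 0 zero_le_one).joinedIn _ hu _ hw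
    obtain rfl : X.cmap j u = a := by rw [← p.source, hp, δ.source]
    obtain rfl : X.cmap j w = b := by rw [← p.target, hp, δ.target]
    have hmem : ∀ t, hj.somePath t ∈ closedBall (0 : Fin 2 → ℝ) 1 := fun t =>
      sphere_subset_closedBall (hj.somePath_mem t)
    let q : Path (X.cmap j u) (X.cmap j w) :=
      ⟨⟨fun t => X.cmap j (hj.somePath t), (X.continuousOn_cmap j).comp_continuous
        hj.somePath.continuous hmem⟩, by simp, by simp⟩
    refine ⟨q, fun t => X.cmap_mem_skelLT j (hj.somePath_mem t), Path.cls_eq_iff.2 ?_⟩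
    exact Path.homotopic_of_convex (convex_closedBall _ _) (X.continuousOn_cmap j) hδ hmem hp
      fun _ => rfl

theorem OneVertex.pathConnectedSpace {X : FinCW} (hX : X.OneVertex) : PathConnectedSpace X := by
  obtain ⟨v, hv⟩ := hX
  obtain ⟨z, hz⟩ := X.openCell_nonempty v
  have h : ∀ m, ∀ i : X.Cell m, ∀ x ∈ X.openCell i, Joined x z := by
    intro m
    induction m using Nat.strong_induction_on with
    | _ m ih =>
      intro i x hx
      rcases Nat.eq_zero_or_pos m with rfl | hm
      · rw [hv i, openCell_zero_eq v hz] at hx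
        rw [hx]
      · have : Nonempty (Fin m) := ⟨⟨0, hm⟩⟩
        obtain ⟨w, hw⟩ := NormedSpace.sphere_nonempty (E := Fin m → ℝ) (x := 0) (r := 1)
          |>.2 zero_le_one
        obtain ⟨u, hu, rfl⟩ := hx
        obtain ⟨k, hk, j, hj⟩ := X.cmap_mem_skelLT i hw
        refine Joined.trans ?_ (ih k hk j _ hj)
        have hJ : JoinedIn (closedBall (0 : Fin m → ℝ) 1) u w :=
          ((convex_closedBall (0 : Fin m → ℝ) 1).isPathConnected
            ⟨w, sphere_subset_closedBall hw⟩).joinedIn _ (ball_subset_closedBall hu) _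
            (sphere_subset_closedBall hw)
        exact ⟨⟨⟨fun t => X.cmap i (hJ.somePath t), (X.continuousOn_cmap i).comp_continuous
          hJ.somePath.continuous hJ.somePath_mem⟩, by simp, by simp⟩⟩
  refine ⟨⟨z⟩, fun x y => ?_⟩
  obtain ⟨m, i, hi⟩ := X.exists_mem_openCell x
  obtain ⟨k, j, hj⟩ := X.exists_mem_openCell y
  exact (h m i x hi).trans (h k j y hj).symm

/-- The standard parametrization of `[-1, 1]` by the unit interval. -/
def edgeParam (t : I) : Fin 1 → ℝ := fun _ => 2 * (t : ℝ) - 1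

theorem continuous_edgeParam : Continuous edgeParam := by
  unfold edgeParam
  fun_prop

theorem edgeParam_zero : edgeParam 0 = fun _ => -1 := by
  ext
  simp [edgeParam]

theorem edgeParam_one : edgeParam 1 = fun _ => 1 := by
  ext
  simp only [edgeParam, Set.Icc.coe_one]
  norm_num

theorem edgeParam_mem (t : I) : edgeParam t ∈ closedBall (0 : Fin 1 → ℝ) 1 := by
  rw [mem_closedBall_zero_iff, pi_norm_le_iff_of_nonneg zero_le_one]
  intro _
  change |2 * (t : ℝ) - 1| ≤ 1
  exact abs_le.2 ⟨by linarith [t.2.1], by linarith [t.2.2]⟩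

theorem edgeParam_injective : Function.Injective edgeParam := fun t s h => by
  have h2 : 2 * (t : ℝ) - 1 = 2 * s - 1 := congrFun h 0
  exact Subtype.ext (by linarith)

theorem edgeParam_image_Ioo : edgeParam '' Ioo 0 1 = ball (0 : Fin 1 → ℝ) 1 := by
  ext u
  constructor
  · rintro ⟨t, ⟨h0, h1⟩, rfl⟩
    have h0' : (0 : ℝ) < t := h0
    have h1' : (t : ℝ) < 1 := h1
    exact WedgeCircles.const_mem_ball (s := 2 * (t : ℝ) - 1) (by linarith) (by linarith)
  · intro hu
    obtain ⟨h1, h2⟩ := WedgeCircles.abs_lt_of_mem_ball hu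
    refine ⟨⟨(u 0 + 1) / 2, by linarith, by linarith⟩, ⟨?_, ?_⟩, ?_⟩
    · exact Subtype.mk_lt_mk.2 (by linarith)
    · exact Subtype.mk_lt_mk.2 (by linarith)
    · conv_rhs => rw [eq_const_fin_one u]
      ext
      simp only [edgeParam]
      ring

theorem edgeParam_zero_mem : edgeParam 0 ∈ sphere (0 : Fin 1 → ℝ) 1 := by
  rw [edgeParam_zero]
  exact const_mem_sphere_fin_one (by simp)

theorem edgeParam_one_mem : edgeParam 1 ∈ sphere (0 : Fin 1 → ℝ) 1 := by
  rw [edgeParam_one]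
  exact const_mem_sphere_fin_one (by simp)

/-- The loop given by a characteristic map of a `1`-cell whose ends are mapped to the same
point. -/
def edgePath {Y : Type*} [TopologicalSpace Y] {φ : (Fin 1 → ℝ) → Y}
    (hφ : ContinuousOn φ (closedBall 0 1)) {y : Y}
    (hy : ∀ u ∈ sphere (0 : Fin 1 → ℝ) 1, φ u = y) : Path y y where
  toFun t := φ (edgeParam t)
  continuous_toFun := hφ.comp_continuous continuous_edgeParam edgeParam_mem
  source' := hy _ edgeParam_zero_mem
  target' := hy _ edgeParam_one_mem

section edgePath

variable {Y : Type*} [TopologicalSpace Y] {φ : (Fin 1 → ℝ) → Y}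
    (hφ : ContinuousOn φ (closedBall 0 1)) {y : Y}
    (hy : ∀ u ∈ sphere (0 : Fin 1 → ℝ) 1, φ u = y)

theorem edgePath_image : edgePath hφ hy '' Ioo 0 1 = φ '' ball 0 1 := by
  rw [← edgeParam_image_Ioo, image_image]
  rfl

theorem edgePath_injOn (h : InjOn φ (ball 0 1)) : InjOn (edgePath hφ hy) (Ioo 0 1) := by
  intro t ht s hs hts
  refine edgeParam_injective (h ?_ ?_ hts)
  · exact edgeParam_image_Ioo ▸ mem_image_of_mem _ ht
  · exact edgeParam_image_Ioo ▸ mem_image_of_mem _ hs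

end edgePath

/-- The point `z` is the only vertex of `Z`, and the loops `ε i` run bijectively through the
`1`-cells of `Z`. -/
structure IsEdgeLoops (Z : FinCW) {z : Z} {ι : Type} (ε : ι → Path z z) : Prop where
  vertex : ∀ v : Z.Cell 0, Z.openCell v = {z}
  injOn : ∀ i, InjOn (ε i) (Ioo 0 1)
  edge : ∀ i, ∃ c : Z.Cell 1, ε i '' Ioo 0 1 = Z.openCell c
  inj : ∀ i j, ε i '' Ioo 0 1 = ε j '' Ioo 0 1 → i = j
  surj : ∀ c : Z.Cell 1, ∃ i, ε i '' Ioo 0 1 = Z.openCell c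

theorem OneVertex.exists_isEdgeLoops {Z : FinCW} (hZ : Z.OneVertex) :
    ∃ (z : Z) (ε : Z.Cell 1 → Path z z), Z.IsEdgeLoops ε := by
  obtain ⟨v, hv⟩ := hZ
  obtain ⟨z, hz⟩ := Z.openCell_nonempty v
  have hvz : ∀ w : Z.Cell 0, Z.openCell w = {z} := fun w => by
    rw [hv w, openCell_zero_eq v hz]
  have hend : ∀ c : Z.Cell 1, ∀ u ∈ sphere (0 : Fin 1 → ℝ) 1, Z.cmap c u = z := by
    intro c u hu
    obtain ⟨k, hk, j, hj⟩ := Z.cmap_mem_skelLT c hu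
    obtain rfl : k = 0 := by omega
    rwa [hvz j] at hj
  refine ⟨z, fun c => edgePath (Z.continuousOn_cmap c) (hend c), hvz, fun c =>
    edgePath_injOn _ _ (Z.injOn_cmap c), fun c => ⟨c, edgePath_image _ _⟩, fun c d h => ?_,
    fun c => ⟨c, edgePath_image _ _⟩⟩
  rw [edgePath_image, edgePath_image] at h
  exact Z.openCell_injective h

namespace IsEdgeLoops

variable {Z : FinCW} {z : Z} {ι : Type} {ε : ι → Path z z}

theorem comp_equiv (h : Z.IsEdgeLoops ε) {κ : Type} (e : κ ≃ ι) :
    Z.IsEdgeLoops (ε ∘ e) where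
  vertex := h.vertex
  injOn i := h.injOn _
  edge i := h.edge _
  inj i j hij := e.injective (h.inj _ _ hij)
  surj c := by
    obtain ⟨i, hi⟩ := h.surj c
    exact ⟨e.symm i, by simpa using hi⟩

theorem mem_vertex (h : Z.IsEdgeLoops ε) : ∃ v : Z.Cell 0, z ∈ Z.openCell v := by
  have : Nonempty Z := ⟨z⟩
  obtain ⟨v⟩ := Z.exists_vertex
  exact ⟨v, h.vertex v ▸ rfl⟩

theorem disjoint_edge (h : Z.IsEdgeLoops ε) (i : ι) {t : I} (ht : t ∈ Ioo 0 1) : ε i t ≠ z := by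
  intro he
  obtain ⟨c, hc⟩ := h.edge i
  obtain ⟨v, hv⟩ := h.mem_vertex
  have h1 := mem_image_of_mem (ε i) ht
  rw [hc, he] at h1
  cases cell_unique hv h1

theorem eq_of_apply_eq (h : Z.IsEdgeLoops ε) {i j : ι} {t s : I} (ht : t ∈ Ioo 0 1)
    (hs : s ∈ Ioo 0 1) (he : ε i t = ε j s) : i = j ∧ t = s := by
  obtain ⟨c, hc⟩ := h.edge i
  obtain ⟨d, hd⟩ := h.edge j
  have h1 : ε i t ∈ Z.openCell c := hc ▸ mem_image_of_mem _ ht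
  have h2 : ε i t ∈ Z.openCell d := hd ▸ he ▸ mem_image_of_mem _ hs
  cases cell_unique h1 h2
  obtain rfl := h.inj i j (hc.trans hd.symm)
  exact ⟨rfl, h.injOn i ht hs he⟩

theorem mem_skelLT_two (h : Z.IsEdgeLoops ε) {x : Z} :
    x ∈ Z.skelLT 2 ↔ x = z ∨ ∃ i, ∃ t ∈ Ioo (0 : I) 1, ε i t = x := by
  constructor
  · rintro ⟨k, hk, j, hj⟩
    obtain rfl | rfl : k = 0 ∨ k = 1 := by omega
    · rw [h.vertex j] at hj
      exact Or.inl hj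
    · obtain ⟨i, hi⟩ := h.surj j
      rw [← hi] at hj
      exact Or.inr ⟨i, hj⟩
  · rintro (rfl | ⟨i, t, ht, rfl⟩)
    · obtain ⟨v, hv⟩ := h.mem_vertex
      exact ⟨0, by omega, v, hv⟩
    · obtain ⟨c, hc⟩ := h.edge i
      exact ⟨1, by omega, c, hc ▸ mem_image_of_mem _ ht⟩

/-- The edge loops identify the `1`-skeleton with a wedge of circles. -/
theorem exists_wedge {n : ℕ} {ε : Fin n → Path z z} (h : Z.IsEdgeLoops ε) :
    ∃ f : WedgeCircles n → Z, Continuous f ∧ Function.Injective f ∧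
      f (WedgeCircles.base n) = z ∧ (∀ i t, f (WedgeCircles.loop i t) = ε i t) ∧
      (∀ i, ∃ c : Z.Cell 1, f '' WedgeCircles.openCircle i = Z.openCell c) ∧
      range f = Z.skelLT 2 := by
  obtain ⟨f, hf, hb, hl⟩ := WedgeCircles.exists_desc ε
  refine ⟨f, hf, ?_, hb, hl, fun i => ?_, ?_⟩
  · intro w w' hw
    rcases WedgeCircles.eq_base_or_loop w with rfl | ⟨i, t, ht, rfl⟩ <;>
    rcases WedgeCircles.eq_base_or_loop w' with rfl | ⟨j, s, hs, rfl⟩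
    · rfl
    · rw [hb, hl] at hw
      exact absurd hw.symm (h.disjoint_edge j hs)
    · rw [hb, hl] at hw
      exact absurd hw (h.disjoint_edge i ht)
    · rw [hl, hl] at hw
      obtain ⟨rfl, rfl⟩ := h.eq_of_apply_eq ht hs hw
      rfl
  · obtain ⟨c, hc⟩ := h.edge i
    refine ⟨c, ?_⟩
    rw [← hc, ← WedgeCircles.image_loop, image_image]
    exact image_congr fun t _ => hl i t
  · ext x
    rw [h.mem_skelLT_two]
    constructor
    · rintro ⟨w, rfl⟩
      rcases WedgeCircles.eq_base_or_loop w with rfl | ⟨i, t, ht, rfl⟩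
      · exact Or.inl hb
      · exact Or.inr ⟨i, t, ht, (hl i t).symm⟩
    · rintro (rfl | ⟨i, t, ht, rfl⟩)
      · exact ⟨_, hb⟩
      · exact ⟨_, hl i t⟩

/-- A loop can be made into a new edge loop: attach an edge, and a `2`-cell which slides it along
the given loop. -/
theorem exists_append (h : Z.IsEdgeLoops ε) (hZ : Z.DimLE 2) (g : Path z z) :
    ∃ (Z' : FinCW) (f : Z → Z') (hf : Continuous f) (ε' : Option ι → Path (f z) (f z)),
      IsElemExpansion f ∧ Z'.DimLE 2 ∧ Z'.IsEdgeLoops ε' ∧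
      (∀ i, ε' (some i) = (ε i).map hf) ∧ (ε' none).Homotopic (g.map hf) := by
  obtain ⟨v, hv⟩ := h.mem_vertex
  have hz2 : z ∈ Z.skelLT 2 := ⟨0, by omega, v, hv⟩
  -- a `2`-cell may only be attached along the `1`-skeleton
  obtain ⟨w, hws, hgw⟩ := exists_homotopic_skelLT_two hZ hz2 hz2 g
  -- a trivial loop is attached, and then a square with bottom `w`, top this loop, constant sides
  obtain ⟨Y, f₀, φ, e, hY⟩ := Z.exists_attach (m := 1) (fun _ => z) continuousOn_const
    (fun _ _ => ⟨0, by omega, v, hv⟩)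
  let ψ : (Fin 1 → ℝ) → Z := fun u => w.extend ((u 0 + 1) / 2)
  have hψe : ∀ t, ψ (edgeParam t) = w t := by
    intro t
    have : (edgeParam t 0 + 1) / 2 = (t : ℝ) := by
      simp only [edgeParam]
      ring
    simp only [ψ, this, Path.extend_extends']
  have hψs : ∀ u ∈ sphere (0 : Fin 1 → ℝ) 1, z = ψ u := by
    intro u hu
    rcases mem_sphere_fin_one hu with rfl | rfl
    · rw [← edgeParam_one, hψe, w.target]
    · rw [← edgeParam_zero, hψe, w.source]
  obtain ⟨Z', Θ, k, Φ, E, hk, htop, hbot, hside⟩ := exists_cylinder (ψ := ψ)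
    (w.continuous_extend.comp (by fun_prop)).continuousOn (fun u _ => hws _)
    (H := fun _ _ => z) continuousOn_const (fun _ _ _ _ => hz2) hψs (fun _ _ => rfl) hY
  have hf : Continuous (k ∘ f₀) := hk.emb.continuous.comp hY.emb.continuous
  have hother : ∀ x ∈ sphere (0 : Fin 2 → ℝ) 1,
      (¬ ∃ y ∈ ball (0 : Fin 1 → ℝ) 1, x = Fin.cons 1 y) → Φ x ∈ range (k ∘ f₀) := by
    intro x hx hx'
    rw [← Fin.cons_self_tail x] at hx hx' ⊢
    rw [mem_sphere_zero_iff_norm, norm_cons] at hx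
    have h1 : |x 0| ≤ 1 := hx ▸ le_max_left _ _
    have h2 : ‖Fin.tail x‖ ≤ 1 := hx ▸ le_max_right _ _
    rcases h2.lt_or_eq with h3 | h3
    · have h4 : |x 0| = 1 := by
        rcases max_choice |x 0| ‖Fin.tail x‖ with h' | h' <;> rw [h'] at hx
        · exact hx
        · exact absurd hx h3.ne
      rcases eq_or_eq_neg_of_abs_eq h4 with h5 | h5
      · exact absurd ⟨_, mem_ball_zero_iff.2 h3, by rw [h5]⟩ hx'
      · rw [h5, hbot _ (mem_closedBall_zero_iff.2 h2)]
        exact mem_range_self _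
    · rw [hside _ (abs_le.1 h1) _ (mem_sphere_zero_iff_norm.2 h3)]
      exact mem_range_self _
  have hexp : IsElemExpansion (k ∘ f₀) := hY.isElemExpansion hk abs_one htop hother
  have hφc : ContinuousOn (k ∘ φ) (closedBall 0 1) :=
    hk.emb.continuous.comp_continuousOn hY.cont
  have hφs : ∀ u ∈ sphere (0 : Fin 1 → ℝ) 1, (k ∘ φ) u = k (f₀ z) := fun u hu =>
    congrArg k (hY.bd u hu)
  let η : Path (k (f₀ z)) (k (f₀ z)) := edgePath hφc hφs
  obtain ⟨e', he'⟩ := hk.emb.cell 1 e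
  have hη : η '' Ioo 0 1 = Z'.openCell e' := by
    rw [edgePath_image, image_comp, hY.image, he']
  have hηd : Disjoint (η '' Ioo 0 1) (range (k ∘ f₀)) := by
    rw [hη, ← he', range_comp, disjoint_image_iff hk.emb.injective]
    exact hY.disj
  let ε' : Option ι → Path (k (f₀ z)) (k (f₀ z)) := fun i => i.elim η fun i => (ε i).map hf
  have hsome : ∀ i, ε' (some i) '' Ioo 0 1 = (k ∘ f₀) '' (ε i '' Ioo 0 1) := fun i => by
    rw [image_image]
    rfl
  have hne : ∀ i, η '' Ioo 0 1 ≠ ε' (some i) '' Ioo 0 1 := by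
    intro i hi
    rw [hi, hsome] at hηd
    obtain ⟨c, hc⟩ := h.edge i
    obtain ⟨x, hx⟩ := Z.openCell_nonempty c
    rw [hc] at hηd
    exact Set.disjoint_left.1 hηd (mem_image_of_mem _ hx) (mem_range_self _)
  refine ⟨Z', k ∘ f₀, hf, ε', hexp, hk.dimLE (hY.dimLE hZ (by omega)) le_rfl,
    ⟨fun v' => ?_, ?_, ?_, ?_, fun c => ?_⟩, fun _ => rfl, ?_⟩
  · rcases hk.cell_cases v' with ⟨i, hi⟩ | hi
    · rcases hY.cell_cases i with ⟨j, hj⟩ | hj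
      · rw [← hi, ← hj, h.vertex j, image_singleton, image_singleton]
        rfl
      · cases hj
    · cases hi
  · rintro (_ | i)
    · exact edgePath_injOn hφc hφs (hk.emb.injective.comp_injOn hY.inj)
    · exact (hexp.1.injective.comp_injOn (h.injOn i))
  · rintro (_ | i)
    · exact ⟨e', hη⟩
    · obtain ⟨c, hc⟩ := h.edge i
      obtain ⟨c', hc'⟩ := hexp.1.cell 1 c
      exact ⟨c', by rw [hsome, hc, hc']⟩
  · rintro (_ | i) (_ | j) hij
    · rfl
    · exact absurd hij (hne j)
    · exact absurd hij.symm (hne i)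
    · rw [hsome, hsome] at hij
      rw [h.inj i j (hexp.1.injective.image_injective hij)]
  · rcases hk.cell_cases c with ⟨i, hi⟩ | hi
    · rcases hY.cell_cases i with ⟨j, hj⟩ | hj
      · obtain ⟨i', hi'⟩ := h.surj j
        exact ⟨some i', by rw [hsome, hi', ← hi, ← hj, image_comp]⟩
      · cases hj
        exact ⟨none, hη.trans (he'.symm.trans hi)⟩
    · cases hi
  · refine Path.Homotopic.trans ?_ (hgw.symm.map ⟨_, hf⟩)
    -- the new `2`-cell is a homotopy from the new edge to `w`
    let side : ∀ u : Fin 1 → ℝ, Path (Fin.cons (-1) u : Fin 2 → ℝ) (Fin.cons 1 u) := fun u =>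
      ⟨⟨fun t => Fin.cons (edgeParam t 0) u, by
        unfold edgeParam
        fun_prop⟩, by simp [edgeParam_zero], by simp [edgeParam_one]⟩
    let face : ∀ s : ℝ, Path (Fin.cons s (edgeParam 0) : Fin 2 → ℝ) (Fin.cons s (edgeParam 1)) :=
      fun s => ⟨⟨fun t => Fin.cons s (edgeParam t), by
        unfold edgeParam
        fun_prop⟩, rfl, rfl⟩
    have hmem : ∀ s, |s| ≤ 1 → ∀ u ∈ closedBall (0 : Fin 1 → ℝ) 1,
        (Fin.cons s u : Fin 2 → ℝ) ∈ closedBall (0 : Fin 2 → ℝ) 1 := fun s hs u hu => by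
      rw [mem_closedBall_zero_iff, norm_cons]
      exact max_le hs (mem_closedBall_zero_iff.1 hu)
    have habs : ∀ t, |edgeParam t 0| ≤ 1 := fun t =>
      (norm_le_pi_norm (edgeParam t) 0).trans (mem_closedBall_zero_iff.1 (edgeParam_mem t))
    have hΦs : ∀ t, ∀ u ∈ sphere (0 : Fin 1 → ℝ) 1, Φ (Fin.cons (edgeParam t 0) u) = k (f₀ z) :=
      fun t => hside _ (abs_le.1 (habs t))
    -- both paths run in the square from one end of the bottom to the other
    have hhom : ((Path.refl _).trans (η.trans (Path.refl _))).Homotopic (w.map hf) := by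
      refine Path.homotopic_of_convex (convex_closedBall _ _) hk.cont
        (δ := (side _).trans ((face 1).trans (side _).symm)) (δ' := face (-1))
        (fun t => ?_) (fun t => hmem _ (by simp) _ (edgeParam_mem t)) (fun t => ?_) fun t => ?_
      · rw [Path.trans_apply]
        split_ifs
        · exact hmem _ (habs _) _ (edgeParam_mem 0)
        · rw [Path.trans_apply]
          split_ifs
          · exact hmem _ (by simp) _ (edgeParam_mem _)
          · exact hmem _ (habs _) _ (edgeParam_mem 1)
      · rw [Path.trans_apply, Path.trans_apply]
        split_ifs
        · exact (hΦs _ _ edgeParam_zero_mem).symm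
        · rw [Path.trans_apply, Path.trans_apply]
          split_ifs
          · exact (htop _ (edgeParam_mem _)).symm
          · exact (hΦs _ _ edgeParam_one_mem).symm
      · change k (f₀ (w t)) = Φ (Fin.cons (-1) (edgeParam t))
        rw [hbot _ (edgeParam_mem t), hψe]
    refine Path.Homotopic.trans ?_ hhom
    exact (Path.Homotopic.trans ⟨Path.Homotopy.reflTrans _⟩ ⟨Path.Homotopy.transRefl η⟩).symm

end IsEdgeLoops

theorem _root_.ContinuousMap.HomotopyEquiv.bijective_map {X Y : Type} [TopologicalSpace X]
    [TopologicalSpace Y] (E : ContinuousMap.HomotopyEquiv X Y) (x : X) :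
    Function.Bijective (FundamentalGroup.map E.toFun x) := by
  let F := (FundamentalGroupoidFunctor.equivOfHomotopyEquiv E).functor
  exact ⟨fun a b h => F.map_injective h, fun b => F.map_surjective b⟩

theorem IsElemExpansion.bijective_map {X Y : FinCW} {f : X → Y} (h : IsElemExpansion f)
    (hf : Continuous f) (x : X) : Function.Bijective (FundamentalGroup.map ⟨f, hf⟩ x) := by
  obtain ⟨E, hE⟩ := h.homotopyEquiv
  have hEf : E.toFun = ⟨f, hf⟩ := ContinuousMap.ext hE
  exact hEf ▸ E.bijective_map x

/-- The family `t` of elements of the fundamental group is realized by the edge loops of some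
`2`-complex with one vertex in the `3`-deformation class of `X`. -/
def Realizable (X : FinCW) (x : X) {ι : Type} (t : ι → FundamentalGroup X x) : Prop :=
  ∃ (Z : FinCW) (z : Z) (ε : ι → Path z z), Z.IsEdgeLoops ε ∧ Z.DimLE 2 ∧ Deform 3 X Z ∧
    ∃ ψ : FundamentalGroup X x ≃* FundamentalGroup Z z, ∀ i, ψ (t i) = (ε i).cls

namespace Realizable

variable {X : FinCW} {x : X} {ι : Type} {t : ι → FundamentalGroup X x}

theorem comp_equiv (h : X.Realizable x t) {κ : Type} (e : κ ≃ ι) : X.Realizable x (t ∘ e) := by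
  obtain ⟨Z, z, ε, hε, hZ, hd, ψ, hψ⟩ := h
  exact ⟨Z, z, ε ∘ e, hε.comp_equiv e, hZ, hd, ψ, fun i => hψ _⟩

/-- One more element can be realized. -/
theorem option (h : X.Realizable x t) (g : FundamentalGroup X x) :
    X.Realizable x fun i : Option ι => i.elim g t := by
  obtain ⟨Z, z, ε, hε, hZ, hd, ψ, hψ⟩ := h
  obtain ⟨p, hp⟩ := Path.Homotopic.Quotient.mk_surjective (ψ g)
  obtain ⟨Z', f, hf, ε', hexp, hZ', hε', hsome, hnone⟩ := hε.exists_append hZ p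
  refine ⟨Z', f z, ε', hε', hZ', .trans _ _ _ hd (.rel _ _ ⟨hZ.mono (by omega),
    hZ'.mono (by omega), f, Or.inr hexp⟩), ψ.trans (MulEquiv.ofBijective _
      (hexp.bijective_map hf z)), ?_⟩
  rintro (_ | i)
  · change FundamentalGroup.map _ z (ψ g) = _
    rw [← hp]
    exact Path.cls_eq_iff.2 hnone.symm
  · change FundamentalGroup.map _ z (ψ (t i)) = _
    rw [hψ, hsome]
    rfl

/-- Finitely many more elements can be realized. -/
theorem sum (h : X.Realizable x t) {κ : Type} [Finite κ] (s : κ → FundamentalGroup X x) :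
    X.Realizable x (Sum.elim t s) := by
  revert s
  refine Finite.induction_empty_option (P := fun κ => ∀ s : κ → FundamentalGroup X x,
    X.Realizable x (Sum.elim t s)) ?_ ?_ ?_ κ
  · intro α β e ih s
    convert (ih (s ∘ e)).comp_equiv (Equiv.sumCongr (Equiv.refl ι) e.symm) using 1
    ext (i | j) <;> simp
  · intro s
    convert h.comp_equiv (Equiv.sumEmpty ι PEmpty) using 1
    ext (i | j)
    · rfl
    · exact j.elim
  · intro α _ ih s
    let e : ι ⊕ Option α ≃ Option (ι ⊕ α) :=
      { toFun := Sum.elim (fun i => some (.inl i)) fun j => j.map .inr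
        invFun := fun o => o.elim (.inr none) (Sum.map id some)
        left_inv := by rintro (i | _ | j) <;> rfl
        right_inv := by rintro (_ | i | j) <;> rfl }
    convert ((ih (s ∘ some)).option (s none)).comp_equiv e using 1
    ext (i | _ | j) <;> rfl

end Realizable

/-- Some finite family is realized: the edge loops after a deformation to one vertex. -/
theorem exists_realizable (X : FinCW) (hX : X.DimLE 2) [ConnectedSpace X] (x : X) :
    ∃ (ι : Type) (_ : Finite ι) (t : ι → FundamentalGroup X x), X.Realizable x t := by
  obtain ⟨Y, hY1, hY2, hd⟩ := X.exists_oneVertex hX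
  obtain ⟨E⟩ := hd.homotopyEquiv
  have := hY1.pathConnectedSpace
  obtain ⟨z, ε, hε⟩ := hY1.exists_isEdgeLoops
  let ψ : FundamentalGroup X x ≃* FundamentalGroup Y z :=
    (MulEquiv.ofBijective _ (E.bijective_map x)).trans
      (FundamentalGroup.fundamentalGroupMulEquivOfPathConnected _ _)
  exact ⟨Y.Cell 1, inferInstance, fun i => ψ.symm (ε i).cls, Y, z, ε, hε, hY2, hd, ψ,
    fun i => ψ.apply_symm_apply _⟩

end FinCW

/-! ### Loops on the boundary of the square -/

section SphereLoop

open unitInterval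

/-- The vector of angle `a` in the plane. -/
noncomputable def angleVec (a : ℝ) : Fin 2 → ℝ := ![Real.cos a, Real.sin a]

theorem continuous_angleVec : Continuous angleVec := by
  refine continuous_pi fun i => ?_
  fin_cases i
  · exact Real.continuous_cos
  · exact Real.continuous_sin

theorem angleVec_ne_zero (a : ℝ) : angleVec a ≠ 0 := by
  intro h
  have h0 : Real.cos a = 0 := congrFun h 0
  have h1 : Real.sin a = 0 := congrFun h 1
  have := Real.sin_sq_add_cos_sq a
  rw [h0, h1] at this
  norm_num at this

/-- A loop running once around the boundary of the square, starting at the angle `-π`. -/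
noncomputable def sphereLoop (t : I) : Fin 2 → ℝ :=
  ‖angleVec (2 * Real.pi * t - Real.pi)‖⁻¹ • angleVec (2 * Real.pi * t - Real.pi)

theorem continuous_sphereLoop : Continuous sphereLoop := by
  have h : Continuous fun t : I => angleVec (2 * Real.pi * t - Real.pi) :=
    continuous_angleVec.comp (by fun_prop)
  exact (h.norm.inv₀ fun t => norm_ne_zero_iff.2 (angleVec_ne_zero _)).smul h

theorem sphereLoop_mem (t : I) : sphereLoop t ∈ sphere (0 : Fin 2 → ℝ) 1 := by
  rw [mem_sphere_zero_iff_norm, sphereLoop, norm_smul, norm_inv, norm_norm,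
    inv_mul_cancel₀ (norm_ne_zero_iff.2 (angleVec_ne_zero _))]

theorem sphereLoop_zero : sphereLoop 0 = sphereLoop 1 := by
  have h : angleVec (2 * Real.pi * 0 - Real.pi) = angleVec (2 * Real.pi * 1 - Real.pi) := by
    have : 2 * Real.pi * 1 - Real.pi = (2 * Real.pi * 0 - Real.pi) + 2 * Real.pi := by ring
    rw [this, angleVec, angleVec, Real.cos_add_two_pi, Real.sin_add_two_pi]
  simp only [sphereLoop, Set.Icc.coe_zero, Set.Icc.coe_one, h]

theorem eq_of_smul_angleVec {r s a b : ℝ} (hr : 0 < r) (hs : 0 < s)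
    (h : r • angleVec a = s • angleVec b) : Circle.exp a = Circle.exp b := by
  have h0 : r * Real.cos a = s * Real.cos b := congrFun h 0
  have h1 : r * Real.sin a = s * Real.sin b := congrFun h 1
  have h2 : r ^ 2 = s ^ 2 := by
    have ha := Real.sin_sq_add_cos_sq a
    have hb := Real.sin_sq_add_cos_sq b
    calc r ^ 2 = (r * Real.sin a) ^ 2 + (r * Real.cos a) ^ 2 := by
          rw [mul_pow, mul_pow, ← mul_add, ha, mul_one]
      _ = s ^ 2 := by rw [h0, h1, mul_pow, mul_pow, ← mul_add, hb, mul_one]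
  have h3 : r = s := (pow_left_inj₀ hr.le hs.le two_ne_zero).1 h2
  subst h3
  have h4 := mul_left_cancel₀ hr.ne' h0
  have h5 := mul_left_cancel₀ hr.ne' h1
  refine Circle.ext ?_
  rw [Circle.coe_exp, Circle.coe_exp, Complex.exp_mul_I, Complex.exp_mul_I, ← Complex.ofReal_cos,
    ← Complex.ofReal_sin, ← Complex.ofReal_cos, ← Complex.ofReal_sin, h4, h5]

theorem sphereLoop_injOn : InjOn sphereLoop (Ioc 0 1) := by
  intro t ht s hs h
  have hpi := Real.pi_pos
  have ht0 : (0 : ℝ) < t := ht.1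
  have hs0 : (0 : ℝ) < s := hs.1
  have h1 := eq_of_smul_angleVec (inv_pos.2 (norm_pos_iff.2 (angleVec_ne_zero _)))
    (inv_pos.2 (norm_pos_iff.2 (angleVec_ne_zero _))) h
  have h2 := Circle.exp_injOn_Ioc (a := -Real.pi) (b := Real.pi) (by linarith)
    ⟨by nlinarith, by nlinarith [t.2.2]⟩ ⟨by nlinarith, by nlinarith [s.2.2]⟩ h1
  refine Subtype.ext (mul_left_cancel₀ (mul_pos two_pos hpi).ne' ?_)
  linarith

theorem exists_sphereLoop_eq {u : Fin 2 → ℝ} (hu : u ∈ sphere (0 : Fin 2 → ℝ) 1) :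
    ∃ t ∈ Ioc (0 : I) 1, sphereLoop t = u := by
  have hpi := Real.pi_pos
  let z : ℂ := ⟨u 0, u 1⟩
  have hz : z ≠ 0 := by
    intro h
    have h0 : u = 0 := by
      ext i
      fin_cases i
      · exact congrArg Complex.re h
      · exact congrArg Complex.im h
    rw [h0, mem_sphere_zero_iff_norm, norm_zero] at hu
    exact zero_ne_one hu
  have hvec : u = ‖z‖ • angleVec z.arg := by
    ext i
    fin_cases i
    · exact (Complex.norm_mul_cos_arg z).symm
    · exact (Complex.norm_mul_sin_arg z).symm
  have hzn : 0 < ‖z‖ := norm_pos_iff.2 hz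
  have h1 := Complex.neg_pi_lt_arg z
  have h2 := Complex.arg_le_pi z
  have h3 : 0 < (z.arg + Real.pi) / (2 * Real.pi) := by
    apply div_pos <;> linarith
  have h4 : (z.arg + Real.pi) / (2 * Real.pi) ≤ 1 := by
    rw [div_le_one (by linarith)]
    linarith
  refine ⟨⟨_, h3.le, h4⟩, ⟨h3, h4⟩, ?_⟩
  have h5 : 2 * Real.pi * ((z.arg + Real.pi) / (2 * Real.pi)) - Real.pi = z.arg := by
    field_simp
    ring
  rw [sphereLoop]
  simp only [h5]
  have h6 : ‖z‖ * ‖angleVec z.arg‖ = 1 := by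
    rw [mem_sphere_zero_iff_norm, hvec, norm_smul, norm_norm] at hu
    exact hu
  rw [hvec, ← eq_inv_of_mul_eq_one_left h6]

variable {Y : Type*} [TopologicalSpace Y]

/-- The restriction of a map on the boundary of the square to the loop around it. -/
noncomputable def boundaryPath {q : (Fin 2 → ℝ) → Y} (hq : ContinuousOn q (sphere 0 1)) :
    Path (q (sphereLoop 1)) (q (sphereLoop 1)) where
  toFun t := q (sphereLoop t)
  continuous_toFun := hq.comp_continuous continuous_sphereLoop sphereLoop_mem
  source' := congrArg q sphereLoop_zero
  target' := rfl

/-- A map on the boundary of the square which extends to the square gives a null-homotopic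
loop. -/
theorem homotopic_refl_of_square {φ : (Fin 2 → ℝ) → Y} (hφ : ContinuousOn φ (closedBall 0 1))
    {y : Y} {p : Path y y} (hp : ∀ t, p t = φ (sphereLoop t)) : p.Homotopic (Path.refl y) :=
  Path.homotopic_of_convex (convex_closedBall _ _) hφ (u := sphereLoop 1) (w := sphereLoop 1)
    (δ := ⟨⟨sphereLoop, continuous_sphereLoop⟩, sphereLoop_zero, rfl⟩) (δ' := Path.refl _)
    (fun t => sphere_subset_closedBall (sphereLoop_mem t))
    (fun _ => sphere_subset_closedBall (sphereLoop_mem 1)) hp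
    (fun _ => by rw [Path.refl_apply, Path.refl_apply, ← hp 1, p.target])

/-- A map on the boundary of the square which gives a null-homotopic loop is homotopic to a
constant map. -/
theorem exists_homotopy_of_boundaryPath {q : (Fin 2 → ℝ) → Y} (hq : ContinuousOn q (sphere 0 1))
    (h : (boundaryPath hq).Homotopic (Path.refl _)) :
    ∃ H : (Fin 2 → ℝ) × I → Y, ContinuousOn H (sphere 0 1 ×ˢ univ) ∧
      (∀ u ∈ sphere (0 : Fin 2 → ℝ) 1, H (u, 0) = q u) ∧
      ∀ u ∈ sphere (0 : Fin 2 → ℝ) 1, H (u, 1) = q (sphereLoop 1) := by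
  obtain ⟨F⟩ := h
  -- a section of the parametrization of the boundary; only the ends of the interval are identified
  choose! T hT hTu using fun u (hu : u ∈ sphere (0 : Fin 2 → ℝ) 1) => exists_sphereLoop_eq hu
  let H : (Fin 2 → ℝ) × I → Y := fun p => F (p.2, T p.1)
  have hH : ∀ t s, H (sphereLoop t, s) = F (s, t) := by
    intro t s
    rcases eq_or_ne t 0 with rfl | ht
    · have h1 : T (sphereLoop 0) = 1 := by
        rw [sphereLoop_zero]
        exact sphereLoop_injOn (hT _ (sphereLoop_mem 1)) ⟨zero_lt_one, le_rfl⟩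
          (hTu _ (sphereLoop_mem 1))
      change F (s, T (sphereLoop 0)) = _
      rw [h1, F.source, F.target]
    · change F (s, T (sphereLoop t)) = _
      rw [sphereLoop_injOn (hT _ (sphereLoop_mem t)) ⟨unitInterval.pos_iff_ne_zero.2 ht, t.2.2⟩
        (hTu _ (sphereLoop_mem t))]
  refine ⟨H, ?_, fun u hu => ?_, fun u hu => ?_⟩
  · let b : I × I → sphere (0 : Fin 2 → ℝ) 1 × I := fun p => (⟨_, sphereLoop_mem p.1⟩, p.2)
    have hb : Continuous b := by
      refine Continuous.prodMk (Continuous.subtype_mk ?_ _) continuous_snd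
      exact continuous_sphereLoop.comp continuous_fst
    have hbs : ∀ x, ∃ p, b p = x := by
      rintro ⟨⟨u, hu⟩, s⟩
      exact ⟨(T u, s), Prod.ext (Subtype.ext (hTu u hu)) rfl⟩
    have hc : Continuous fun x : sphere (0 : Fin 2 → ℝ) 1 × I => H (x.1, x.2) := by
      have hcb : Continuous ((fun x : sphere (0 : Fin 2 → ℝ) 1 × I => H (x.1, x.2)) ∘ b) := by
        have : ((fun x : sphere (0 : Fin 2 → ℝ) 1 × I => H (x.1, x.2)) ∘ b) =
            fun p => F (p.2, p.1) := funext fun p => hH p.1 p.2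
        rw [this]
        exact F.continuous.comp (by fun_prop)
      exact continuous_of_compact_cover hb hb (fun x => Or.inl (hbs x)) hcb hcb
    rw [continuousOn_iff_continuous_domRestrict]
    exact hc.comp (f := fun x : (sphere (0 : Fin 2 → ℝ) 1 ×ˢ univ : Set _) =>
      ((⟨x.1.1, x.2.1⟩ : sphere (0 : Fin 2 → ℝ) 1), x.1.2)) (by fun_prop)
  · change F (0, T u) = _
    rw [F.apply_zero]
    exact congrArg q (hTu u hu)
  · change F (1, T u) = _
    rw [F.apply_one]
    rfl

end SphereLoop

/-! ### Wedges of circles with the same kernel on fundamental groups -/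

namespace WedgeCircles

open CategoryTheory unitInterval

variable {n : ℕ}

theorem joined_base (w : WedgeCircles n) : Joined (base n) w := by
  rcases eq_base_or_loop w with rfl | ⟨i, t, -, rfl⟩
  · exact Joined.refl _
  · exact ⟨((loop i).subpath 0 t).cast (loop i).source.symm rfl⟩

theorem map_conj {X Y : Type*} [TopologicalSpace X] [TopologicalSpace Y] (f : C(X, Y)) {a b : X}
    (α : Path a b) (p : Path b b) :
    FundamentalGroup.map f a (α.trans (p.trans α.symm)).cls =
      (α.map f.continuous).cls ≫ (p.map f.continuous).cls ≫
        CategoryTheory.inv (α.map f.continuous).cls := by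
  rw [← Path.cls_symm, ← Path.cls_trans, ← Path.cls_trans, Path.map_symm, ← Path.map_trans,
    ← Path.map_trans]
  rfl

/-- Two maps from a wedge of circles which agree on the generators up to an isomorphism of
fundamental groups kill the same loops. -/
theorem homotopic_refl_of_mulEquiv {Y₁ Y₂ : Type*} [TopologicalSpace Y₁] [TopologicalSpace Y₂]
    {f₁ : C(WedgeCircles n, Y₁)} {f₂ : C(WedgeCircles n, Y₂)}
    (θ : FundamentalGroup Y₁ (f₁ (base n)) ≃* FundamentalGroup Y₂ (f₂ (base n)))
    (hθ : ∀ i, θ ((loop i).map f₁.continuous).cls = ((loop i).map f₂.continuous).cls)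
    {w : WedgeCircles n} {p : Path w w}
    (hp : (p.map f₁.continuous).Homotopic (Path.refl _)) :
    (p.map f₂.continuous).Homotopic (Path.refl _) := by
  -- conjugate `p` to a loop at the base point
  obtain ⟨α⟩ := joined_base w
  have h := hom_ext (f := θ.toMonoidHom.comp (FundamentalGroup.map f₁ (base n)))
    (g := FundamentalGroup.map f₂ (base n)) hθ
  have h1 : θ (FundamentalGroup.map f₁ (base n) (α.trans (p.trans α.symm)).cls) =
      FundamentalGroup.map f₂ (base n) (α.trans (p.trans α.symm)).cls :=
    DFunLike.congr_fun h (α.trans (p.trans α.symm)).cls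
  have h2 : FundamentalGroup.map f₁ (base n) (α.trans (p.trans α.symm)).cls = 1 := by
    rw [map_conj, Path.cls_eq_iff.2 hp, Path.cls_refl, Category.id_comp, IsIso.hom_inv_id]
    rfl
  rw [h2, map_one, map_conj] at h1
  rw [← Path.cls_eq_iff, Path.cls_refl]
  have h3 : (α.map f₂.continuous).cls ≫ (p.map f₂.continuous).cls ≫
      CategoryTheory.inv (α.map f₂.continuous).cls = 𝟙 _ := h1.symm
  rw [← Category.assoc, IsIso.comp_inv_eq, Category.id_comp] at h3
  exact (cancel_epi (α.map f₂.continuous).cls).1 (h3.trans (Category.comp_id _).symm)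

end WedgeCircles

/-! ### Cells attached along null-homotopic maps -/

namespace FinCW

open unitInterval

/-- The cells outside of the image of `f`. -/
def extraCells {A X : FinCW} (f : A → X) : Set (Σ m, X.Cell m) :=
  {p | Disjoint (X.openCell p.2) (range f)}

/-- All cells of `X` outside of the image of `f` are `2`-cells, attached along maps to `f(A)` which
are null-homotopic in `A`. -/
def HasNullCells {A X : FinCW} (f : A → X) : Prop :=
  ∀ p ∈ extraCells f, ∃ e : X.Cell 2, (⟨2, e⟩ : Σ m, X.Cell m) = p ∧
    ∃ (φ : (Fin 2 → ℝ) → X) (H : (Fin 2 → ℝ) × I → A) (c : A),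
      ContinuousOn φ (closedBall 0 1) ∧ InjOn φ (ball 0 1) ∧ φ '' ball 0 1 = X.openCell e ∧
      ContinuousOn H (sphere 0 1 ×ˢ univ) ∧ c ∈ A.skelLT 2 ∧
      ∀ u ∈ sphere (0 : Fin 2 → ℝ) 1, φ u = f (H (u, 0)) ∧ H (u, 1) = c

theorem IsCellEmbedding.range_or {A X : FinCW} {f : A → X} (hf : IsCellEmbedding f) {m : ℕ}
    (e : X.Cell m) : (∃ i : A.Cell m, f '' A.openCell i = X.openCell e) ∨
      Disjoint (X.openCell e) (range f) := by
  by_cases h : Disjoint (X.openCell e) (range f)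
  · exact Or.inr h
  · obtain ⟨x, hx, a, rfl⟩ := Set.not_disjoint_iff.1 h
    obtain ⟨i, -, hi⟩ := hf.exists_cell hx
    exact Or.inl ⟨i, hi⟩

theorem HasNullCells.dimLE {A X : FinCW} {f : A → X} (hf : IsCellEmbedding f)
    (h : HasNullCells f) (hA : A.DimLE 2) : X.DimLE 2 := by
  refine fun m hm => ⟨fun e => ?_⟩
  rcases hf.range_or e with ⟨i, -⟩ | he
  · exact (hA m hm).false i
  · obtain ⟨e', he', -⟩ := h ⟨m, e⟩ he
    cases he'
    omega

theorem isSub_compl {X : FinCW} {m : ℕ} (hX : X.DimLE m) (e : X.Cell m) :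
    X.IsSub (X.openCell e)ᶜ := by
  refine ⟨(hX.isCellAttachment.isOpen_cell e).isClosed_compl, fun k i => ?_⟩
  by_cases h : Disjoint (X.openCell i) (X.openCell e)
  · exact Or.inl (disjoint_left.1 h)
  · obtain ⟨x, hx, hx'⟩ := Set.not_disjoint_iff.1 h
    cases cell_unique hx hx'
    exact Or.inr disjoint_compl_right

/-- Removing one of the extra cells. -/
theorem HasNullCells.exists_remove {A X : FinCW} [Nonempty A] {f : A → X} (hf : IsCellEmbedding f)
    (h : HasNullCells f) (hA : A.DimLE 2) (hne : (extraCells f).Nonempty) :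
    ∃ (S : FinCW) (f₁ : A → S) (g : S → X) (φ : (Fin 2 → ℝ) → X) (e : X.Cell 2)
      (H : (Fin 2 → ℝ) × I → A) (c : A), IsCellEmbedding f₁ ∧ (∀ a, g (f₁ a) = f a) ∧
      HasNullCells f₁ ∧ (extraCells f₁).ncard + 1 = (extraCells f).ncard ∧
      IsAttach (fun u => f₁ (H (u, 0))) g φ e ∧ ContinuousOn H (sphere 0 1 ×ˢ univ) ∧
      c ∈ A.skelLT 2 ∧ ∀ u ∈ sphere (0 : Fin 2 → ℝ) 1, H (u, 1) = c := by
  have hX := h.dimLE hf hA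
  obtain ⟨p, hp⟩ := hne
  obtain ⟨e, rfl, φ, H, c, hφ, hinj, him, hH, hc, hu⟩ := h p hp
  have hS := isSub_compl hX e
  have hfS : range f ⊆ (X.openCell e)ᶜ := disjoint_left.1 (disjoint_comm.1 hp)
  obtain ⟨f₁, hf₁, hff⟩ := hf.exists_factor hS hfS
  have hg := X.isCellEmbedding_incl _ hS
  have hrange : X.incl _ hS '' range f₁ = range f := by
    rw [← range_comp]
    exact congrArg range (funext hff)
  have : Nonempty (X.sub _ hS) := ⟨f₁ (Classical.arbitrary A)⟩
  -- the cells of the subcomplex, as cells of `X`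
  let τ : (Σ m, (X.sub _ hS).Cell m) → Σ m, X.Cell m := fun q =>
    ⟨q.1, Subtype.val (p := fun i : X.Cell q.1 => X.openCell i ⊆ (X.openCell e)ᶜ) q.2⟩
  have hτi : Function.Injective τ := by
    rintro ⟨m, i, hi⟩ ⟨k, j, hj⟩ hij
    cases hij
    rfl
  have hτo : ∀ q, X.incl _ hS '' (X.sub _ hS).openCell q.2 = X.openCell (τ q).2 := fun q =>
    X.incl_image_openCell _ hS q.2
  have hτ : ∀ q, q ∈ extraCells f₁ ↔ τ q ∈ extraCells f := by
    intro q
    change Disjoint _ _ ↔ Disjoint _ _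
    rw [← hτo, ← hrange, disjoint_image_iff hg.injective]
  have hτr : ∀ q, τ q ≠ ⟨2, e⟩ := by
    rintro ⟨m, i, hi⟩ hq
    have h1 : X.openCell i = X.openCell e :=
      congrArg (fun q : Σ m, X.Cell m => X.openCell q.2) hq
    obtain ⟨x, hx⟩ := X.openCell_nonempty i
    exact hi hx (h1 ▸ hx)
  have himage : τ '' extraCells f₁ = extraCells f \ {⟨2, e⟩} := by
    ext q
    constructor
    · rintro ⟨q, hq, rfl⟩
      exact ⟨(hτ q).1 hq, hτr q⟩
    · rintro ⟨hq, hqe⟩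
      have hsub : X.openCell q.2 ⊆ (X.openCell e)ᶜ := by
        intro x hx hxe
        exact hqe (cell_unique hx hxe)
      exact ⟨⟨q.1, (⟨q.2, hsub⟩ : {i : X.Cell q.1 // X.openCell i ⊆ (X.openCell e)ᶜ})⟩,
        (hτ _).2 hq, rfl⟩
  refine ⟨X.sub _ hS, f₁, X.incl _ hS, φ, e, H, c, hf₁, hff, fun q hq => ?_, ?_, ?_, hH, hc,
    fun u hu' => (hu u hu').2⟩
  · obtain ⟨e₁, he₁, φ₁, H₁, c₁, hφ₁, hinj₁, him₁, hH₁, hc₁, hu₁⟩ := h _ ((hτ q).1 hq)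
    obtain ⟨m, i⟩ := q
    obtain rfl : 2 = m := congrArg Sigma.fst he₁
    have hmem : ∀ u ∈ closedBall (0 : Fin 2 → ℝ) 1, φ₁ u ∈ range (X.incl _ hS) := by
      intro u hu'
      rw [range_incl]
      rcases (mem_closedBall_zero_iff.1 hu').lt_or_eq with h' | h'
      · have h1 : φ₁ u ∈ X.openCell e₁ := him₁ ▸ mem_image_of_mem _ (mem_ball_zero_iff.2 h')
        intro h2
        exact hτr ⟨2, i⟩ (he₁.symm.trans (cell_unique h1 h2))
      · rw [(hu₁ u (mem_sphere_zero_iff_norm.2 h')).1]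
        exact hfS (mem_range_self _)
    -- the characteristic map of another extra cell factors through the subcomplex
    let φ' : (Fin 2 → ℝ) → X.sub _ hS := fun u => Function.invFun (X.incl _ hS) (φ₁ u)
    have hφ' : ∀ u ∈ closedBall (0 : Fin 2 → ℝ) 1, X.incl _ hS (φ' u) = φ₁ u := fun u hu' =>
      Function.invFun_eq (hmem u hu')
    refine ⟨i, rfl, φ', H₁, c₁, ?_, ?_, ?_, hH₁, hc₁, fun u hu' => ⟨?_, (hu₁ u hu').2⟩⟩
    · rw [hg.isClosedEmbedding.isInducing.continuousOn_iff]
      exact hφ₁.congr hφ'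
    · intro u hu' v hv huv
      refine hinj₁ hu' hv ?_
      rw [← hφ' u (ball_subset_closedBall hu'), ← hφ' v (ball_subset_closedBall hv), huv]
    · apply hg.injective.image_injective
      rw [image_image, image_congr fun u hu' => hφ' u (ball_subset_closedBall hu'), him₁,
        hτo ⟨2, i⟩]
      exact congrArg (fun q : Σ m, X.Cell m => X.openCell q.2) he₁
    · apply hg.injective
      rw [hφ' u (sphere_subset_closedBall hu'), hff, (hu₁ u hu').1]
  · rw [← ncard_image_of_injective _ hτi, himage]
    exact ncard_sdiff_singleton_add_one hp (toFinite _)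
  · refine ⟨hg, hφ, hinj, him, ?_, ?_, fun u hu' => ?_⟩
    · rw [range_incl]
      exact disjoint_compl_right
    · rw [range_incl, compl_union_self]
    · rw [(hu u hu').1, hff]

/-- Relative to `A`, a complex obtained from `A` by attaching `2`-cells along null-homotopic maps
depends only on the number of these cells: slide them to constant attaching maps. -/
theorem HasNullCells.relDeform {A X X' : FinCW} [PathConnectedSpace A] (hA : A.DimLE 2)
    {f : A → X} (hf : IsCellEmbedding f) (h : HasNullCells f) {f' : A → X'}
    (hf' : IsCellEmbedding f') (h' : HasNullCells f')
    (hN : (extraCells f).ncard = (extraCells f').ncard) : RelDeform 3 ⟨X, f⟩ ⟨X', f'⟩ := by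
  generalize hn : (extraCells f).ncard = N
  induction N generalizing X X' with
  | zero =>
    have key : ∀ {Y : FinCW} {g : A → Y}, IsCellEmbedding g → (extraCells g).ncard = 0 →
        RelDeform 3 ⟨A, id⟩ ⟨Y, g⟩ := by
      intro Y g hg h0
      rw [ncard_eq_zero (toFinite _)] at h0
      refine IsCellIso.relDeform (f := g) ⟨hg, fun y => ?_⟩ (hA.mono (by omega)) fun _ => rfl
      obtain ⟨m, e, he⟩ := Y.exists_mem_openCell y
      rcases hg.range_or e with ⟨i, hi⟩ | hd
      · rw [← hi] at he
        obtain ⟨x, -, hx⟩ := he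
        exact ⟨x, hx⟩
      · exact absurd (show (⟨m, e⟩ : Σ m, Y.Cell m) ∈ extraCells g from hd) (h0 ▸ notMem_empty _)
    exact .trans _ _ _ (.symm _ _ (key hf hn)) (key hf' (hN ▸ hn))
  | succ N ih =>
    have hne : (extraCells f).Nonempty := nonempty_of_ncard_ne_zero (by omega)
    have hne' : (extraCells f').Nonempty := nonempty_of_ncard_ne_zero (by omega)
    obtain ⟨S, f₁, g, φ, e, H, c, hf₁, hgf, hn₁, hcard, hatt, hH, hc, hH1⟩ :=
      h.exists_remove hf hA hne
    obtain ⟨S', f₁', g', φ', e', H', c', hf₁', hgf', hn₁', hcard', hatt', hH', hc', hH1'⟩ :=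
      h'.exists_remove hf' hA hne'
    have hS := (hn₁.dimLE hf₁ hA)
    have hS' := (hn₁'.dimLE hf₁' hA)
    have hrel := ih hf₁ hn₁ hf₁' hn₁' (by omega) (by omega)
    -- slide an attaching map to a constant
    have slide : ∀ {T Z : FinCW} {k : A → T} {j : T → Z} {ψ : (Fin 2 → ℝ) → Z} {d : Z.Cell 2}
        {K : (Fin 2 → ℝ) × I → A} {b : A}, T.DimLE 2 → IsCellEmbedding k →
        IsAttach (fun u => k (K (u, 0))) j ψ d → ContinuousOn K (sphere 0 1 ×ˢ univ) →
        b ∈ A.skelLT 2 → (∀ u ∈ sphere (0 : Fin 2 → ℝ) 1, K (u, 1) = b) →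
        ∃ (Y : FinCW) (i : T → Y) (χ : (Fin 2 → ℝ) → Y) (d' : Y.Cell 2),
          IsAttach (fun _ => k b) i χ d' ∧ RelDeform 3 ⟨Z, j ∘ k⟩ ⟨Y, i ∘ k⟩ := by
      intro T Z k j ψ d K b hT hk hd hK hb hK1
      obtain ⟨Y, i, χ, d', hY⟩ := T.exists_attach (m := 2) (fun _ => k b) continuousOn_const
        (fun _ _ => hk.mem_skelLT_iff.2 hb)
      refine ⟨Y, i, χ, d', hY, ?_⟩
      have := hd.relDeform_of_homotopy (d := 3) (by omega) (hT.mono (by omega)) hY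
        (H := fun p => k (K p)) (hk.continuous.comp_continuousOn hK)
        (fun u hu t => hT.mem_skelLT (by omega) _) (fun _ _ => rfl)
        (fun u hu => congrArg k (hK1 u hu))
      exact this.comp k
    obtain ⟨Y, i, χ, d, hY, hXY⟩ := slide hS hf₁ hatt hH hc hH1
    obtain ⟨Y', i', χ', d', hY', hXY'⟩ := slide hS' hf₁' hatt' hH' hc' hH1'
    -- the two constants are moved to each other along a path in `A`
    let α : Path c c' := PathConnectedSpace.somePath c c'
    obtain ⟨W, k, ω, b, hW⟩ := S'.exists_attach (m := 2) (fun _ => f₁' c) continuousOn_const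
      (fun _ _ => hf₁'.mem_skelLT_iff.2 hc)
    have hWY : RelDeform 3 ⟨W, k ∘ f₁'⟩ ⟨Y', i' ∘ f₁'⟩ :=
      (hW.relDeform_of_homotopy (d := 3) (by omega) (hS'.mono (by omega)) hY'
        (H := fun p => f₁' (α p.2))
        (hf₁'.continuous.comp (α.continuous.comp continuous_snd)).continuousOn
        (fun u hu t => hS'.mem_skelLT (by omega) _) (fun _ _ => by simp)
        (fun _ _ => by simp)).comp f₁'
    have hYW : RelDeform 3 ⟨Y, i ∘ f₁⟩ ⟨W, k ∘ f₁'⟩ :=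
      hrel.attach (m := 2) (γ := fun _ => c) (by omega) (hS.mono (by omega)) hY hW
    have e1 : g ∘ f₁ = f := funext hgf
    have e2 : g' ∘ f₁' = f' := funext hgf'
    rw [e1] at hXY
    rw [e2] at hXY'
    exact .trans _ _ _ hXY (.trans _ _ _ hYW (.trans _ _ _ hWY (.symm _ _ hXY')))

end FinCW

/-! ### Deformations relative to the boundary -/

/-- `ι` identifies a wedge of circles with a subgraph of the `1`-skeleton. -/
structure FinCW.IsBoundary {n : ℕ} (X : FinCW) (ι : WedgeCircles n → X) : Prop where
  continuous_ι : Continuous ι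
  injective_ι : Function.Injective ι
  base_ι : ∃ v : X.Cell 0, ι '' {WedgeCircles.base n} = X.openCell v
  circle_ι : ∀ i : Fin n, ∃ e : X.Cell 1, ι '' WedgeCircles.openCircle i = X.openCell e

namespace BdCW

variable {n : ℕ}

theorem isBoundary (A : BdCW n) : A.cx.IsBoundary A.ι :=
  ⟨A.continuous_ι, A.injective_ι, A.base_ι, A.circle_ι⟩

/-- The complex with boundary given by a complex and an identification of its boundary. -/
def ofBoundary (S : Σ X : FinCW, WedgeCircles n → X) (h : S.1.IsBoundary S.2) : BdCW n :=
  ⟨S.1, S.2, h.continuous_ι, h.injective_ι, h.base_ι, h.circle_ι⟩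

end BdCW

namespace FinCW

variable {n : ℕ}

theorem IsCellEmbedding.isBoundary_iff {X Y : FinCW} {g : X → Y} (hg : IsCellEmbedding g)
    {ι : WedgeCircles n → X} {κ : WedgeCircles n → Y} (h : ∀ w, g (ι w) = κ w) :
    X.IsBoundary ι ↔ Y.IsBoundary κ := by
  obtain rfl : g ∘ ι = κ := funext h
  have cells : ∀ {m : ℕ} (T : Set (WedgeCircles n)),
      (∃ v : X.Cell m, ι '' T = X.openCell v) ↔
        ∃ v : Y.Cell m, (g ∘ ι) '' T = Y.openCell v := by
    intro m T
    constructor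
    · rintro ⟨v, hv⟩
      obtain ⟨v', hv'⟩ := hg.cell m v
      exact ⟨v', by rw [image_comp, hv, hv']⟩
    · rintro ⟨v', hv'⟩
      obtain ⟨y, hy⟩ := Y.openCell_nonempty v'
      have hy' := hy
      rw [← hv'] at hy'
      obtain ⟨w, -, rfl⟩ := hy'
      obtain ⟨v, -, hv⟩ := hg.exists_cell hy
      refine ⟨v, hg.injective.image_injective ?_⟩
      rw [← image_comp, hv', hv]
  constructor
  · intro hι
    exact ⟨hg.continuous.comp hι.continuous_ι, hg.injective.comp hι.injective_ι,
      (cells _).1 hι.base_ι, fun i => (cells _).1 (hι.circle_ι i)⟩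
  · intro hκ
    exact ⟨hg.isClosedEmbedding.isInducing.continuous_iff.2 hκ.continuous_ι,
      hκ.injective_ι.of_comp, (cells _).2 hκ.base_ι, fun i => (cells _).2 (hκ.circle_ι i)⟩

/-- All complexes in a deformation under a wedge of circles have it as boundary as soon as one of
them does. -/
theorem RelDeform.bdDeform {d : ℕ} {S T : Σ X : FinCW, WedgeCircles n → X}
    (h : RelDeform d S T) : (S.1.IsBoundary S.2 ↔ T.1.IsBoundary T.2) ∧
      ∀ hS hT, BdCW.Deform d (BdCW.ofBoundary S hS) (BdCW.ofBoundary T hT) := by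
  induction h with
  | rel S T h =>
    obtain ⟨h1, h2, g, hg, h3⟩ := h
    exact ⟨(RelStep.isCellEmbedding h3).isBoundary_iff hg, fun hS hT =>
      .rel _ _ ⟨h1, h2, g, hg, h3⟩⟩
  | refl S => exact ⟨Iff.rfl, fun _ _ => .refl _⟩
  | symm _ _ _ ih => exact ⟨ih.1.symm, fun hS hT => .symm _ _ (ih.2 hT hS)⟩
  | trans S T U _ _ ih ih' =>
    exact ⟨ih.1.trans ih'.1, fun hS hU => .trans _ _ _ (ih.2 hS (ih.1.1 hS)) (ih'.2 _ hU)⟩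

/-! ### Invariance of the Euler characteristic -/

theorem finite_nonempty_cell (X : FinCW) : {m | Nonempty (X.Cell m)}.Finite := by
  have : {m | Nonempty (X.Cell m)} = range (fun p : Σ m, X.Cell m => p.1) := by
    ext m
    constructor
    · rintro ⟨i⟩
      exact ⟨⟨m, i⟩, rfl⟩
    · rintro ⟨⟨m, i⟩, rfl⟩
      exact ⟨i⟩
  rw [this]
  exact finite_range _

theorem IsCellEmbedding.natCard_cell {X Y : FinCW} {f : X → Y} (hf : IsCellEmbedding f) (k : ℕ) :
    Nat.card (Y.Cell k) =
      Nat.card (X.Cell k) + {j : Y.Cell k | ⟨k, j⟩ ∈ extraCells f}.ncard := by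
  choose τ hτ using hf.cell k
  have hτi : Function.Injective τ := by
    intro i j hij
    apply X.openCell_injective
    apply hf.injective.image_injective
    rw [hτ, hτ, hij]
  have hc : {j : Y.Cell k | ⟨k, j⟩ ∈ extraCells f} = (range τ)ᶜ := by
    ext j
    constructor
    · rintro hj ⟨i, rfl⟩
      change Disjoint (Y.openCell (τ i)) _ at hj
      rw [← hτ] at hj
      obtain ⟨x, hx⟩ := X.openCell_nonempty i
      exact Set.disjoint_left.1 hj (mem_image_of_mem f hx) (mem_range_self x)
    · intro hj
      refine (hf.range_or j).resolve_left ?_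
      rintro ⟨i, hi⟩
      exact hj ⟨i, Y.openCell_injective ((hτ i).symm.trans hi)⟩
  rw [hc, ← ncard_add_ncard_compl (range τ), ← image_univ, ncard_image_of_injective _ hτi,
    ncard_univ]

theorem ncard_cell_eq {X : FinCW} (k : ℕ) {m : ℕ} (e : X.Cell m) :
    {j : X.Cell k | (⟨k, j⟩ : Σ m, X.Cell m) = ⟨m, e⟩}.ncard = if k = m then 1 else 0 := by
  split_ifs with h
  · subst h
    have : {j : X.Cell k | (⟨k, j⟩ : Σ m, X.Cell m) = ⟨k, e⟩} = {e} := by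
      ext j
      simp
    rw [this, ncard_singleton]
  · have : {j : X.Cell k | (⟨k, j⟩ : Σ m, X.Cell m) = ⟨m, e⟩} = ∅ := by
      ext j
      simp only [mem_ofPred_eq, mem_empty_iff_false, iff_false]
      intro hj
      exact h (congrArg Sigma.fst hj)
    rw [this, ncard_empty]

theorem IsElemExpansion.exists_natCard_cell {X Y : FinCW} {f : X → Y} (h : IsElemExpansion f) :
    ∃ m, ∀ k, Nat.card (Y.Cell k) =
      Nat.card (X.Cell k) + ((if k = m then 1 else 0) + if k = m + 1 then 1 else 0) := by
  obtain ⟨hf, m, e, e', φ, he, he', hun, -⟩ := h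
  refine ⟨m, fun k => ?_⟩
  have hset : {j : Y.Cell k | ⟨k, j⟩ ∈ extraCells f} =
      {j : Y.Cell k | (⟨k, j⟩ : Σ m, Y.Cell m) = ⟨m, e⟩} ∪
        {j : Y.Cell k | (⟨k, j⟩ : Σ m, Y.Cell m) = ⟨m + 1, e'⟩} := by
    ext j
    constructor
    · intro hj
      obtain ⟨y, hy⟩ := Y.openCell_nonempty j
      have hy' : y ∈ range f ∪ Y.openCell e ∪ Y.openCell e' := hun ▸ mem_univ y
      rcases hy' with (hy' | hy') | hy'
      · exact absurd hy' (Set.disjoint_left.1 hj hy)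
      · exact Or.inl (cell_unique hy hy')
      · exact Or.inr (cell_unique hy hy')
    · rintro (hj | hj)
      · exact (show (⟨k, j⟩ : Σ m, Y.Cell m) ∈ extraCells f from hj ▸ he)
      · exact (show (⟨k, j⟩ : Σ m, Y.Cell m) ∈ extraCells f from hj ▸ he')
  have hdisj : Disjoint {j : Y.Cell k | (⟨k, j⟩ : Σ m, Y.Cell m) = ⟨m, e⟩}
      {j : Y.Cell k | (⟨k, j⟩ : Σ m, Y.Cell m) = ⟨m + 1, e'⟩} := by
    rw [Set.disjoint_left]
    intro j h1 h2
    have := congrArg Sigma.fst ((h1 : (⟨k, j⟩ : Σ m, Y.Cell m) = _).symm.trans h2)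
    simp at this
  rw [hf.natCard_cell, hset, ncard_union_eq hdisj, ncard_cell_eq, ncard_cell_eq]

theorem IsCellIso.natCard_cell {X Y : FinCW} {f : X → Y} (h : IsCellIso f) (k : ℕ) :
    Nat.card (Y.Cell k) = Nat.card (X.Cell k) := by
  have hset : {j : Y.Cell k | ⟨k, j⟩ ∈ extraCells f} = ∅ := by
    ext j
    simp only [mem_ofPred_eq, mem_empty_iff_false, iff_false]
    intro hj
    obtain ⟨y, hy⟩ := Y.openCell_nonempty j
    exact Set.disjoint_left.1 hj hy (h.2 y)
  rw [h.1.natCard_cell, hset, ncard_empty, add_zero]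

theorem Deform.eulerChar_eq {d : ℕ} {X Y : FinCW} (h : Deform d X Y) :
    X.eulerChar = Y.eulerChar := by
  induction h with
  | rel X Y h =>
    obtain ⟨-, -, f, h | h⟩ := h
    · simp only [eulerChar, h.natCard_cell]
    · obtain ⟨m, hm⟩ := h.exists_natCard_cell
      have hsum : ∀ a : ℕ, ∑ᶠ k : ℕ, (-1 : ℤ) ^ k * ((if k = a then 1 else 0 : ℕ) : ℤ) =
          (-1) ^ a := by
        intro a
        rw [finsum_eq_single _ a]
        · simp
        · intro k hk
          simp [hk]
      have hfin : ∀ a : ℕ, (Function.support fun k : ℕ =>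
          (-1 : ℤ) ^ k * ((if k = a then 1 else 0 : ℕ) : ℤ)).Finite := fun a =>
        (finite_singleton a).subset fun k hk => by
          by_contra hka
          exact hk (by simp [show k ≠ a from hka])
      have hfinX : (Function.support fun k : ℕ =>
          (-1 : ℤ) ^ k * (Nat.card (X.Cell k) : ℤ)).Finite :=
        X.finite_nonempty_cell.subset fun k hk => by
          by_contra hka
          rw [mem_ofPred_eq, not_nonempty_iff] at hka
          exact hk (by simp)
      have hY : Y.eulerChar = X.eulerChar + ((-1) ^ m + (-1) ^ (m + 1)) := by
        rw [← hsum m, ← hsum (m + 1), ← finsum_add_distrib (hfin _) (hfin _), eulerChar, eulerChar,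
          ← finsum_add_distrib hfinX (((hfin m).union (hfin (m + 1))).subset
            (Function.support_add _ _))]
        refine finsum_congr fun k => ?_
        rw [hm k]
        push_cast
        ring
      rw [hY, pow_succ]
      ring
  | refl _ => rfl
  | symm _ _ _ ih => exact ih.symm
  | trans _ _ _ _ _ ih ih' => exact ih.trans ih'

theorem IsEdgeLoops.eulerChar_eq {Z : FinCW} {z : Z} {n : ℕ} {ε : Fin n → Path z z}
    (h : Z.IsEdgeLoops ε) (hZ : Z.DimLE 2) :
    Z.eulerChar = 1 - n + Nat.card (Z.Cell 2) := by
  have h0 : Nat.card (Z.Cell 0) = 1 := by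
    obtain ⟨v, -⟩ := h.mem_vertex
    rw [Nat.card_eq_one_iff_exists]
    exact ⟨v, fun w => Z.openCell_injective (by rw [h.vertex, h.vertex])⟩
  have h1 : Nat.card (Z.Cell 1) = n := by
    choose c hc using h.edge
    have hbij : Function.Bijective c := by
      refine ⟨fun i j hij => h.inj i j (by rw [hc, hc, hij]), fun d => ?_⟩
      obtain ⟨i, hi⟩ := h.surj d
      exact ⟨i, Z.openCell_injective ((hc i).symm.trans hi)⟩
    rw [← Nat.card_congr (Equiv.ofBijective c hbij), Nat.card_fin]
  rw [eulerChar, finsum_eq_sum_of_support_subset (s := Finset.range 3)]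
  · simp only [Finset.sum_range_succ, Finset.sum_range_zero, h0, h1]
    push_cast
    ring
  · intro k hk
    rw [Finset.mem_coe, Finset.mem_range]
    by_contra hk3
    have := hZ k (by omega)
    exact hk (by simp)

end FinCW

/-! ### Complexes with a given generating tuple, and their unions -/

/-- The edge loops of a complex with one vertex make it a complex with boundary, whose boundary is
the whole `1`-skeleton. -/
theorem FinCW.Realizable.exists_bdCW {X : FinCW} {x : X} {n : ℕ} {t : Fin n → FundamentalGroup X x}
    (h : X.Realizable x t) :
    ∃ A : BdCW n, A.cx.DimLE 2 ∧ A.IsOneSkeleton ∧ FinCW.Deform 3 X A.cx ∧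
      PathConnectedSpace A.cx ∧ A.cx.eulerChar = 1 - n + Nat.card (A.cx.Cell 2) ∧
      ∃ ψ : FundamentalGroup X x ≃* FundamentalGroup A.cx (A.ι (WedgeCircles.base n)),
        ∀ i, ψ (t i) = ((WedgeCircles.loop i).map A.continuous_ι).cls := by
  obtain ⟨Z, z, ε, hε, hZ, hd, ψ, hψ⟩ := h
  obtain ⟨f, hf, hinj, rfl, hl, hc, hr⟩ := hε.exists_wedge
  obtain ⟨v, -⟩ := hε.mem_vertex
  have hv : Z.OneVertex := ⟨v, fun w => Z.openCell_injective (by rw [hε.vertex, hε.vertex])⟩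
  refine ⟨⟨Z, f, hf, hinj, ⟨v, by rw [image_singleton, hε.vertex]⟩, hc⟩, hZ,
    hr.trans Z.skelLT_two_eq_skeleton, hd, hv.pathConnectedSpace, hε.eulerChar_eq hZ, ψ,
    fun i => (hψ i).trans (congrArg Path.cls ?_)⟩
  ext s
  exact (hl i s).symm

namespace BdCW

open GlueSpace

variable {n : ℕ}

theorem IsOneSkeleton.range_eq {B : BdCW n} (hB : B.IsOneSkeleton) :
    range B.ι = B.cx.skelLT 2 :=
  Eq.trans hB B.cx.skelLT_two_eq_skeleton.symm

theorem ι_mem_skelLT (A : BdCW n) (w : WedgeCircles n) : A.ι w ∈ A.cx.skelLT 2 := by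
  rcases WedgeCircles.eq_base_or_mem w with rfl | ⟨i, hi⟩
  · obtain ⟨v, hv⟩ := A.base_ι
    exact ⟨0, by omega, v, hv ▸ mem_image_of_mem _ rfl⟩
  · obtain ⟨e, he⟩ := A.circle_ι i
    exact ⟨1, by omega, e, he ▸ mem_image_of_mem _ hi⟩

theorem isCellEmbedding_inl (A B : BdCW n) :
    FinCW.IsCellEmbedding (X := A.cx) (Y := glueCx A B) (inl A B) :=
  ⟨GlueSpace.continuous_inl, inl_injective, fun _ i =>
    (glue_openCell_inl A B i).imp fun _ h => h.symm⟩

/-- If the `1`-skeleton of `B` is its boundary, the cells which `B` contributes to the union with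
`A` are its `2`-cells. -/
theorem mem_extraCells_inl {A B : BdCW n} (hB2 : B.cx.DimLE 2) (hB : B.IsOneSkeleton)
    (p : Σ m, (glueCx A B).Cell m) :
    p ∈ FinCW.extraCells (A := A.cx) (X := glueCx A B) (inl A B) ↔
      ∃ j : B.cx.Cell 2, (glueCx A B).openCell p.2 = inr A B '' B.cx.openCell j := by
  constructor
  · intro hp
    rcases glue_openCell_cases A B p.2 with ⟨i, hi⟩ | ⟨j, hj⟩
    · obtain ⟨y, hy⟩ := A.cx.openCell_nonempty i
      exact absurd (mem_range_self y)
        (Set.disjoint_left.1 hp (hi ▸ mem_image_of_mem (inl A B) hy))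
    · obtain ⟨m, c⟩ := p
      change B.cx.Cell m at j
      have h1 : ¬ m < 2 := by
        intro hm
        obtain ⟨y, hy⟩ := B.cx.openCell_nonempty j
        obtain ⟨w, rfl⟩ := hB.range_eq ▸ B.cx.openCell_subset_skelLT hm j hy
        exact Set.disjoint_left.1 hp (hj ▸ mem_image_of_mem (inr A B) hy)
          ⟨A.ι w, inl_ι w⟩
      have h2 : ¬ 2 < m := fun hm => (hB2 m hm).false j
      obtain rfl : m = 2 := by omega
      exact ⟨j, hj⟩
  · rintro ⟨j, hj⟩
    refine Set.disjoint_left.2 fun x hx => ?_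
    rw [hj] at hx
    obtain ⟨y, hy, rfl⟩ := hx
    rintro ⟨a, ha⟩
    obtain ⟨w, -, rfl⟩ := inl_eq_inr.1 ha
    exact FinCW.notMem_skelLT hy le_rfl (hB.range_eq ▸ mem_range_self w)

theorem ncard_extraCells_inl {A B : BdCW n} (hB2 : B.cx.DimLE 2) (hB : B.IsOneSkeleton) :
    (FinCW.extraCells (A := A.cx) (X := glueCx A B) (inl A B)).ncard =
      Nat.card (B.cx.Cell 2) := by
  choose τ hτ using fun j : B.cx.Cell 2 => glue_openCell_inr A B j
  have hτi : Function.Injective fun j => (⟨2, τ j⟩ : Σ m, (glueCx A B).Cell m) := by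
    intro i j hij
    apply B.cx.openCell_injective
    apply (inr_injective (A := A) (B := B)).image_injective
    rw [← hτ, ← hτ, sigma_mk_injective hij]
  have himage : FinCW.extraCells (A := A.cx) (X := glueCx A B) (inl A B) =
      range fun j => (⟨2, τ j⟩ : Σ m, (glueCx A B).Cell m) := by
    ext p
    rw [mem_extraCells_inl hB2 hB]
    constructor
    · rintro ⟨j, hj⟩
      obtain ⟨y, hy⟩ := (glueCx A B).openCell_nonempty p.2
      exact ⟨j, FinCW.cell_unique (hτ j ▸ hj ▸ hy) hy⟩
    · rintro ⟨j, rfl⟩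
      exact ⟨j, hτ j⟩
  rw [himage, ← image_univ, ncard_image_of_injective _ hτi, ncard_univ]

/-- If the `1`-skeleton of `B` is its boundary and every boundary loop which is null-homotopic in
`B` is so in `A`, then the `2`-cells of `B` are attached to `A` along null-homotopic maps. -/
theorem hasNullCells_inl {A B : BdCW n} (hB2 : B.cx.DimLE 2) (hB : B.IsOneSkeleton)
    (hAB : ∀ {w : WedgeCircles n} {p : Path w w},
      (p.map B.continuous_ι).Homotopic (Path.refl _) →
        (p.map A.continuous_ι).Homotopic (Path.refl _)) :
    FinCW.HasNullCells (A := A.cx) (X := glueCx A B) (inl A B) := by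
  intro p hp
  obtain ⟨j, hj⟩ := (mem_extraCells_inl hB2 hB p).1 hp
  obtain ⟨e, he⟩ := glue_openCell_inr A B j
  have hep : (⟨2, e⟩ : Σ m, (glueCx A B).Cell m) = p := by
    obtain ⟨y, hy⟩ := (glueCx A B).openCell_nonempty p.2
    exact FinCW.cell_unique (he ▸ hj ▸ hy) hy
  have : Nonempty (WedgeCircles n) := ⟨WedgeCircles.base n⟩
  -- the attaching map of the cell, as a map to the wedge of circles
  let q : (Fin 2 → ℝ) → WedgeCircles n := fun u => Function.invFun B.ι (B.cx.cmap j u)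
  have hqι : ∀ u ∈ sphere (0 : Fin 2 → ℝ) 1, B.ι (q u) = B.cx.cmap j u := fun u hu =>
    Function.invFun_eq (hB.range_eq.superset (B.cx.cmap_mem_skelLT j hu))
  have hq : ContinuousOn q (sphere 0 1) := by
    rw [B.isClosedEmbedding_ι.isInducing.continuousOn_iff]
    exact ((B.cx.continuousOn_cmap j).mono sphere_subset_closedBall).congr hqι
  have hq' : ContinuousOn (A.ι ∘ q) (sphere 0 1) := A.continuous_ι.comp_continuousOn hq
  have hB0 : ((boundaryPath hq).map B.continuous_ι).Homotopic (Path.refl _) :=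
    homotopic_refl_of_square (B.cx.continuousOn_cmap j) fun t => hqι _ (sphereLoop_mem t)
  obtain ⟨H, hH, hH0, hH1⟩ := exists_homotopy_of_boundaryPath hq' (hAB hB0)
  refine ⟨e, hep, fun u => inr A B (B.cx.cmap j u), H, A.ι (q (sphereLoop 1)),
    GlueSpace.continuous_inr.comp_continuousOn (B.cx.continuousOn_cmap j),
    fun u hu v hv huv => B.cx.injOn_cmap j hu hv (inr_injective huv), ?_, hH, A.ι_mem_skelLT _,
    fun u hu => ⟨?_, hH1 u hu⟩⟩
  · rw [he]
    exact (image_image (inr A B) (B.cx.cmap j) _).symm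
  · rw [hH0 u hu]
    exact (congrArg (inr A B) (hqι u hu)).symm.trans (inl_ι _).symm

/-- If the boundary loops which die in `B` or in `B'` die in `A`, the unions of `A` with `B` and
with `B'` differ only by the number of `2`-cells which `B` and `B'` contribute. -/
theorem Deform.glue_of_null {A B B' : BdCW n} [PathConnectedSpace A.cx] (hA : A.cx.DimLE 2)
    (hB2 : B.cx.DimLE 2) (hB : B.IsOneSkeleton) (hB2' : B'.cx.DimLE 2) (hB' : B'.IsOneSkeleton)
    (hAB : ∀ {w : WedgeCircles n} {p : Path w w},
      (p.map B.continuous_ι).Homotopic (Path.refl _) →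
        (p.map A.continuous_ι).Homotopic (Path.refl _))
    (hAB' : ∀ {w : WedgeCircles n} {p : Path w w},
      (p.map B'.continuous_ι).Homotopic (Path.refl _) →
        (p.map A.continuous_ι).Homotopic (Path.refl _))
    (hcard : Nat.card (B.cx.Cell 2) = Nat.card (B'.cx.Cell 2)) :
    Deform 3 (BdCW.glue A B) (BdCW.glue A B') :=
  (((hasNullCells_inl hB2 hB hAB).relDeform hA (isCellEmbedding_inl A B)
    (isCellEmbedding_inl A B') (hasNullCells_inl hB2' hB' hAB')
    (by rw [ncard_extraCells_inl hB2 hB, ncard_extraCells_inl hB2' hB', hcard])).comp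
    A.ι).bdDeform.2 (BdCW.glue A B).isBoundary (BdCW.glue A B').isBoundary

end BdCW

theorem Kn.mk_eq {n : ℕ} {A B : BdCW n} {hA : A.cx.DimLE 2} {hB : B.cx.DimLE 2}
    (h : BdCW.Deform 3 A B) : Kn.mk A hA = Kn.mk B hB :=
  Quotient.sound (s := KnSetoid n) h

theorem theorem4p1 (L₁ L₂ : FinCW) (h₁ : L₁.DimLE 2) (h₂ : L₂.DimLE 2)
    [ConnectedSpace L₁] [ConnectedSpace L₂] (x₁ : L₁) (x₂ : L₂)
    (hπ : Nonempty (FundamentalGroup L₁ x₁ ≃* FundamentalGroup L₂ x₂))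
    (hχ : L₁.eulerChar = L₂.eulerChar) :
    ∃ (n : ℕ) (L₁' L₂' : BdCW n) (h₁' : L₁'.cx.DimLE 2) (h₂' : L₂'.cx.DimLE 2),
      L₁'.IsOneSkeleton ∧ L₂'.IsOneSkeleton ∧
      FinCW.Deform 3 L₁ L₁'.cx ∧ FinCW.Deform 3 L₂ L₂'.cx ∧
      ∀ (k : Type*) [CommRing k] (x : MonoidAlgebra k (Kn n)),
        x = MonoidAlgebra.single (Kn.mk L₁' h₁') 1 - MonoidAlgebra.single (Kn.mk L₂' h₂') 1 →
        x * x = 0 ∧ universalPairing x x = 0 := by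
  obtain ⟨φ⟩ := hπ
  obtain ⟨ι₁, _, t₁, r₁⟩ := L₁.exists_realizable h₁ x₁
  obtain ⟨ι₂, _, t₂, r₂⟩ := L₂.exists_realizable h₂ x₂
  let e : Fin (Nat.card (ι₁ ⊕ ι₂)) ≃ ι₁ ⊕ ι₂ := (Finite.equivFin _).symm
  -- the generators of both complexes, as elements of the first fundamental group
  let s : ι₁ ⊕ ι₂ → FundamentalGroup L₁ x₁ := Sum.elim t₁ (φ.symm ∘ t₂)
  have hs : φ ∘ s = Sum.elim t₂ (φ ∘ t₁) ∘ Equiv.sumComm ι₁ ι₂ := by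
    ext (i | i)
    · rfl
    · exact φ.apply_symm_apply _
  have R₁ : L₁.Realizable x₁ (s ∘ e) := (r₁.sum _).comp_equiv e
  have R₂ : L₂.Realizable x₂ ((φ ∘ s) ∘ e) := by
    rw [hs]
    exact ((r₂.sum _).comp_equiv _).comp_equiv e
  obtain ⟨A, hA, hA1, hdA, _, hχA, ψA, hψA⟩ := R₁.exists_bdCW
  obtain ⟨B, hB, hB1, hdB, _, hχB, ψB, hψB⟩ := R₂.exists_bdCW
  have hcard : Nat.card (A.cx.Cell 2) = Nat.card (B.cx.Cell 2) := by
    have := (hdA.eulerChar_eq.symm.trans hχ).trans hdB.eulerChar_eq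
    rw [hχA, hχB] at this
    omega
  let θ := ψA.symm.trans (φ.trans ψB)
  have hθ : ∀ i, θ ((WedgeCircles.loop i).map A.continuous_ι).cls =
      ((WedgeCircles.loop i).map B.continuous_ι).cls := by
    intro i
    rw [← hψA i, ← hψB i]
    exact congrArg (fun g => ψB (φ g)) (ψA.symm_apply_apply _)
  have hAB : ∀ {w : WedgeCircles (Nat.card (ι₁ ⊕ ι₂))} {p : Path w w},
      (p.map A.continuous_ι).Homotopic (Path.refl _) →
        (p.map B.continuous_ι).Homotopic (Path.refl _) := fun hp =>
    WedgeCircles.homotopic_refl_of_mulEquiv (f₁ := ⟨A.ι, A.continuous_ι⟩)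
      (f₂ := ⟨B.ι, B.continuous_ι⟩) θ hθ hp
  have hBA : ∀ {w : WedgeCircles (Nat.card (ι₁ ⊕ ι₂))} {p : Path w w},
      (p.map B.continuous_ι).Homotopic (Path.refl _) →
        (p.map A.continuous_ι).Homotopic (Path.refl _) := fun hp =>
    WedgeCircles.homotopic_refl_of_mulEquiv (f₁ := ⟨B.ι, B.continuous_ι⟩)
      (f₂ := ⟨A.ι, A.continuous_ι⟩) θ.symm (fun i => θ.symm_apply_eq.2 (hθ i).symm) hp
  have h1 : Kn.mk A hA * Kn.mk A hA = Kn.mk A hA * Kn.mk B hB :=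
    Kn.mk_eq (.glue_of_null hA hA hA1 hB hB1 id hBA hcard)
  have h2 : Kn.mk B hB * Kn.mk A hA = Kn.mk B hB * Kn.mk B hB :=
    Kn.mk_eq (.glue_of_null hB hA hA1 hB hB1 hAB id hcard)
  have h3 : Kn.mk A hA * Kn.mk B hB = Kn.mk B hB * Kn.mk A hA :=
    Kn.mk_eq (BdCW.glue_comm 3 (fun m hm => hA m (by omega)) fun m hm => hB m (by omega))
  refine ⟨_, A, B, hA, hB, hA1, hB1, hdA, hdB, ?_⟩
  rintro k _ x rfl
  have h0 : (MonoidAlgebra.single (Kn.mk A hA) (1 : k) - MonoidAlgebra.single (Kn.mk B hB) 1) *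
      (MonoidAlgebra.single (Kn.mk A hA) 1 - MonoidAlgebra.single (Kn.mk B hB) 1) = 0 := by
    rw [sub_mul, mul_sub, mul_sub, MonoidAlgebra.single_mul_single,
      MonoidAlgebra.single_mul_single, MonoidAlgebra.single_mul_single,
      MonoidAlgebra.single_mul_single, h1, ← h2, h3, sub_self]
  refine ⟨h0, ?_⟩
  rw [universalPairing, h0]
  exact Finsupp.mapDomain_zero
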